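/- **Theorem.** *Model.* Algorithms are race-free programs in the nested-parallel (fork–join) model with stack-allocated arrays; the control flow depends only on the problem size $n$ and on $\lceil\omega\rceil$, not on the input values, and the programs are cache-oblivious (they know neither the cache size $M$ nor the line size $B$). Work is the total number of operations in the series-parallel DAG of the computation, span is the length of a longest path in it. Cache complexity refers to the sequential depth-first execution in the ideal-cache model: the data memory is transferred in lines of $B$ words to and from an initially empty cache of $M$ words with optimal offline replacement, all operands of a data operation must be in the cache, and all modified lines are finally written back (indices and control data are kept in registers and are not counted). The symmetric cache complexity is the number of line transfers; the asymmetric one is the number of read transfers plus $\omega\ge 1$ times the number of write transfers. Matrices are stored in row-major order. For each of the following three problems there is one such algorithm (with $\lceil \omega\rceil$ replaced by $1$ in the symmetric case) that solves it for all $n\ge1$: 1. *Kleene's algorithm for all-pairs shortest paths.* Over an arbitrary semiring, the $n\times n$ matrix $A$ is replaced by $\mathrm{Kleene}(A)$, where $\mathrm{Kleene}(A)=A$ if $n = 1$, and otherwise, with $A=\begin{bmatrix}A_{00}&A_{01}\\A_{10}&A_{11}\end{bmatrix}$ partitioned at $\lfloor n/2\rfloor$, one executes in this order $A_{00}\gets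 \mathrm{Kleene}(A_{00})$, $A_{01}\gets A_{01}+A_{00}A_{01}$, $A_{10}\gets A_{10}+A_{10}A_{00}$, $A_{11}\gets A_{11}+A_{10}A_{01}$, $A_{11}\gets \mathrm{Kleene}(A_{11})$, $A_{01}\gets A_{01}+A_{01}A_{11}$, $A_{10}\gets A_{10}+A_{11}A_{10}$, $A_{00}\gets A_{00}+A_{01}A_{10}$. In particular, over the $(\min,+)$ semiring on $\mathbb R\cup\{\infty\}$, if $A$ is the weight matrix, with zero diagonal, of a directed graph on $n$ vertices without negative cycles, then the result is the matrix of shortest-path distances. 2. *Gaussian elimination without pivoting.* Over an arbitrary field, if no elimination step divides by zero, the $n\times n$ matrix $A$ is replaced by the upper triangular matrix $U$ that elimination leaves (on and above the diagonal) and the multipliers $L$ (below the diagonal), and $A=LU$ with $L$ completed by ones on the diagonal. 3. *Triangular system solver.* Over an arbitrary field, given a lower triangular $n\times n$ matrix $T$ with nonzero diagonal entries and an $n\times n$ matrix $Y$, the matrix $Y$ is replaced by the $X$ with $TX=Y$. Each of the three algorithms has $\Theta(n^3)$ work and $O(n)$ span, uniformly in $\omega$. There is a constant $\ell$ such that, whenever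 the cache has at least $\ell$ lines ($M\ge \ell B$) and is tall ($M=\Omega(B^2)$), the following holds. If $n^2=\Omega(M)$, then the symmetric cache complexity is $$O\left(\frac{n^3}{B\sqrt M}\right),$$ and if $n=\Omega(\omega^{2/3}M)$, then the asymmetric cache complexity is $$O\left(\frac{\omega^{1/3}n^3}{B\sqrt M}\right).$$ Here the constants in the $O$-bounds on the cache complexity depend only on the constants in the $\Omega$-assumptions. -/

import Mathlib

open scoped ENNReal

universe u

/-! ## Algorithms: a nested-parallel language -/

/-- Integer expressions over the integer registers of a task. The expressions in a program do not depend
on its input, so evaluating one takes constant time. -/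
inductive IExpr where
  | lit (c : ℕ)
  | var (i : ℕ)
  | add (e f : IExpr)
  | sub (e f : IExpr)
  | mul (e f : IExpr)
  | div (e f : IExpr)

/-- The value of an expression; `ρ` lists the contents of the registers. -/
def IExpr.eval (ρ : List ℕ) : IExpr → ℕ
  | lit c => c
  | var i => ρ.getD i 0
  | add e f => e.eval ρ + f.eval ρ
  | sub e f => e.eval ρ - f.eval ρ
  | mul e f => e.eval ρ * f.eval ρ
  | div e f => e.eval ρ / f.eval ρ

/-- Statements. The type `σ` lists the binary data operations of the machine. Data is only touched by
`op o d a b`, which sets cell `d` of the memory to `o` of cells `a` and `b`; control depends on integer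
registers only. `fork s t` creates two tasks that may run in parallel and joins them. `alloc e s` runs
`s` with a fresh stack-allocated array of `e` cells, whose first address is the new register `0`
(the other registers are shifted by one), and frees the array afterwards. `call p args` runs procedure
`p` on the given arguments. -/
inductive Stmt (σ : Type) where
  | skip
  | op (o : σ) (d a b : IExpr)
  | seq (s t : Stmt σ)
  | fork (s t : Stmt σ)
  | ifLe (e f : IExpr) (s t : Stmt σ)
  | alloc (e : IExpr) (s : Stmt σ)
  | call (p : ℕ) (args : List IExpr)

/-- An algorithm is a finite list of procedures that may call each other recursively;
execution starts with procedure `0`. -/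
abbrev Program (σ : Type) := List (Stmt σ)

/-- A finished computation: the series-parallel DAG of the operations that were executed.
A `step` is an operation that does not touch data memory (a test, a call). -/
inductive Comp (σ : Type) where
  | step
  | op (o : σ) (d a b : ℕ)
  | seq (p q : Comp σ)
  | fork (p q : Comp σ)
  | alloc (s : ℕ) (p : Comp σ)

/-- `Unfolds P sp ρ s c`: executing `s` with registers `ρ`, when the addresses below `sp` are allocated,
terminates and gives the computation `c`. -/
inductive Unfolds {σ : Type} (P : Program σ) : ℕ → List ℕ → Stmt σ → Comp σ → Prop where
  | skip (sp : ℕ) (ρ : List ℕ) : Unfolds P sp ρ .skip .step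
  | op (sp : ℕ) (ρ : List ℕ) (o : σ) (d a b : IExpr) :
      Unfolds P sp ρ (.op o d a b) (.op o (d.eval ρ) (a.eval ρ) (b.eval ρ))
  | seq {sp : ℕ} {ρ : List ℕ} {s t : Stmt σ} {p q : Comp σ} :
      Unfolds P sp ρ s p → Unfolds P sp ρ t q → Unfolds P sp ρ (.seq s t) (.seq p q)
  | fork {sp : ℕ} {ρ : List ℕ} {s t : Stmt σ} {p q : Comp σ} :
      Unfolds P sp ρ s p → Unfolds P sp ρ t q → Unfolds P sp ρ (.fork s t) (.fork p q)
  | ifTrue {sp : ℕ} {ρ : List ℕ} {e f : IExpr} {s t : Stmt σ} {p : Comp σ} :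
      e.eval ρ ≤ f.eval ρ → Unfolds P sp ρ s p → Unfolds P sp ρ (.ifLe e f s t) (.seq .step p)
  | ifFalse {sp : ℕ} {ρ : List ℕ} {e f : IExpr} {s t : Stmt σ} {p : Comp σ} :
      ¬ e.eval ρ ≤ f.eval ρ → Unfolds P sp ρ t p → Unfolds P sp ρ (.ifLe e f s t) (.seq .step p)
  | alloc {sp : ℕ} {ρ : List ℕ} {e : IExpr} {s : Stmt σ} {p : Comp σ} :
      Unfolds P (sp + e.eval ρ) (sp :: ρ) s p → Unfolds P sp ρ (.alloc e s) (.alloc (e.eval ρ) p)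
  | call {sp : ℕ} {ρ : List ℕ} {i : ℕ} {args : List IExpr} {s : Stmt σ} {p : Comp σ} :
      P[i]? = some s → Unfolds P sp (args.map (IExpr.eval ρ)) s p →
        Unfolds P sp ρ (.call i args) (.seq .step p)

namespace Comp

variable {σ : Type}

/-! ## Work, span, races -/

/-- Work: the total number of operations in the DAG. -/
def work : Comp σ → ℕ
  | step => 1
  | op _ _ _ _ => 1
  | seq p q => p.work + q.work
  | fork p q => p.work + q.work + 1
  | alloc _ p => p.work + 1

/-- Span (depth): the length of a longest path in the DAG. -/
def span : Comp σ → ℕ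
  | step => 1
  | op _ _ _ _ => 1
  | seq p q => p.span + q.span
  | fork p q => max p.span q.span + 1
  | alloc _ p => p.span + 1

/-- The memory cells that are read. -/
def reads : Comp σ → Set ℕ
  | step => ∅
  | op _ _ a b => {a, b}
  | seq p q => p.reads ∪ q.reads
  | fork p q => p.reads ∪ q.reads
  | alloc _ p => p.reads

/-- The memory cells that are written. -/
def writes : Comp σ → Set ℕ
  | step => ∅
  | op _ d _ _ => {d}
  | seq p q => p.writes ∪ q.writes
  | fork p q => p.writes ∪ q.writes
  | alloc _ p => p.writes

/-- Only allocated cells are accessed. -/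
def InScope : ℕ → Comp σ → Prop
  | _, step => True
  | sp, op _ d a b => d < sp ∧ a < sp ∧ b < sp
  | sp, seq p q => p.InScope sp ∧ q.InScope sp
  | sp, fork p q => p.InScope sp ∧ q.InScope sp
  | sp, alloc s p => p.InScope (sp + s)

/-- Race-freeness: of two logically parallel tasks, neither writes a cell that the other accesses.
The cells shared by the two tasks of a `fork` are those below the stack pointer `sp` at the fork; what
a task allocates later lies on its own branch of the stack. -/
def RaceFree : ℕ → Comp σ → Prop
  | _, step => True
  | _, op _ _ _ _ => True
  | sp, seq p q => p.RaceFree sp ∧ q.RaceFree sp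
  | sp, fork p q => p.RaceFree sp ∧ q.RaceFree sp ∧
      ∀ x < sp, (x ∈ p.writes → x ∉ q.reads ∪ q.writes) ∧ (x ∈ q.writes → x ∉ p.reads ∪ p.writes)
  | sp, alloc s p => p.RaceFree (sp + s)

/-! ## Semantics -/

/-- The memory after a computation, for data in `R` and an interpretation `I` of the operations.
Freshly allocated cells are not initialised: they hold arbitrary data `junk`. -/
def run {R : Type u} (I : σ → R → R → R) (junk : ℕ → R) : ℕ → Comp σ → (ℕ → R) → (ℕ → R)
  | _, step, m => m
  | _, op o d a b, m => Function.update m d (I o (m a) (m b))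
  | sp, seq p q, m => run I junk sp q (run I junk sp p m)
  | sp, fork p q, m => run I junk sp q (run I junk sp p m)
  | sp, alloc s p, m => run I junk (sp + s) p (fun x => if sp ≤ x ∧ x < sp + s then junk x else m x)

/-- The memory accesses `(d, a, b)` (destination, two sources) in the sequential, depth-first order
of execution. -/
def trace : Comp σ → List (ℕ × ℕ × ℕ)
  | step => []
  | op _ d a b => [(d, a, b)]
  | seq p q => p.trace ++ q.trace
  | fork p q => p.trace ++ q.trace
  | alloc _ p => p.trace

end Comp

/-! ## The ideal-cache model -/

/-- `CacheRun M B tr S D r w`: if the cache has `M` words and lines of `B` words, the lines in `S` are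
in the cache and those in `D` are in the cache and modified, then the accesses `tr` can be served with
`r` line reads from main memory and `w` line writes to it, the data being in main memory at the end.
All choices of lines to load and evict are allowed (offline replacement). -/
inductive CacheRun (M B : ℕ) : List (ℕ × ℕ × ℕ) → Finset ℕ → Finset ℕ → ℕ → ℕ → Prop where
  | done (S : Finset ℕ) : CacheRun M B [] S ∅ 0 0
  | load {tr : List (ℕ × ℕ × ℕ)} {S D : Finset ℕ} {r w : ℕ} (l : ℕ) :
      (insert l S).card * B ≤ M → CacheRun M B tr (insert l S) D r w → CacheRun M B tr S D (r + 1) w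
  | evict {tr : List (ℕ × ℕ × ℕ)} {S D : Finset ℕ} {r w : ℕ} (l : ℕ) :
      l ∉ D → CacheRun M B tr (S.erase l) D r w → CacheRun M B tr S D r w
  | writeBack {tr : List (ℕ × ℕ × ℕ)} {S D : Finset ℕ} {r w : ℕ} (l : ℕ) :
      l ∈ D → CacheRun M B tr S (D.erase l) r w → CacheRun M B tr S D r (w + 1)
  | exec {tr : List (ℕ × ℕ × ℕ)} {S D : Finset ℕ} {r w : ℕ} (d a b : ℕ) :
      d / B ∈ S → a / B ∈ S → b / B ∈ S → CacheRun M B tr S (insert (d / B) D) r w →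
        CacheRun M B ((d, a, b) :: tr) S D r w

namespace Comp

variable {σ : Type}

/-- Symmetric cache complexity: the least number of transferred cache lines, starting with an
empty cache (`∞` if the computation is impossible with that cache). -/
noncomputable def symCacheCost (M B : ℕ) (c : Comp σ) : ℝ≥0∞ :=
  ⨅ (r : ℕ) (w : ℕ) (_ : CacheRun M B c.trace ∅ ∅ r w), ((r : ℝ≥0∞) + (w : ℝ≥0∞))

/-- Asymmetric cache complexity: a write transfer costs `ω`, a read transfer costs `1`. -/
noncomputable def asymCacheCost (M B : ℕ) (ω : ℝ) (c : Comp σ) : ℝ≥0∞ :=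
  ⨅ (r : ℕ) (w : ℕ) (_ : CacheRun M B c.trace ∅ ∅ r w), ((r : ℝ≥0∞) + ENNReal.ofReal ω * (w : ℝ≥0∞))

end Comp

/-! ## Cost bounds -/

/-- `G n w` is the computation of `P` on arguments `n` (the size of the problem) and `w` (the write
cost, rounded up), for an input that occupies the first `size n` memory cells. The program is given
neither the cache size nor the line size, and `G n w` does not depend on the input values. -/
def Generates {σ : Type} (P : Program σ) (size : ℕ → ℕ) (G : ℕ → ℕ → Comp σ) : Prop :=
  ∀ n w : ℕ, 1 ≤ n → 1 ≤ w → Unfolds P (size n) [n, w] (.call 0 [.var 0, .var 1]) (G n w)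

/-- All computations use only allocated memory and are race-free. -/
def Safe {σ : Type} (size : ℕ → ℕ) (G : ℕ → ℕ → Comp σ) : Prop :=
  ∀ n w : ℕ, 1 ≤ n → 1 ≤ w → (G n w).InScope (size n) ∧ (G n w).RaceFree (size n)

/-- `Θ(n³)` work. -/
def CubicWork {σ : Type} (G : ℕ → ℕ → Comp σ) : Prop :=
  ∃ c C : ℝ, 0 < c ∧ 0 < C ∧ ∀ n w : ℕ, 1 ≤ n → 1 ≤ w →
    c * (n : ℝ) ^ 3 ≤ ((G n w).work : ℝ) ∧ ((G n w).work : ℝ) ≤ C * (n : ℝ) ^ 3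

/-- `O(n)` span. -/
def LinearSpan {σ : Type} (G : ℕ → ℕ → Comp σ) : Prop :=
  ∃ C : ℝ, 0 < C ∧ ∀ n w : ℕ, 1 ≤ n → 1 ≤ w → ((G n w).span : ℝ) ≤ C * (n : ℝ)

/-- Symmetric cache complexity `O(n³ / (B √M))`, for tall caches `M = Ω(B²)` with at least a constant
number of lines, and inputs that are not smaller than the cache, `n² = Ω(M)`. The constant depends only
on the constant `κ` in these assumptions. -/
def SymCacheBound {σ : Type} (G : ℕ → ℕ → Comp σ) : Prop :=
  ∃ lines : ℕ, ∀ κ : ℝ, 0 < κ → ∃ C : ℝ, 0 < C ∧ ∀ M B n : ℕ, 1 ≤ B → 1 ≤ n →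
    lines * B ≤ M → κ * (B : ℝ) ^ 2 ≤ (M : ℝ) → κ * (M : ℝ) ≤ (n : ℝ) ^ 2 →
    (G n 1).symCacheCost M B ≤ ENNReal.ofReal (C * ((n : ℝ) ^ 3 / ((B : ℝ) * √(M : ℝ))))

/-- Asymmetric cache complexity `O(ω^(1/3) n³ / (B √M))`, for tall caches as above and
`n = Ω(ω^(2/3) M)`, with a constant that depends only on the constant `κ` in these assumptions. -/
def AsymCacheBound {σ : Type} (G : ℕ → ℕ → Comp σ) : Prop :=
  ∃ lines : ℕ, ∀ κ : ℝ, 0 < κ → ∃ C : ℝ, 0 < C ∧ ∀ (ω : ℝ) (M B n : ℕ), 1 ≤ ω → 1 ≤ B → 1 ≤ n →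
    lines * B ≤ M → κ * (B : ℝ) ^ 2 ≤ (M : ℝ) →
    κ * (ω ^ (2 / 3 : ℝ) * (M : ℝ)) ≤ (n : ℝ) →
    (G n ⌈ω⌉₊).asymCacheCost M B ω ≤
      ENNReal.ofReal (C * (ω ^ (1 / 3 : ℝ) * (n : ℝ) ^ 3 / ((B : ℝ) * √(M : ℝ))))

/-! ## Data operations -/

/-- Data operations over a semiring. -/
inductive SemiringOp where
  | zero | one | copy | add | mul

def SemiringOp.interp {R : Type u} [Semiring R] : SemiringOp → R → R → R
  | zero, _, _ => 0
  | one, _, _ => 1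
  | copy, x, _ => x
  | add, x, y => x + y
  | mul, x, y => x * y

/-- Data operations over a field. -/
inductive FieldOp where
  | zero | one | copy | add | sub | mul | div

def FieldOp.interp {K : Type u} [Field K] : FieldOp → K → K → K
  | zero, _, _ => 0
  | one, _, _ => 1
  | copy, x, _ => x
  | add, x, y => x + y
  | sub, x, y => x - y
  | mul, x, y => x * y
  | div, x, y => x / y

/-- The memory `m` holds the matrix `A` in row-major order from address `base` on. -/
def Holds {R : Type u} {n : ℕ} (m : ℕ → R) (base : ℕ) (A : Matrix (Fin n) (Fin n) R) : Prop :=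
  ∀ i j : Fin n, m (base + (i : ℕ) * n + (j : ℕ)) = A i j

/-! ## Kleene's algorithm and shortest paths -/

/-- The indices `lo, …, lo + len - 1`. -/
def indexBlock (n lo len : ℕ) : Finset (Fin n) :=
  Finset.univ.filter fun i => lo ≤ (i : ℕ) ∧ (i : ℕ) < lo + len

/-- `A[I,J] ← A[I,J] + A[I,K] · A[K,J]`. -/
def gridUpdate {R : Type u} [Semiring R] {n : ℕ} (I J K : Finset (Fin n))
    (A : Matrix (Fin n) (Fin n) R) : Matrix (Fin n) (Fin n) R :=
  fun i j => if i ∈ I ∧ j ∈ J then A i j + ∑ k ∈ K, A i k * A k j else A i j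

/-- Kleene's algorithm on the diagonal block of `A` with indices `lo, …, lo + len - 1`,
partitioned into quadrants at the middle. -/
def kleene {R : Type u} [Semiring R] {n : ℕ} (lo len : ℕ) (A : Matrix (Fin n) (Fin n) R) :
    Matrix (Fin n) (Fin n) R :=
  if _h : len ≤ 1 then A
  else
    let I₀ := indexBlock n lo (len / 2)
    let I₁ := indexBlock n (lo + len / 2) (len - len / 2)
    let A := kleene lo (len / 2) A
    let A := gridUpdate I₀ I₁ I₀ A
    let A := gridUpdate I₁ I₀ I₀ A
    let A := gridUpdate I₁ I₁ I₀ A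
    let A := kleene (lo + len / 2) (len - len / 2) A
    let A := gridUpdate I₀ I₁ I₁ A
    let A := gridUpdate I₁ I₀ I₁ A
    gridUpdate I₀ I₀ I₁ A
termination_by len
decreasing_by all_goals omega

/-- `WalkWeight e i j x`: some walk from `i` to `j` has total weight `x`, in the directed graph with
edge weights `e` (`⊤` for a missing edge). -/
inductive WalkWeight {n : ℕ} (e : Fin n → Fin n → WithTop ℝ) : Fin n → Fin n → WithTop ℝ → Prop where
  | nil (i : Fin n) : WalkWeight e i i 0
  | cons (i : Fin n) {k j : Fin n} {x : WithTop ℝ} : WalkWeight e k j x → WalkWeight e i j (e i k + x)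

def NoNegativeCycle {n : ℕ} (e : Fin n → Fin n → WithTop ℝ) : Prop :=
  ∀ (i : Fin n) (x : WithTop ℝ), WalkWeight e i i x → 0 ≤ x

/-- The initial distance matrix, over the semiring with `min` as addition and `+` as multiplication. -/
def distInit {n : ℕ} (e : Fin n → Fin n → WithTop ℝ) : Matrix (Fin n) (Fin n) (Tropical (WithTop ℝ)) :=
  fun i j => Tropical.trop (if i = j then 0 else e i j)

/-! ## Gaussian elimination without pivoting -/

/-- The matrix after the first `k` elimination steps. -/
def elim {K : Type u} [Field K] {n : ℕ} (A : Matrix (Fin n) (Fin n) K) :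
    ℕ → Matrix (Fin n) (Fin n) K
  | 0 => A
  | k + 1 => fun i j =>
      if h : k < (i : ℕ) then
        let r : Fin n := ⟨k, h.trans i.isLt⟩
        elim A k i j - elim A k i r / elim A k r r * elim A k r j
      else elim A k i j

/-- No step of the elimination divides by zero. -/
def PivotsNonzero {K : Type u} [Field K] {n : ℕ} (A : Matrix (Fin n) (Fin n) K) : Prop :=
  ∀ k : Fin n, (k : ℕ) + 1 < n → elim A k k k ≠ 0

/-- The matrix that Gaussian elimination leaves. -/
def upperFactor {K : Type u} [Field K] {n : ℕ} (A : Matrix (Fin n) (Fin n) K) :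
    Matrix (Fin n) (Fin n) K := elim A n

/-- The unit lower triangular matrix of the multipliers of the elimination. -/
def lowerFactor {K : Type u} [Field K] {n : ℕ} (A : Matrix (Fin n) (Fin n) K) :
    Matrix (Fin n) (Fin n) K :=
  fun i j => if j < i then elim A j i j / elim A j j j else if i = j then 1 else 0

/-! ## Correctness of the algorithms -/

/-- The computations run Kleene's algorithm in place, over every semiring, and for a graph without
negative cycles the result consists of the shortest-path distances. -/
def ComputesKleene (G : ℕ → ℕ → Comp SemiringOp) : Prop :=
  (∀ (R : Type u) [Semiring R] (n w : ℕ) (A : Matrix (Fin n) (Fin n) R) (m junk : ℕ → R),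
    1 ≤ n → 1 ≤ w → Holds m 0 A →
      Holds ((G n w).run SemiringOp.interp junk (n ^ 2) m) 0 (kleene 0 n A)) ∧
  (∀ (n w : ℕ) (e : Fin n → Fin n → WithTop ℝ) (m junk : ℕ → Tropical (WithTop ℝ)),
    1 ≤ n → 1 ≤ w → NoNegativeCycle e → Holds m 0 (distInit e) →
      ∃ dist : Fin n → Fin n → WithTop ℝ, (∀ i j, IsLeast {x | WalkWeight e i j x} (dist i j)) ∧
        Holds ((G n w).run SemiringOp.interp junk (n ^ 2) m) 0
          (fun i j => Tropical.trop (dist i j)))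

/-- Over every field, the computations replace a matrix by the two factors that Gaussian elimination
without pivoting computes: the multipliers below the diagonal, the upper triangular matrix on and above
it; and these factors form an LU decomposition of the matrix. -/
def ComputesGaussianElimination (G : ℕ → ℕ → Comp FieldOp) : Prop :=
  ∀ (K : Type u) [Field K] (n w : ℕ) (A : Matrix (Fin n) (Fin n) K) (m junk : ℕ → K),
    1 ≤ n → 1 ≤ w → PivotsNonzero A → Holds m 0 A →
      Holds ((G n w).run FieldOp.interp junk (n ^ 2) m) 0
        (fun i j => if j < i then lowerFactor A i j else upperFactor A i j) ∧
      (∀ i j : Fin n, j < i → upperFactor A i j = 0) ∧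
      lowerFactor A * upperFactor A = A

/-- Over every field, for a lower triangular matrix `T` with nonzero diagonal entries and a matrix `B`
stored behind it, the computations replace `B` by a matrix `X` with `T X = B`. -/
def SolvesTriangularSystem (G : ℕ → ℕ → Comp FieldOp) : Prop :=
  ∀ (K : Type u) [Field K] (n w : ℕ) (T B : Matrix (Fin n) (Fin n) K) (m junk : ℕ → K),
    1 ≤ n → 1 ≤ w → (∀ i j : Fin n, i < j → T i j = 0) → (∀ i : Fin n, T i i ≠ 0) →
    Holds m 0 T → Holds m (n ^ 2) B →
      ∃ X : Matrix (Fin n) (Fin n) K, T * X = B ∧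
        Holds ((G n w).run FieldOp.interp junk (2 * n ^ 2) m) (n ^ 2) X

/-! All three algorithms recurse on blocks, and their cubic work is done by products of submatrices
with comparable sides. Everything therefore rests on one cache-oblivious product `C ← C + φ(A Bᵀ)`
(`mmC`) with a parameter `r` that trades reads for writes. While `k ≤ r (p + q) + 1` it halves the
longer of `p` and `q`, otherwise it halves `k`, so it aims at bricks with `k ≈ r (p + q)`.

Let `t` be of order `√M`. Once `p + q` has dropped to about `t`, the block of `C` and all
temporaries below it stay in the cache during a brick with `k ≈ r t`. They are written back once,
which makes `t²/B` writes for a volume of `r t³`, hence `1/(B r t)` writes per scalar product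
(`serves_mmC`). Inside the brick only `A` and `B` are streamed. When `(p + q) k ≈ t²`, that is `p +
q ≈ t/√r` and `k ≈ √r t`, both operands fit as well; `t²/B` reads serve a volume of `t³/√r`, hence
`√r/(B t)` reads per scalar product (`streams_mmC`). With `r ≈ ω^(2/3)` both reads and weighted
writes become `ω^(1/3) n³/(B √M)`.

A split of `k` runs its halves in parallel, one of them into a zeroed temporary. A temporary of `p
q` cells appears only when `k` exceeds `r (p + q)`, so the stack stays small (`extent_mmC_le`). Only
a single cell sums its `k ≤ 2 r + 1` products sequentially, so the span is `O(r + log²)`. The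
operands are first copied to the stack (`gemmC`), with `B` transposed. This makes the long dimension
contiguous and allows the target to overlap its operands.

Kleene's algorithm and LU make two sequential calls of half size. They replace `r` by `⌈2r/5⌉`, and
`2/5` satisfies three constraints. The cubes of the halves sum to at most a third of `m³`, so the
recursive writes are at most `5/2 · 1/3 < 1` times the bound. Two calls have total ratio about `4/5
r`, so the spans sum to `O(n + r)` (`span_halves_le`). Finally `2/5 < 1/2`, so `r t` stays `O(m)`
(`Level.half`). The top level thus dominates the cache cost; when `m ≤ t` the block and its stack
fit into the cache (`cheap_of_fits`).

The program finds `r` by doubling until `w² ≤ r³` or `n ≤ r`. The cap at `n` gives span `O(n)`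
uniformly in `ω`. It costs only a constant in the asymmetric bound, where `n = Ω(ω^(2/3) M)`.

Triangular systems are solved through `N = 1 - V⁻¹`, computed in a copy on the stack; the two
diagonal halves are inverted in parallel. Then `V⁻¹ Y = Y - N Y` is one more product. LU uses this
twice per level, for `L₀₀⁻¹ A₀₁` and, with a transposed copy, for `A₁₀ U₀₀⁻¹`.

Correctness of Kleene's algorithm over a semiring is literal. For shortest paths, every entry is the
weight of a walk, and the result satisfies the triangle inequality (`kleene_le_mul`). For LU, the
elimination steps telescope to `eq_natElim_add_sum`, from which the block identities and `A = L U`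
are read off. -/

/-! ## Basic facts about computations -/

namespace Comp

variable {σ : Type}

/-- The number of stack cells that a computation uses. -/
def extent : Comp σ → ℕ
  | step => 0
  | op _ _ _ _ => 0
  | seq p q => max p.extent q.extent
  | fork p q => max p.extent q.extent
  | alloc s p => s + p.extent

/-- A computation preceded by one step of control. -/
abbrev tick (p : Comp σ) : Comp σ := .seq .step p

/-- Every access writes to `W` and reads from `X`. -/
def Touches (c : Comp σ) (W X : ℕ → Prop) : Prop :=
  ∀ e ∈ c.trace, W e.1 ∧ X e.2.1 ∧ X e.2.2

theorem mem_writes {c : Comp σ} {x : ℕ} : x ∈ c.writes ↔ ∃ e ∈ c.trace, e.1 = x := by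
  induction c with
  | step => simp [writes, trace]
  | op o d a b => simp [writes, trace, eq_comm]
  | seq p q hp hq | fork p q hp hq =>
    simp only [writes, trace, Set.mem_union, hp, hq, List.mem_append, or_and_right, exists_or]
  | alloc s p hp => simpa [writes, trace] using hp

theorem mem_reads {c : Comp σ} {x : ℕ} : x ∈ c.reads ↔ ∃ e ∈ c.trace, e.2.1 = x ∨ e.2.2 = x := by
  induction c with
  | step => simp [reads, trace]
  | op o d a b => simp [reads, trace, eq_comm]
  | seq p q hp hq | fork p q hp hq =>
    simp only [reads, trace, Set.mem_union, hp, hq, List.mem_append, or_and_right, exists_or]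
  | alloc s p hp => simpa [reads, trace] using hp

namespace Touches

variable {W X W' X' : ℕ → Prop} {p q : Comp σ}

theorem mono (h : p.Touches W X) (hW : ∀ x, W x → W' x) (hX : ∀ x, X x → X' x) :
    p.Touches W' X' := fun e he =>
  ⟨hW _ (h e he).1, hX _ (h e he).2.1, hX _ (h e he).2.2⟩

theorem step : (Comp.step : Comp σ).Touches W X := by simp [Touches, trace]

theorem op {o : σ} {d a b : ℕ} (hd : W d) (ha : X a) (hb : X b) :
    (Comp.op o d a b).Touches W X := by simp [Touches, trace, hd, ha, hb]

theorem seq (hp : p.Touches W X) (hq : q.Touches W X) : (Comp.seq p q).Touches W X := by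
  intro e he
  rcases List.mem_append.1 he with h | h
  exacts [hp e h, hq e h]

theorem tick (hp : p.Touches W X) : p.tick.Touches W X := seq step hp

theorem fork (hp : p.Touches W X) (hq : q.Touches W X) : (Comp.fork p q).Touches W X := by
  intro e he
  rcases List.mem_append.1 he with h | h
  exacts [hp e h, hq e h]

theorem alloc {s : ℕ} (hp : p.Touches W X) : (Comp.alloc s p).Touches W X := hp

/-- Footprints may be overestimates, and they need to be disjoint only below `sp`: the stack of each
branch is private. This is why all later footprints can contain every address from `sp` on. -/
theorem raceFree_fork {W₁ X₁ W₂ X₂ : ℕ → Prop} {sp : ℕ} (hp : p.RaceFree sp) (hq : q.RaceFree sp)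
    (tp : p.Touches W₁ X₁) (tq : q.Touches W₂ X₂)
    (h₁ : ∀ x < sp, W₁ x → ¬ X₂ x ∧ ¬ W₂ x) (h₂ : ∀ x < sp, W₂ x → ¬ X₁ x ∧ ¬ W₁ x) :
    (Comp.fork p q).RaceFree sp := by
  refine ⟨hp, hq, fun x hx => ⟨fun hxp hxq => ?_, fun hxq hxp => ?_⟩⟩
  · obtain ⟨e, he, rfl⟩ := mem_writes.1 hxp
    have := h₁ _ hx (tp e he).1
    rcases hxq with hxq | hxq
    · obtain ⟨f, hf, h | h⟩ := mem_reads.1 hxq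
      · exact this.1 (h ▸ (tq f hf).2.1)
      · exact this.1 (h ▸ (tq f hf).2.2)
    · obtain ⟨f, hf, h⟩ := mem_writes.1 hxq
      exact this.2 (h ▸ (tq f hf).1)
  · obtain ⟨e, he, rfl⟩ := mem_writes.1 hxq
    have := h₂ _ hx (tq e he).1
    rcases hxp with hxp | hxp
    · obtain ⟨f, hf, h | h⟩ := mem_reads.1 hxp
      · exact this.1 (h ▸ (tp f hf).2.1)
      · exact this.1 (h ▸ (tp f hf).2.2)
    · obtain ⟨f, hf, h⟩ := mem_writes.1 hxp
      exact this.2 (h ▸ (tp f hf).1)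

/-- A computation leaves the allocated cells alone that it does not write. -/
theorem run_eq {R : Type u} {I : σ → R → R → R} {junk : ℕ → R} {sp : ℕ} {c : Comp σ}
    (h : c.Touches W X) {m : ℕ → R} {x : ℕ} (hx : x < sp) (hW : ¬ W x) :
    c.run I junk sp m x = m x := by
  induction c generalizing sp m with
  | step => rfl
  | op o d a b =>
    have : x ≠ d := by
      rintro rfl
      exact hW (h _ (List.mem_singleton.2 rfl)).1
    simp [run, this]
  | seq p q hp hq | fork p q hp hq =>
    simp only [run]
    rw [hq (fun e he => h e (List.mem_append_right _ he)) hx,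
      hp (fun e he => h e (List.mem_append_left _ he)) hx]
  | alloc s p hp =>
    simp only [run]
    rw [hp h (by omega)]
    simp [not_le.2 hx]

end Touches

/-- Bounds the stack part of a footprint from above. Together with a bound on `extent` it makes the
whole stack a short interval that can stay in the cache. -/
theorem InScope.touches {c : Comp σ} {sp : ℕ} (h : c.InScope sp) :
    c.Touches (· < sp + c.extent) (· < sp + c.extent) := by
  induction c generalizing sp with
  | step => exact .step
  | op o d a b => exact .op h.1 h.2.1 h.2.2
  | seq p q hp hq | fork p q hp hq =>
    intro e he
    simp only [extent]
    rcases List.mem_append.1 he with he | he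
    · have := hp h.1 e he
      omega
    · have := hq h.2 e he
      omega
  | alloc s p hp =>
    intro e he
    have := hp h e he
    simp only [extent]
    omega

end Comp

/-! ## Serving traces in the ideal-cache model -/

section Cache

variable {M B : ℕ}

/-- Modified lines lie in `F`, so whatever `A` adds to `F` is clean and leaves without a write. -/
theorem CacheRun.evict_all {tr : List (ℕ × ℕ × ℕ)} {F D : Finset ℕ} {r w : ℕ} (A : Finset ℕ)
    (hD : D ⊆ F) (h : CacheRun M B tr F D r w) : CacheRun M B tr (F ∪ A) D r w := by
  induction A using Finset.induction_on with
  | empty => simpa using h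
  | insert a A ha ih =>
    by_cases haF : a ∈ F ∪ A
    · rwa [Finset.union_insert, Finset.insert_eq_of_mem haF]
    · refine .evict a (fun haD => haF (Finset.mem_union_left _ (hD haD))) ?_
      rwa [Finset.union_insert, Finset.erase_insert haF]

theorem CacheRun.load_all {tr : List (ℕ × ℕ × ℕ)} {F D : Finset ℕ} {r w : ℕ} (A : Finset ℕ)
    (hM : (F ∪ A).card * B ≤ M) (h : CacheRun M B tr (F ∪ A) D r w) :
    CacheRun M B tr F D (A.card + r) w := by
  induction A using Finset.induction_on generalizing r with
  | empty => simpa using h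
  | insert a A ha ih =>
    rw [Finset.union_insert] at h hM
    have := ih ((Nat.mul_le_mul_right _ (Finset.card_le_card (Finset.subset_insert _ _))).trans hM)
      (.load a hM h)
    rw [Finset.card_insert_of_notMem ha]
    convert this using 1
    ring

/-- A finished run has written everything back, so its leftover lines are clean and can be evicted
before the second run starts from an empty cache. -/
theorem CacheRun.append {tr tr' : List (ℕ × ℕ × ℕ)} {S D : Finset ℕ} {r w r' w' : ℕ}
    (h : CacheRun M B tr S D r w) (h' : CacheRun M B tr' ∅ ∅ r' w') :
    CacheRun M B (tr ++ tr') S D (r + r') (w + w') := by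
  induction h with
  | done S => simpa using h'.evict_all S (Finset.empty_subset _)
  | load l hl _ ih => rw [add_right_comm]; exact .load l hl ih
  | evict l hl _ ih => exact .evict l hl ih
  | writeBack l hl _ ih => rw [add_right_comm]; exact .writeBack l hl ih
  | exec d a b hd ha hb _ ih => exact .exec d a b hd ha hb ih

theorem CacheRun.nil (F D : Finset ℕ) : CacheRun M B [] F D 0 D.card := by
  induction D using Finset.induction_on with
  | empty => exact .done F
  | insert a A ha ih =>
    rw [Finset.card_insert_of_notMem ha]
    refine .writeBack a (Finset.mem_insert_self _ _) ?_
    rwa [Finset.erase_insert ha]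

/-- Starting and ending with an empty cache, the trace can be served with at most `R` line reads and
`W` line writes. -/
def Serves (M B : ℕ) (tr : List (ℕ × ℕ × ℕ)) (R W : ℝ) : Prop :=
  ∃ r w : ℕ, (r : ℝ) ≤ R ∧ (w : ℝ) ≤ W ∧ CacheRun M B tr ∅ ∅ r w

/-- The trace can be served with at most `R` line reads and no line write by a cache in which the lines
`F` stay resident throughout, and only they are modified. -/
def Streams (M B : ℕ) (F : Finset ℕ) (tr : List (ℕ × ℕ × ℕ)) (R : ℝ) : Prop :=
  ∀ D ⊆ F, ∃ r : ℕ, (r : ℝ) ≤ R ∧ ∃ D' ⊆ F, ∀ tr' r' w', CacheRun M B tr' F D' r' w' →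
    CacheRun M B (tr ++ tr') F D (r + r') w'

theorem Serves.mono {tr : List (ℕ × ℕ × ℕ)} {R W R' W' : ℝ} (h : Serves M B tr R W) (hR : R ≤ R')
    (hW : W ≤ W') : Serves M B tr R' W' := by
  obtain ⟨r, w, h₁, h₂, h₃⟩ := h
  exact ⟨r, w, h₁.trans hR, h₂.trans hW, h₃⟩

theorem Serves.append {tr tr' : List (ℕ × ℕ × ℕ)} {R W R' W' : ℝ} (h : Serves M B tr R W)
    (h' : Serves M B tr' R' W') : Serves M B (tr ++ tr') (R + R') (W + W') := by
  obtain ⟨r, w, h₁, h₂, h₃⟩ := h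
  obtain ⟨r', w', h₁', h₂', h₃'⟩ := h'
  exact ⟨r + r', w + w', by push_cast; linarith, by push_cast; linarith, h₃.append h₃'⟩

theorem Serves.nil : Serves M B [] 0 0 := ⟨0, 0, by simp, by simp, .done _⟩

theorem Streams.mono {F : Finset ℕ} {tr : List (ℕ × ℕ × ℕ)} {R R' : ℝ} (h : Streams M B F tr R)
    (hR : R ≤ R') : Streams M B F tr R' := fun D hD => by
  obtain ⟨r, h₁, h₂⟩ := h D hD
  exact ⟨r, h₁.trans hR, h₂⟩

/-- The quantification over the set of modified lines and over all continuations is what permits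
composition without flushing `F` in between. Writes are paid only once, at the very end. -/
theorem Streams.append {F : Finset ℕ} {tr tr' : List (ℕ × ℕ × ℕ)} {R R' : ℝ}
    (h : Streams M B F tr R) (h' : Streams M B F tr' R') : Streams M B F (tr ++ tr') (R + R') := by
  intro D hD
  obtain ⟨r, hr, D₁, hD₁, h₁⟩ := h D hD
  obtain ⟨r', hr', D₂, hD₂, h₂⟩ := h' D₁ hD₁
  refine ⟨r + r', by push_cast; linarith, D₂, hD₂, fun t r₃ w₃ h₃ => ?_⟩
  rw [List.append_assoc, add_assoc]
  exact h₁ _ _ _ (h₂ _ _ _ h₃)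

/-- Load the read-only lines `A` next to the resident `F`, execute everything, and drop `A` again.
-/
theorem streams_of_lines {F A : Finset ℕ} {tr : List (ℕ × ℕ × ℕ)}
    (htr : ∀ e ∈ tr, e.1 / B ∈ F ∧ e.2.1 / B ∈ F ∪ A ∧ e.2.2 / B ∈ F ∪ A)
    (hM : (F ∪ A).card * B ≤ M) : Streams M B F tr A.card := by
  have key : ∀ D ⊆ F, ∃ D' ⊆ F, ∀ tr' r' w', CacheRun M B tr' (F ∪ A) D' r' w' →
      CacheRun M B (tr ++ tr') (F ∪ A) D r' w' := by
    clear hM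
    induction tr with
    | nil => exact fun D hD => ⟨D, hD, fun _ _ _ h => h⟩
    | cons e tr ih =>
      intro D hD
      have he := htr e List.mem_cons_self
      obtain ⟨D', hD', h⟩ := ih (fun f hf => htr f (List.mem_cons_of_mem _ hf))
        (insert (e.1 / B) D) (Finset.insert_subset he.1 hD)
      exact ⟨D', hD', fun tr' r' w' h' => .exec _ _ _ (Finset.mem_union_left _ he.1) he.2.1 he.2.2
        (h _ _ _ h')⟩
  intro D hD
  obtain ⟨D', hD', h⟩ := key D hD
  exact ⟨A.card, le_rfl, D', hD', fun tr' r' w' h' =>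
    CacheRun.load_all A hM (h _ _ _ (h'.evict_all A hD'))⟩

/-- The resident lines are loaded once before and written back at most once after the stream. -/
theorem Streams.serves {F : Finset ℕ} {tr : List (ℕ × ℕ × ℕ)} {R : ℝ} (h : Streams M B F tr R)
    (hM : F.card * B ≤ M) : Serves M B tr (F.card + R) F.card := by
  obtain ⟨r, hr, D, hD, h'⟩ := h ∅ (Finset.empty_subset _)
  refine ⟨F.card + r, D.card, by push_cast; linarith, by exact_mod_cast Finset.card_le_card hD, ?_⟩
  have := h' [] 0 _ (CacheRun.nil F D)
  rw [List.append_nil, add_zero] at this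
  exact CacheRun.load_all F (by simpa using hM) (by simpa using this)

theorem serves_of_lines {F : Finset ℕ} {tr : List (ℕ × ℕ × ℕ)}
    (htr : ∀ e ∈ tr, e.1 / B ∈ F ∧ e.2.1 / B ∈ F ∧ e.2.2 / B ∈ F) (hM : F.card * B ≤ M) :
    Serves M B tr F.card F.card := by
  have := (streams_of_lines (F := F) (A := ∅) (M := M) (by simpa using htr) (by simpa using hM)).serves hM
  simpa using this

theorem Serves.symCacheCost_le {σ : Type} {c : Comp σ} {R W : ℝ} (h : Serves M B c.trace R W) :
    c.symCacheCost M B ≤ ENNReal.ofReal (R + W) := by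
  obtain ⟨r, w, hr, hw, h⟩ := h
  refine (iInf₂_le_of_le r w (iInf_le _ h)).trans ?_
  rw [← ENNReal.ofReal_natCast r, ← ENNReal.ofReal_natCast w, ← ENNReal.ofReal_add (by simp) (by simp)]
  exact ENNReal.ofReal_le_ofReal (by linarith)

theorem Serves.asymCacheCost_le {σ : Type} {c : Comp σ} {R W ω : ℝ} (hω : 0 ≤ ω)
    (h : Serves M B c.trace R W) : c.asymCacheCost M B ω ≤ ENNReal.ofReal (R + ω * W) := by
  obtain ⟨r, w, hr, hw, h⟩ := h
  refine (iInf₂_le_of_le r w (iInf_le _ h)).trans ?_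
  rw [← ENNReal.ofReal_natCast r, ← ENNReal.ofReal_natCast w, ← ENNReal.ofReal_mul hω,
    ← ENNReal.ofReal_add (by simp) (by positivity)]
  exact ENNReal.ofReal_le_ofReal (add_le_add hr (mul_le_mul_of_nonneg_left hw hω))

end Cache

/-! ## Blocks of a matrix in memory -/

/-- The cells of a `p × q` matrix in row-major order with row stride `s`. -/
def Blk (b s p q : ℕ) (x : ℕ) : Prop := ∃ i < p, ∃ j < q, x = b + i * s + j

theorem Blk.intro {b s p q i j : ℕ} (hi : i < p) (hj : j < q) : Blk b s p q (b + i * s + j) :=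
  ⟨i, hi, j, hj, rfl⟩

theorem Blk.sub {b s p q i j p' q' x : ℕ} (hi : i + p' ≤ p) (hj : j + q' ≤ q)
    (h : Blk (b + i * s + j) s p' q' x) : Blk b s p q x := by
  obtain ⟨i', hi', j', hj', rfl⟩ := h
  exact ⟨i + i', by omega, j + j', by omega, by ring⟩

theorem Blk.top {b s p q p' x : ℕ} (hp : p' ≤ p) (h : Blk b s p' q x) : Blk b s p q x :=
  Blk.sub (i := 0) (j := 0) (p' := p') (q' := q) (by omega) (by omega) (by simpa using h)

theorem Blk.bottom {b s p q i p' x : ℕ} (hp : i + p' ≤ p) (h : Blk (b + i * s) s p' q x) :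
    Blk b s p q x :=
  Blk.sub (i := i) (j := 0) hp (by omega : 0 + q ≤ q) (by simpa using h)

theorem Blk.left {b s p q q' x : ℕ} (hq : q' ≤ q) (h : Blk b s p q' x) : Blk b s p q x :=
  Blk.sub (i := 0) (j := 0) (by omega : 0 + p ≤ p) (by omega : 0 + q' ≤ q) (by simpa using h)

theorem Blk.right {b s p q j q' x : ℕ} (hq : j + q' ≤ q) (h : Blk (b + j) s p q' x) :
    Blk b s p q x :=
  Blk.sub (i := 0) (j := j) (by omega : 0 + p ≤ p) hq (by simpa using h)

theorem index_unique {s i j i' j' : ℕ} (hj : j < s) (hj' : j' < s)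
    (h : i * s + j = i' * s + j') : i = i' ∧ j = j' := by
  have h₁ : i = i' := by
    have := congrArg (· / s) h
    simpa [Nat.add_div_of_dvd_right, Nat.mul_add_div, mul_comm _ s, Nat.div_eq_of_lt, hj, hj',
      (Nat.zero_le j).trans_lt hj] using this
  exact ⟨h₁, by subst h₁; omega⟩

/-- Since no row is longer than the stride, an address determines its row and column, so index
rectangles that are separated in one direction occupy different cells. -/
theorem Blk.disjoint {b s q i j p' q' i' j' p'' q'' x : ℕ} (hq : q ≤ s)
    (hd : i + p' ≤ i' ∨ i' + p'' ≤ i ∨ j + q' ≤ j' ∨ j' + q'' ≤ j)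
    (hj : j + q' ≤ q) (hj' : j' + q'' ≤ q) (h : Blk (b + i * s + j) s p' q' x) :
    ¬ Blk (b + i' * s + j') s p'' q'' x := by
  obtain ⟨k, hk, l, hl, rfl⟩ := h
  rintro ⟨k', hk', l', hl', h⟩
  have := index_unique (s := s) (i := i + k) (j := j + l) (i' := i' + k') (j' := j' + l')
    (by omega) (by omega) (by linarith)
  omega

theorem Blk.rows_disjoint {b s p q i p'' x : ℕ} (hq : q ≤ s) (hi : p ≤ i) (h : Blk b s p q x) :
    ¬ Blk (b + i * s) s p'' q x := by
  have := Blk.disjoint (b := b) (s := s) (q := q) (i := 0) (j := 0) (p' := p) (q' := q) (i' := i) (j' := 0)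
    (p'' := p'') (q'' := q) (x := x) hq (by omega) (by omega) (by omega) (by simpa using h)
  simpa using this

theorem Blk.cols_disjoint {b s p q j q'' x : ℕ} (hq : j + q'' ≤ s) (hj : q ≤ j) (h : Blk b s p q x) :
    ¬ Blk (b + j) s p q'' x := by
  have := Blk.disjoint (b := b) (s := s) (q := j + q'') (i := 0) (j := 0) (p' := p) (q' := q) (i' := 0)
    (j' := j) (p'' := p) (q'' := q'') (x := x) hq (by omega) (by omega) (by omega)
    (by simpa using h)
  simpa using this

theorem Blk.compact {b p q x : ℕ} (h : Blk b q p q x) : b ≤ x ∧ x < b + p * q := by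
  obtain ⟨i, hi, j, hj, rfl⟩ := h
  have : (i + 1) * q ≤ p * q := Nat.mul_le_mul_right _ hi
  constructor
  · omega
  · linarith

/-- The cache lines of a block. -/
def blkLines (B b s p q : ℕ) : Finset ℕ :=
  (Finset.range p).biUnion fun i => Finset.Icc ((b + i * s) / B) ((b + i * s + q) / B)

theorem mem_blkLines {B b s p q x : ℕ} (h : Blk b s p q x) : x / B ∈ blkLines B b s p q := by
  obtain ⟨i, hi, j, hj, rfl⟩ := h
  simp only [blkLines, Finset.mem_biUnion, Finset.mem_range, Finset.mem_Icc]
  exact ⟨i, hi, Nat.div_le_div_right (by omega), Nat.div_le_div_right (by omega)⟩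

/-- The term `2` per row is for the partial lines at its two ends. It is harmless only if rows are
not much shorter than `B`, and this is where the tall cache is needed. -/
theorem card_blkLines_le {B : ℕ} (hB : 1 ≤ B) (b s p q : ℕ) :
    ((blkLines B b s p q).card : ℝ) ≤ p * ((q : ℝ) / B + 2) := by
  have h : (blkLines B b s p q).card ≤ p * (q / B + 2) := by
    have := Finset.card_biUnion_le_card_mul (Finset.range p)
      (fun i => Finset.Icc ((b + i * s) / B) ((b + i * s + q) / B)) (q / B + 2) (fun i _ => by
        rw [Nat.card_Icc]
        have h₁ : (b + i * s + q) / B ≤ (b + i * s) / B + q / B + 1 := by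
          rw [Nat.add_div hB]
          split_ifs <;> simp
        generalize (b + i * s) / B = u, (b + i * s + q) / B = v, q / B = w at *
        omega)
    simpa [blkLines] using this
  calc ((blkLines B b s p q).card : ℝ) ≤ ((p * (q / B + 2) : ℕ) : ℝ) := by exact_mod_cast h
    _ ≤ _ := by
      push_cast
      gcongr
      exact Nat.cast_div_le

/-- The cache lines of an interval. -/
theorem mem_lines_interval {B b e x : ℕ} (h₁ : b ≤ x) (h₂ : x < b + e) :
    x / B ∈ blkLines B b 0 1 e :=
  mem_blkLines ⟨0, one_pos, x - b, by omega, by omega⟩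

/-! ## Parallel loops over the entries of a matrix -/

instance : Add IExpr := ⟨.add⟩
instance : Sub IExpr := ⟨.sub⟩
instance : Mul IExpr := ⟨.mul⟩
instance : Div IExpr := ⟨.div⟩
instance (n : ℕ) : OfNat IExpr n := ⟨.lit n⟩

/-- The register `i`. -/
abbrev reg (i : ℕ) : IExpr := .var i

variable {σ : Type}

/-- For the `p × q` matrices `D` at `d` with row stride `ds` and `A` at `a` with strides `ar` and `ac`,
apply `D[i,j] ← o(A[i,j], D[i,j])` to all entries. The registers hold `d, ds, a, ar, ac, p, q`. -/
def mapStmt (self : ℕ) (o : σ) : Stmt σ :=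
  .ifLe (reg 5 + reg 6) 2 (.op o (reg 0) (reg 2) (reg 0))
    (.ifLe (reg 6) (reg 5)
      (.fork
        (.call self [reg 0, reg 1, reg 2, reg 3, reg 4, reg 5 / 2, reg 6])
        (.call self [reg 0 + reg 5 / 2 * reg 1, reg 1, reg 2 + reg 5 / 2 * reg 3, reg 3, reg 4,
          reg 5 - reg 5 / 2, reg 6]))
      (.fork
        (.call self [reg 0, reg 1, reg 2, reg 3, reg 4, reg 5, reg 6 / 2])
        (.call self [reg 0 + reg 6 / 2, reg 1, reg 2 + reg 6 / 2 * reg 4, reg 3, reg 4,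
          reg 5, reg 6 - reg 6 / 2])))

/-- The computation of `mapStmt`. -/
def mapC (o : σ) (ds ar ac d a p q : ℕ) : Comp σ :=
  if p + q ≤ 2 then .tick (.tick (.op o d a d))
  else if q ≤ p then
    .tick (.tick (.tick (.fork (mapC o ds ar ac d a (p / 2) q)
      (mapC o ds ar ac (d + p / 2 * ds) (a + p / 2 * ar) (p - p / 2) q))))
  else
    .tick (.tick (.tick (.fork (mapC o ds ar ac d a p (q / 2))
      (mapC o ds ar ac (d + q / 2) (a + q / 2 * ac) p (q - q / 2)))))
termination_by p + q

theorem unfolds_mapC {P : Program σ} {self : ℕ} {o : σ} (hP : P[self]? = some (mapStmt self o))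
    (sp : ℕ) (ds ar ac d a p q : ℕ) : ∀ (ρ : List ℕ) (args : List IExpr),
    args.map (IExpr.eval ρ) = [d, ds, a, ar, ac, p, q] →
      Unfolds P sp ρ (.call self args) (mapC o ds ar ac d a p q) := by
  fun_induction mapC o ds ar ac d a p q with
  | case1 d a p q h =>
    exact fun ρ args hρ => .call hP (hρ ▸ .ifTrue h (.op ..))
  | case2 d a p q h h' ih₁ ih₂ =>
    exact fun ρ args hρ => .call hP (hρ ▸ .ifFalse h (.ifTrue h'
      (.fork (ih₁ _ _ rfl) (ih₂ _ _ rfl))))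
  | case3 d a p q h h' ih₁ ih₂ =>
    exact fun ρ args hρ => .call hP (hρ ▸ .ifFalse h (.ifFalse h'
      (.fork (ih₁ _ _ rfl) (ih₂ _ _ rfl))))

theorem mem_trace_mapC {o : σ} {ds ar ac d a p q : ℕ} (hp : 1 ≤ p) (hq : 1 ≤ q)
    {e : ℕ × ℕ × ℕ} (he : e ∈ (mapC o ds ar ac d a p q).trace) :
    ∃ i < p, ∃ j < q, e = (d + i * ds + j, a + i * ar + j * ac, d + i * ds + j) := by
  fun_induction mapC o ds ar ac d a p q with
  | case1 d a p q h =>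
    exact ⟨0, hp, 0, hq, by simpa [Comp.trace] using he⟩
  | case2 d a p q h h' ih₁ ih₂ =>
    simp only [Comp.trace, List.nil_append, List.mem_append] at he
    rcases he with he | he
    · obtain ⟨i, hi, j, hj, rfl⟩ := ih₁ (by omega) hq he
      exact ⟨i, by omega, j, hj, rfl⟩
    · obtain ⟨i, hi, j, hj, rfl⟩ := ih₂ (by omega) hq he
      exact ⟨p / 2 + i, by omega, j, hj, by ring_nf⟩
  | case3 d a p q h h' ih₁ ih₂ =>
    simp only [Comp.trace, List.nil_append, List.mem_append] at he
    rcases he with he | he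
    · obtain ⟨i, hi, j, hj, rfl⟩ := ih₁ hp (by omega) he
      exact ⟨i, hi, j, by omega, rfl⟩
    · obtain ⟨i, hi, j, hj, rfl⟩ := ih₂ hp (by omega) he
      exact ⟨i, hi, q / 2 + j, by omega, by ring_nf⟩

theorem touches_mapC {o : σ} {ds ar ac d a p q : ℕ} (hp : 1 ≤ p) (hq : 1 ≤ q) {W X : ℕ → Prop}
    (hW : ∀ i < p, ∀ j < q, W (d + i * ds + j))
    (hX : ∀ i < p, ∀ j < q, X (d + i * ds + j) ∧ X (a + i * ar + j * ac)) :
    (mapC o ds ar ac d a p q).Touches W X := by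
  intro e he
  obtain ⟨i, hi, j, hj, rfl⟩ := mem_trace_mapC hp hq he
  exact ⟨hW i hi j hj, (hX i hi j hj).2, (hX i hi j hj).1⟩

theorem extent_mapC (o : σ) (ds ar ac d a p q : ℕ) : (mapC o ds ar ac d a p q).extent = 0 := by
  fun_induction mapC o ds ar ac d a p q with
  | case1 => rfl
  | case2 d a p q h h' ih₁ ih₂ | case3 d a p q h h' ih₁ ih₂ => simp [Comp.extent, ih₁, ih₂]

theorem inScope_mapC {o : σ} {ds ar ac d a p q sp : ℕ} (hp : 1 ≤ p) (hq : 1 ≤ q)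
    (h : ∀ i < p, ∀ j < q, d + i * ds + j < sp ∧ a + i * ar + j * ac < sp) :
    (mapC o ds ar ac d a p q).InScope sp := by
  fun_induction mapC o ds ar ac d a p q with
  | case1 d a p q h' =>
    have := h 0 hp 0 hq
    simp only [zero_mul, add_zero] at this
    exact ⟨trivial, trivial, this.1, this.2, this.1⟩
  | case2 d a p q h₁ h' ih₁ ih₂ =>
    refine ⟨trivial, trivial, trivial, ih₁ (by omega) hq fun i hi j hj => h i (by omega) j hj,
      ih₂ (by omega) hq fun i hi j hj => ?_⟩
    have := h (p / 2 + i) (by omega) j hj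
    rw [add_mul, add_mul] at this
    omega
  | case3 d a p q h₁ h' ih₁ ih₂ =>
    refine ⟨trivial, trivial, trivial, ih₁ hp (by omega) fun i hi j hj => h i hi j (by omega),
      ih₂ hp (by omega) fun i hi j hj => ?_⟩
    have := h i hi (q / 2 + j) (by omega)
    rw [add_mul (q / 2)] at this
    omega

/-- Source and target may be disjoint or coincide entry by entry, as when a block is zeroed in
place; only a collision at different indices would be a race. -/
theorem raceFree_mapC {o : σ} {ds ar ac d a p q sp : ℕ} (hp : 1 ≤ p) (hq : 1 ≤ q) (hs : q ≤ ds)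
    (h : ∀ i < p, ∀ j < q, ∀ i' < p, ∀ j' < q,
      d + i * ds + j = a + i' * ar + j' * ac → i = i' ∧ j = j') :
    (mapC o ds ar ac d a p q).RaceFree sp := by
  fun_induction mapC o ds ar ac d a p q with
  | case1 d a p q h' => exact ⟨trivial, trivial, trivial⟩
  | case2 d a p q h₁ h' ih₁ ih₂ =>
    refine ⟨trivial, trivial, trivial, Comp.Touches.raceFree_fork
      (ih₁ (by omega) hq hs fun i hi j hj i' hi' j' hj' => h i (by omega) j hj i' (by omega) j' hj')
      (ih₂ (by omega) hq hs fun i hi j hj i' hi' j' hj' hh => ?_)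
      (W₁ := fun x => ∃ i < p / 2, ∃ j < q, x = d + i * ds + j)
      (X₁ := fun x => ∃ i < p / 2, ∃ j < q, x = d + i * ds + j ∨ x = a + i * ar + j * ac)
      (W₂ := fun x => ∃ i < p, p / 2 ≤ i ∧ ∃ j < q, x = d + i * ds + j)
      (X₂ := fun x => ∃ i < p, p / 2 ≤ i ∧ ∃ j < q, x = d + i * ds + j ∨ x = a + i * ar + j * ac)
      (touches_mapC (by omega) hq (fun i hi j hj => ⟨i, hi, j, hj, rfl⟩)
        (fun i hi j hj => ⟨⟨i, hi, j, hj, .inl rfl⟩, ⟨i, hi, j, hj, .inr rfl⟩⟩))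
      (touches_mapC (by omega) hq
        (fun i hi j hj => ⟨p / 2 + i, by omega, by omega, j, hj, by ring⟩)
        (fun i hi j hj => ⟨⟨p / 2 + i, by omega, by omega, j, hj, .inl (by ring)⟩,
          ⟨p / 2 + i, by omega, by omega, j, hj, .inr (by ring)⟩⟩)) ?_ ?_⟩
    · have := h (p / 2 + i) (by omega) j hj (p / 2 + i') (by omega) j' hj' (by linarith)
      omega
    · rintro x - ⟨i, hi, j, hj, rfl⟩
      refine ⟨?_, ?_⟩
      · rintro ⟨i', hi', hi'', j', hj', hh | hh⟩
        · have := index_unique (s := ds) (i := i) (j := j) (i' := i') (j' := j') (by omega) (by omega)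
            (by linarith)
          omega
        · have := h i (by omega) j hj i' (by omega) j' hj' hh
          omega
      · rintro ⟨i', hi', hi'', j', hj', hh⟩
        have := index_unique (s := ds) (i := i) (j := j) (i' := i') (j' := j') (by omega) (by omega)
          (by linarith)
        omega
    · rintro x - ⟨i, hi, hi₁, j, hj, rfl⟩
      refine ⟨?_, ?_⟩
      · rintro ⟨i', hi', j', hj', hh | hh⟩
        · have := index_unique (s := ds) (i := i) (j := j) (i' := i') (j' := j') (by omega) (by omega)
            (by linarith)
          omega
        · have := h i (by omega) j hj i' (by omega) j' hj' hh
          omega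
      · rintro ⟨i', hi', j', hj', hh⟩
        have := index_unique (s := ds) (i := i) (j := j) (i' := i') (j' := j') (by omega) (by omega)
          (by linarith)
        omega
  | case3 d a p q h₁ h' ih₁ ih₂ =>
    refine ⟨trivial, trivial, trivial, Comp.Touches.raceFree_fork
      (ih₁ hp (by omega) (by omega)
        fun i hi j hj i' hi' j' hj' => h i hi j (by omega) i' hi' j' (by omega))
      (ih₂ hp (by omega) (by omega) fun i hi j hj i' hi' j' hj' hh => ?_)
      (W₁ := fun x => ∃ i < p, ∃ j < q / 2, x = d + i * ds + j)
      (X₁ := fun x => ∃ i < p, ∃ j < q / 2, x = d + i * ds + j ∨ x = a + i * ar + j * ac)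
      (W₂ := fun x => ∃ i < p, ∃ j < q, q / 2 ≤ j ∧ x = d + i * ds + j)
      (X₂ := fun x => ∃ i < p, ∃ j < q, q / 2 ≤ j ∧ (x = d + i * ds + j ∨ x = a + i * ar + j * ac))
      (touches_mapC hp (by omega) (fun i hi j hj => ⟨i, hi, j, hj, rfl⟩)
        (fun i hi j hj => ⟨⟨i, hi, j, hj, .inl rfl⟩, ⟨i, hi, j, hj, .inr rfl⟩⟩))
      (touches_mapC hp (by omega)
        (fun i hi j hj => ⟨i, hi, q / 2 + j, by omega, by omega, by ring⟩)
        (fun i hi j hj => ⟨⟨i, hi, q / 2 + j, by omega, by omega, .inl (by ring)⟩,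
          ⟨i, hi, q / 2 + j, by omega, by omega, .inr (by ring)⟩⟩)) ?_ ?_⟩
    · have := h i hi (q / 2 + j) (by omega) i' hi' (q / 2 + j') (by omega) (by linarith)
      omega
    · rintro x - ⟨i, hi, j, hj, rfl⟩
      refine ⟨?_, ?_⟩
      · rintro ⟨i', hi', j', hj', hj'', hh | hh⟩
        · have := index_unique (s := ds) (i := i) (j := j) (i' := i') (j' := j') (by omega) (by omega)
            (by linarith)
          omega
        · have := h i hi j (by omega) i' hi' j' (by omega) hh
          omega
      · rintro ⟨i', hi', j', hj', hj'', hh⟩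
        have := index_unique (s := ds) (i := i) (j := j) (i' := i') (j' := j') (by omega) (by omega)
          (by linarith)
        omega
    · rintro x - ⟨i, hi, j, hj, hj₁, rfl⟩
      refine ⟨?_, ?_⟩
      · rintro ⟨i', hi', j', hj', hh | hh⟩
        · have := index_unique (s := ds) (i := i) (j := j) (i' := i') (j' := j') (by omega) (by omega)
            (by linarith)
          omega
        · have := h i hi j (by omega) i' hi' j' (by omega) hh
          omega
      · rintro ⟨i', hi', j', hj', hh⟩
        have := index_unique (s := ds) (i := i) (j := j) (i' := i') (j' := j') (by omega) (by omega)
          (by linarith)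
        omega

theorem run_mapC {R : Type u} (I : σ → R → R → R) (junk : ℕ → R) {o : σ}
    {ds ar ac d a p q sp : ℕ} (hp : 1 ≤ p) (hq : 1 ≤ q) (hs : q ≤ ds)
    (hsp : ∀ i < p, ∀ j < q, d + i * ds + j < sp ∧ a + i * ar + j * ac < sp)
    (h : ∀ i < p, ∀ j < q, ∀ i' < p, ∀ j' < q,
      d + i * ds + j = a + i' * ar + j' * ac → i = i' ∧ j = j') (m : ℕ → R) :
    ∀ i < p, ∀ j < q, (mapC o ds ar ac d a p q).run I junk sp m (d + i * ds + j) =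
      I o (m (a + i * ar + j * ac)) (m (d + i * ds + j)) := by
  fun_induction mapC o ds ar ac d a p q generalizing m with
  | case1 d a p q h' =>
    intro i hi j hj
    obtain rfl : i = 0 := by omega
    obtain rfl : j = 0 := by omega
    simp [Comp.run]
  | case2 d a p q h₁ h' ih₁ ih₂ =>
    have ih₁ := ih₁ (by omega) hq hs (fun i hi j hj => hsp i (by omega) j hj)
      (fun i hi j hj i' hi' j' hj' => h i (by omega) j hj i' (by omega) j' hj') m
    have e₁ : ∀ x < sp, (∀ i < p / 2, ∀ j < q, x ≠ d + i * ds + j) →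
        (mapC o ds ar ac d a (p / 2) q).run I junk sp m x = m x := fun x hx hh =>
      (touches_mapC (W := fun y => ∃ i < p / 2, ∃ j < q, y = d + i * ds + j) (X := fun _ => True)
        (by omega) hq (fun i hi j hj => ⟨i, hi, j, hj, rfl⟩) (fun _ _ _ _ => ⟨trivial, trivial⟩)).run_eq
        hx (by rintro ⟨i, hi, j, hj, rfl⟩; exact hh i hi j hj rfl)
    simp only [Comp.run]
    set m₁ := (mapC o ds ar ac d a (p / 2) q).run I junk sp m
    have hsp' : ∀ i < p - p / 2, ∀ j < q, d + p / 2 * ds + i * ds + j < sp ∧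
        a + p / 2 * ar + i * ar + j * ac < sp := fun i hi j hj => by
      have := hsp (p / 2 + i) (by omega) j hj
      rw [add_mul, add_mul] at this
      omega
    have ih₂ := ih₂ (by omega) hq hs hsp' (fun i hi j hj i' hi' j' hj' hh => by
      have := h (p / 2 + i) (by omega) j hj (p / 2 + i') (by omega) j' hj' (by linarith)
      omega) m₁
    intro i hi j hj
    by_cases hi' : i < p / 2
    · rw [(touches_mapC (W := fun y => ∃ i < p - p / 2, ∃ j < q, y = d + p / 2 * ds + i * ds + j)
        (X := fun _ => True) (by omega) hq (fun i hi j hj => ⟨i, hi, j, hj, rfl⟩)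
        (fun _ _ _ _ => ⟨trivial, trivial⟩)).run_eq (hsp i hi j hj).1, ih₁ i hi' j hj]
      rintro ⟨i', hi'', j', hj', hh⟩
      have := index_unique (s := ds) (i := i) (j := j) (i' := p / 2 + i') (j' := j') (by omega)
        (by omega) (by linarith)
      omega
    · have := ih₂ (i - p / 2) (by omega) j hj
      have e₂ : d + p / 2 * ds + (i - p / 2) * ds + j = d + i * ds + j := by
        conv_rhs => rw [← Nat.add_sub_of_le (not_lt.1 hi')]
        ring
      have e₃ : a + p / 2 * ar + (i - p / 2) * ar + j * ac = a + i * ar + j * ac := by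
        conv_rhs => rw [← Nat.add_sub_of_le (not_lt.1 hi')]
        ring
      rw [e₂, e₃] at this
      rw [this, e₁ _ (hsp i hi j hj).2, e₁ _ (hsp i hi j hj).1]
      · intro i' hi'' j' hj' hh
        have := index_unique (s := ds) (i := i) (j := j) (i' := i') (j' := j') (by omega)
          (by omega) (by linarith)
        omega
      · intro i' hi'' j' hj' hh
        have := h i' (by omega) j' hj' i hi j hj hh.symm
        omega
  | case3 d a p q h₁ h' ih₁ ih₂ =>
    have ih₁ := ih₁ hp (by omega) (by omega) (fun i hi j hj => hsp i hi j (by omega))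
      (fun i hi j hj i' hi' j' hj' => h i hi j (by omega) i' hi' j' (by omega)) m
    have e₁ : ∀ x < sp, (∀ i < p, ∀ j < q / 2, x ≠ d + i * ds + j) →
        (mapC o ds ar ac d a p (q / 2)).run I junk sp m x = m x := fun x hx hh =>
      (touches_mapC (W := fun y => ∃ i < p, ∃ j < q / 2, y = d + i * ds + j) (X := fun _ => True)
        hp (by omega) (fun i hi j hj => ⟨i, hi, j, hj, rfl⟩) (fun _ _ _ _ => ⟨trivial, trivial⟩)).run_eq
        hx (by rintro ⟨i, hi, j, hj, rfl⟩; exact hh i hi j hj rfl)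
    simp only [Comp.run]
    set m₁ := (mapC o ds ar ac d a p (q / 2)).run I junk sp m
    have hsp' : ∀ i < p, ∀ j < q - q / 2, d + q / 2 + i * ds + j < sp ∧
        a + q / 2 * ac + i * ar + j * ac < sp := fun i hi j hj => by
      have := hsp i hi (q / 2 + j) (by omega)
      rw [add_mul (q / 2)] at this
      omega
    have ih₂ := ih₂ hp (by omega) (by omega) hsp' (fun i hi j hj i' hi' j' hj' hh => by
      have := h i hi (q / 2 + j) (by omega) i' hi' (q / 2 + j') (by omega) (by linarith)
      omega) m₁
    intro i hi j hj
    by_cases hi' : j < q / 2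
    · rw [(touches_mapC (W := fun y => ∃ i < p, ∃ j < q - q / 2, y = d + q / 2 + i * ds + j)
        (X := fun _ => True) hp (by omega) (fun i hi j hj => ⟨i, hi, j, hj, rfl⟩)
        (fun _ _ _ _ => ⟨trivial, trivial⟩)).run_eq (hsp i hi j hj).1, ih₁ i hi j hi']
      rintro ⟨i', hi'', j', hj', hh⟩
      have := index_unique (s := ds) (i := i) (j := j) (i' := i') (j' := q / 2 + j') (by omega)
        (by omega) (by linarith)
      omega
    · have := ih₂ i hi (j - q / 2) (by omega)
      have e₂ : d + q / 2 + i * ds + (j - q / 2) = d + i * ds + j := by omega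
      have e₃ : a + q / 2 * ac + i * ar + (j - q / 2) * ac = a + i * ar + j * ac := by
        conv_rhs => rw [← Nat.add_sub_of_le (not_lt.1 hi')]
        ring
      rw [e₂, e₃] at this
      rw [this, e₁ _ (hsp i hi j hj).2, e₁ _ (hsp i hi j hj).1]
      · intro i' hi'' j' hj' hh
        have := index_unique (s := ds) (i := i) (j := j) (i' := i') (j' := j') (by omega)
          (by omega) (by linarith)
        omega
      · intro i' hi'' j' hj' hh
        have := h i' (by omega) j' (by omega) i hi j hj hh.symm
        omega

/-- The summand `4` is a potential: an inner node has two children, and one of their two reserves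
pays for its tests, call and fork. -/
theorem work_mapC_le (o : σ) {ds ar ac d a p q : ℕ} (hp : 1 ≤ p) (hq : 1 ≤ q) :
    (mapC o ds ar ac d a p q).work + 4 ≤ 8 * (p * q) := by
  fun_induction mapC o ds ar ac d a p q with
  | case1 d a p q h =>
    have := Nat.mul_pos hp hq
    simp only [Comp.work]
    omega
  | case2 d a p q h h' ih₁ ih₂ =>
    have h₁ := ih₁ (by omega) hq
    have h₂ := ih₂ (by omega) hq
    have : p / 2 * q + (p - p / 2) * q = p * q := by rw [← add_mul]; congr 1; omega
    simp only [Comp.work]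
    omega
  | case3 d a p q h h' ih₁ ih₂ =>
    have h₁ := ih₁ hp (by omega)
    have h₂ := ih₂ hp (by omega)
    have : p * (q / 2) + p * (q - q / 2) = p * q := by rw [← mul_add]; congr 1; omega
    simp only [Comp.work]
    omega

theorem clog_half {m h : ℕ} (hm : 2 ≤ m) (hh : h ≤ m - m / 2) :
    Nat.clog 2 h + 1 ≤ Nat.clog 2 m := by
  rw [Nat.clog_of_two_le (b := 2) one_lt_two hm]
  have : Nat.clog 2 h ≤ Nat.clog 2 ((m + 2 - 1) / 2) := Nat.clog_mono_right _ (by omega)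
  omega

theorem span_mapC_le (o : σ) {ds ar ac d a p q : ℕ} (hp : 1 ≤ p) (hq : 1 ≤ q) :
    (mapC o ds ar ac d a p q).span ≤ 4 * (Nat.clog 2 p + Nat.clog 2 q) + 3 := by
  fun_induction mapC o ds ar ac d a p q with
  | case1 d a p q h =>
    simp only [Comp.span]
    omega
  | case2 d a p q h h' ih₁ ih₂ =>
    have h₁ := ih₁ (by omega) hq
    have h₂ := ih₂ (by omega) hq
    have h₃ := clog_half (m := p) (h := p / 2) (by omega) (by omega)
    have h₄ := clog_half (m := p) (h := p - p / 2) (by omega) (by omega)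
    simp only [Comp.span]
    omega
  | case3 d a p q h h' ih₁ ih₂ =>
    have h₁ := ih₁ hp (by omega)
    have h₂ := ih₂ hp (by omega)
    have h₃ := clog_half (m := q) (h := q / 2) (by omega) (by omega)
    have h₄ := clog_half (m := q) (h := q - q / 2) (by omega) (by omega)
    simp only [Comp.span]
    omega

/-! ### Cache complexity -/

/-- The cache has `M` words and lines of `B` words, and `t` is proportional to `√M` with a constant
that depends on `θ`: blocks of size `t × t` fit into the cache, and their rows are not short. -/
structure Tall (θ : ℝ) (M B t : ℕ) : Prop where
  one_le_B : 1 ≤ B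
  two_le_t : 2 ≤ t
  two_le_θ : 2 ≤ θ
  B_le : (B : ℝ) ≤ θ * t
  fits : 20 * (t ^ 2 + t * B) ≤ M

theorem Tall.mono {θ θ' : ℝ} {M B t : ℕ} (h : Tall θ M B t) (hθ : θ ≤ θ') : Tall θ' M B t :=
  ⟨h.one_le_B, h.two_le_t, h.two_le_θ.trans hθ, h.B_le.trans (by gcongr), h.fits⟩

/-- The recursion splits the longer side, so blocks keep an aspect ratio of at most `3` until `p + q
≤ t`. Such a block fits into the cache and is still of order `t` in both directions, so even a
source read by columns has long enough runs of contiguous cells. A block costs its area divided by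
`B`, and areas add up exactly. -/
theorem serves_mapC {θ : ℝ} {M B t : ℕ} (hT : Tall θ M B t) (o : σ) {ds ar ac d a p q : ℕ}
    (hp : 1 ≤ p) (hq : 1 ≤ q) (hpq : p ≤ 3 * q) (hqp : q ≤ 3 * p) (ht : t ≤ 3 * (p + q))
    (hac : ac = 1 ∨ ar = 1) :
    Serves M B (mapC o ds ar ac d a p q).trace (66 * θ * (p * q / B)) (66 * θ * (p * q / B)) := by
  obtain ⟨hB, ht₂, hθ, hBt, hM⟩ := hT
  have hB' : (1 : ℝ) ≤ B := by exact_mod_cast hB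
  by_cases hs : p + q ≤ t
  · obtain ⟨A, hA, hAc⟩ : ∃ A : Finset ℕ, (∀ i < p, ∀ j < q, (a + i * ar + j * ac) / B ∈ A) ∧
        (A.card : ℝ) ≤ p * q / B + 2 * (p + q) := by
      rcases hac with rfl | rfl
      · refine ⟨blkLines B a ar p q, fun i hi j hj => mem_blkLines ⟨i, hi, j, hj, by ring⟩,
          (card_blkLines_le hB a ar p q).trans ?_⟩
        rw [mul_add, mul_div_assoc]
        have : (0 : ℝ) ≤ q := by positivity
        linarith
      · refine ⟨blkLines B a ac q p, fun i hi j hj => mem_blkLines ⟨j, hj, i, hi, by ring⟩,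
          (card_blkLines_le hB a ac q p).trans ?_⟩
        rw [mul_add, ← mul_div_assoc, mul_comm (q : ℝ) p]
        have : (0 : ℝ) ≤ p := by positivity
        linarith
    set F := blkLines B d ds p q ∪ A
    have hF : (F.card : ℝ) ≤ 2 * (p * q / B) + 4 * (p + q) := by
      have h₁ : (F.card : ℝ) ≤ (blkLines B d ds p q).card + A.card := by
        exact_mod_cast Finset.card_union_le _ _
      have h₂ := card_blkLines_le hB d ds p q
      rw [mul_add, ← mul_div_assoc] at h₂
      have : (0 : ℝ) ≤ q := by positivity
      linarith
    have hpt : (p + q : ℝ) ≤ t := by exact_mod_cast hs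
    have htp : (t : ℝ) ≤ 3 * (p + q) := by exact_mod_cast ht
    have hpq' : (p : ℝ) ≤ 3 * q := by exact_mod_cast hpq
    have hqp' : (q : ℝ) ≤ 3 * p := by exact_mod_cast hqp
    have hp0 : (1 : ℝ) ≤ p := by exact_mod_cast hp
    have hq0 : (1 : ℝ) ≤ q := by exact_mod_cast hq
    have hFM : F.card * B ≤ M := by
      have h₁ : (F.card : ℝ) * B ≤ 2 * (p * q) + 4 * (p + q) * B := by
        calc (F.card : ℝ) * B ≤ (2 * (p * q / B) + 4 * (p + q)) * B := by gcongr
          _ = _ := by field_simp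
      have h₂ : (20 * (t ^ 2 + t * B) : ℝ) ≤ M := by exact_mod_cast hM
      have h₃ : (p * q : ℝ) ≤ t ^ 2 := by nlinarith
      have h₄ : (p + q : ℝ) * B ≤ t * B := by gcongr
      have h₅ : (F.card : ℝ) * B ≤ M := by nlinarith
      exact_mod_cast h₅
    have key : (F.card : ℝ) ≤ 66 * θ * (p * q / B) := by
      refine hF.trans ?_
      -- The end effects of rows are absorbed by the area term: `B ≤ θ t ≤ 3 θ (p + q)` and `3 (p +
      -- q)² ≤ 16 p q`. The constant `66` is `2 + 4 · 16`.
      have h₁ : (p + q : ℝ) * B ≤ 16 * θ * (p * q) := by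
        have h₂ : (p + q : ℝ) ^ 2 * 3 ≤ 16 * (p * q) := by nlinarith
        calc (p + q : ℝ) * B ≤ (p + q) * (θ * t) := by gcongr
          _ ≤ (p + q) * (θ * (3 * (p + q))) := by gcongr
          _ = θ * ((p + q) ^ 2 * 3) := by ring
          _ ≤ θ * (16 * (p * q)) := by gcongr
          _ = _ := by ring
      have h₂ : (p + q : ℝ) ≤ 16 * θ * (p * q / B) := by
        rw [← mul_div_assoc, le_div_iff₀ (by positivity)]
        exact h₁
      have h₃ : (0 : ℝ) ≤ p * q / B := by positivity
      nlinarith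
    refine (serves_of_lines (F := F) (fun e he => ?_) hFM).mono key key
    obtain ⟨i, hi, j, hj, rfl⟩ := mem_trace_mapC hp hq he
    have := mem_blkLines (B := B) (Blk.intro (b := d) (s := ds) hi hj)
    exact ⟨Finset.mem_union_left _ this, Finset.mem_union_right _ (hA i hi j hj),
      Finset.mem_union_left _ this⟩
  · rw [mapC, if_neg (by omega)]
    split_ifs with h'
    · have h₁ := serves_mapC ⟨hB, ht₂, hθ, hBt, hM⟩ o (ds := ds) (ar := ar) (ac := ac) (d := d) (a := a)
        (p := p / 2) (q := q) (by omega) hq (by omega) (by omega) (by omega) hac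
      have h₂ := serves_mapC ⟨hB, ht₂, hθ, hBt, hM⟩ o (ds := ds) (ar := ar) (ac := ac)
        (d := d + p / 2 * ds) (a := a + p / 2 * ar)
        (p := p - p / 2) (q := q) (by omega) hq (by omega) (by omega) (by omega) hac
      have e : ((p / 2 : ℕ) : ℝ) + ((p - p / 2 : ℕ) : ℝ) = p := by
        rw [← Nat.cast_add]; congr 1; omega
      refine (h₁.append h₂).mono (le_of_eq ?_) (le_of_eq ?_) <;>
      · rw [← mul_add, ← add_div, ← add_mul, e]
    · have h₁ := serves_mapC ⟨hB, ht₂, hθ, hBt, hM⟩ o (ds := ds) (ar := ar) (ac := ac) (d := d) (a := a)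
        (p := p) (q := q / 2) hp (by omega) (by omega) (by omega) (by omega) hac
      have h₂ := serves_mapC ⟨hB, ht₂, hθ, hBt, hM⟩ o (ds := ds) (ar := ar) (ac := ac)
        (d := d + q / 2) (a := a + q / 2 * ac)
        (p := p) (q := q - q / 2) hp (by omega) (by omega) (by omega) (by omega) hac
      have e : ((q / 2 : ℕ) : ℝ) + ((q - q / 2 : ℕ) : ℝ) = q := by
        rw [← Nat.cast_add]; congr 1; omega
      refine (h₁.append h₂).mono (le_of_eq ?_) (le_of_eq ?_) <;>
      · rw [← mul_add, ← add_div, ← mul_add, e]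
termination_by p + q

/-! ## Matrix multiplication -/

/-- The data operations that matrix multiplication needs; `acc` is the accumulation `x + y` or `x - y`. -/
structure Kernel (σ : Type) where
  zero : σ
  copy : σ
  add : σ
  acc : σ
  mul : σ

/-- The interpretation of the operations; accumulation is `x + φ y` with an additive map `φ`. -/
structure Kernel.Lawful {R : Type u} [Semiring R] (o : Kernel σ) (I : σ → R → R → R) (φ : R →+ R) :
    Prop where
  zero : ∀ x y, I o.zero x y = 0
  copy : ∀ x y, I o.copy x y = x
  add : ∀ x y, I o.add x y = x + y
  acc : ∀ x y, I o.acc x y = x + φ y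
  mul : ∀ x y, I o.mul x y = x * y

/-- `C ← C + φ(A Bᵀ)` for `C` of size `p × q` at `c`, `A` of size `p × k` at `a` and `B` of size
`q × k` at `b`. The registers hold `c, sc, a, sa, b, sb, p, q, k, r`, where `sc, sa, sb` are the row
strides and `r` is the aspect ratio `k : p + q` that the recursion aims at. -/
def mmStmt (o : Kernel σ) : Stmt σ :=
  .ifLe (reg 8) (reg 9 * (reg 6 + reg 7) + 1)
    (.ifLe (reg 6 + reg 7) 2
      (.ifLe (reg 8) 1
        (.alloc 1 (.seq (.op o.mul (reg 0) (reg 3) (reg 5)) (.op o.acc (reg 1) (reg 1) (reg 0))))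
        (.seq
          (.call 4 [reg 0, reg 1, reg 2, reg 3, reg 4, reg 5, reg 6, reg 7, reg 8 / 2, reg 9])
          (.call 4 [reg 0, reg 1, reg 2 + reg 8 / 2, reg 3, reg 4 + reg 8 / 2, reg 5, reg 6, reg 7,
            reg 8 - reg 8 / 2, reg 9])))
      (.ifLe (reg 7) (reg 6)
        (.fork
          (.call 4 [reg 0, reg 1, reg 2, reg 3, reg 4, reg 5, reg 6 / 2, reg 7, reg 8, reg 9])
          (.call 4 [reg 0 + reg 6 / 2 * reg 1, reg 1, reg 2 + reg 6 / 2 * reg 3, reg 3, reg 4, reg 5,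
            reg 6 - reg 6 / 2, reg 7, reg 8, reg 9]))
        (.fork
          (.call 4 [reg 0, reg 1, reg 2, reg 3, reg 4, reg 5, reg 6, reg 7 / 2, reg 8, reg 9])
          (.call 4 [reg 0 + reg 7 / 2, reg 1, reg 2, reg 3, reg 4 + reg 7 / 2 * reg 5, reg 5,
            reg 6, reg 7 - reg 7 / 2, reg 8, reg 9]))))
    (.alloc (reg 6 * reg 7)
      (.seq
        (.fork
          (.seq
            (.call 1 [reg 0, reg 8, reg 0, reg 8, 1, reg 7, reg 8])
            (.call 4 [reg 0, reg 8, reg 3, reg 4, reg 5, reg 6, reg 7, reg 8, reg 9 / 2, reg 10]))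
          (.call 4 [reg 1, reg 2, reg 3 + reg 9 / 2, reg 4, reg 5 + reg 9 / 2, reg 6, reg 7, reg 8,
            reg 9 - reg 9 / 2, reg 10]))
        (.call 2 [reg 1, reg 2, reg 0, reg 8, 1, reg 7, reg 8])))

/-- The computation of `mmStmt`. -/
def mmC (o : Kernel σ) (r sa sb : ℕ) (sp c sc a b p q k : ℕ) : Comp σ :=
  if k ≤ r * (p + q) + 1 then
    if p + q ≤ 2 then
      if k ≤ 1 then
        .tick (.tick (.tick (.tick (.alloc 1 (.seq (.op o.mul sp a b) (.op o.acc c c sp))))))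
      else
        .tick (.tick (.tick (.tick (.seq (mmC o r sa sb sp c sc a b p q (k / 2))
          (mmC o r sa sb sp c sc (a + k / 2) (b + k / 2) p q (k - k / 2))))))
    else if q ≤ p then
      .tick (.tick (.tick (.tick (.fork (mmC o r sa sb sp c sc a b (p / 2) q k)
        (mmC o r sa sb sp (c + p / 2 * sc) sc (a + p / 2 * sa) b (p - p / 2) q k)))))
    else
      .tick (.tick (.tick (.tick (.fork (mmC o r sa sb sp c sc a b p (q / 2) k)
        (mmC o r sa sb sp (c + q / 2) sc a (b + q / 2 * sb) p (q - q / 2) k)))))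
  else
    .tick (.tick (.alloc (p * q) (.seq
      (.fork
        (.seq (mapC o.zero q q 1 sp sp p q) (mmC o r sa sb (sp + p * q) sp q a b p q (k / 2)))
        (mmC o r sa sb (sp + p * q) c sc (a + k / 2) (b + k / 2) p q (k - k / 2)))
      (mapC o.add sc q 1 c sp p q))))
termination_by p + q + k

/-- The program contains the loops and the matrix multiplication. -/
structure HasMM (P : Program σ) (o : Kernel σ) : Prop where
  zero : P[1]? = some (mapStmt 1 o.zero)
  add : P[2]? = some (mapStmt 2 o.add)
  mm : P[4]? = some (mmStmt o)

theorem unfolds_mmC {P : Program σ} {o : Kernel σ} (hP : HasMM P o) (r sa sb : ℕ)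
    (sp c sc a b p q k : ℕ) : ∀ (ρ : List ℕ) (args : List IExpr),
    args.map (IExpr.eval ρ) = [c, sc, a, sa, b, sb, p, q, k, r] →
      Unfolds P sp ρ (.call 4 args) (mmC o r sa sb sp c sc a b p q k) := by
  fun_induction mmC o r sa sb sp c sc a b p q k with
  | case1 sp c sc a b p q k h h' h'' =>
    exact fun ρ args hρ => .call hP.mm (hρ ▸ .ifTrue h (.ifTrue h' (.ifTrue h''
      (.alloc (.seq (.op ..) (.op ..))))))
  | case2 sp c sc a b p q k h h' h'' ih₁ ih₂ =>
    exact fun ρ args hρ => .call hP.mm (hρ ▸ .ifTrue h (.ifTrue h' (.ifFalse h''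
      (.seq (ih₁ _ _ rfl) (ih₂ _ _ rfl)))))
  | case3 sp c sc a b p q k h h' h'' ih₁ ih₂ =>
    exact fun ρ args hρ => .call hP.mm (hρ ▸ .ifTrue h (.ifFalse h' (.ifTrue h''
      (.fork (ih₁ _ _ rfl) (ih₂ _ _ rfl)))))
  | case4 sp c sc a b p q k h h' h'' ih₁ ih₂ =>
    exact fun ρ args hρ => .call hP.mm (hρ ▸ .ifTrue h (.ifFalse h' (.ifFalse h''
      (.fork (ih₁ _ _ rfl) (ih₂ _ _ rfl)))))
  | case5 sp c sc a b p q k h ih₁ ih₂ =>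
    exact fun ρ args hρ => .call hP.mm (hρ ▸ .ifFalse h (.alloc (.seq
      (.fork (.seq (unfolds_mapC hP.zero _ _ _ _ _ _ _ _ _ _ rfl) (ih₁ _ _ rfl)) (ih₂ _ _ rfl))
      (unfolds_mapC hP.add _ _ _ _ _ _ _ _ _ _ rfl))))

/-! ### Footprint, race-freeness and correctness of the multiplication. -/

/-- The arguments of a matrix multiplication are in order. -/
structure MMArgs (sp c sc a sa b sb p q k : ℕ) : Prop where
  hp : 1 ≤ p
  hq : 1 ≤ q
  hk : 1 ≤ k
  hs : q ≤ sc
  hC : ∀ x, Blk c sc p q x → x < sp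
  hA : ∀ x, Blk a sa p k x → x < sp
  hB : ∀ x, Blk b sb q k x → x < sp
  hCA : ∀ x, Blk c sc p q x → ¬ Blk a sa p k x
  hCB : ∀ x, Blk c sc p q x → ¬ Blk b sb q k x

namespace MMArgs

variable {sp c sc a sa b sb p q k : ℕ}

theorem sub (h : MMArgs sp c sc a sa b sb p q k) {c' a' b' p' q' k' : ℕ} (hp : 1 ≤ p') (hq : 1 ≤ q')
    (hk : 1 ≤ k') (hs : q' ≤ sc) (hC : ∀ x, Blk c' sc p' q' x → Blk c sc p q x)
    (hA : ∀ x, Blk a' sa p' k' x → Blk a sa p k x) (hB : ∀ x, Blk b' sb q' k' x → Blk b sb q k x) :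
    MMArgs sp c' sc a' sa b' sb p' q' k' :=
  ⟨hp, hq, hk, hs, fun x hx => h.hC x (hC x hx), fun x hx => h.hA x (hA x hx),
    fun x hx => h.hB x (hB x hx), fun x hx hx' => h.hCA x (hC x hx) (hA x hx'),
    fun x hx hx' => h.hCB x (hC x hx) (hB x hx')⟩

theorem kLeft (h : MMArgs sp c sc a sa b sb p q k) (hk : 2 ≤ k) :
    MMArgs sp c sc a sa b sb p q (k / 2) :=
  h.sub h.hp h.hq (by omega) h.hs (fun _ => id) (fun _ => Blk.left (by omega))
    (fun _ => Blk.left (by omega))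

theorem kRight (h : MMArgs sp c sc a sa b sb p q k) (hk : 2 ≤ k) :
    MMArgs sp c sc (a + k / 2) sa (b + k / 2) sb p q (k - k / 2) :=
  h.sub h.hp h.hq (by omega) h.hs (fun _ => id) (fun _ => Blk.right (by omega))
    (fun _ => Blk.right (by omega))

theorem pTop (h : MMArgs sp c sc a sa b sb p q k) (hp : 2 ≤ p) :
    MMArgs sp c sc a sa b sb (p / 2) q k :=
  h.sub (by omega) h.hq h.hk h.hs (fun _ => Blk.top (by omega)) (fun _ => Blk.top (by omega))
    (fun _ => id)

theorem pBottom (h : MMArgs sp c sc a sa b sb p q k) (hp : 2 ≤ p) :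
    MMArgs sp (c + p / 2 * sc) sc (a + p / 2 * sa) sa b sb (p - p / 2) q k :=
  h.sub (by omega) h.hq h.hk h.hs (fun _ => Blk.bottom (by omega)) (fun _ => Blk.bottom (by omega))
    (fun _ => id)

theorem qLeft (h : MMArgs sp c sc a sa b sb p q k) (hq : 2 ≤ q) :
    MMArgs sp c sc a sa b sb p (q / 2) k :=
  h.sub h.hp (by omega) h.hk (by have := h.hs; omega) (fun _ => Blk.left (by omega)) (fun _ => id)
    (fun _ => Blk.top (by omega))

theorem qRight (h : MMArgs sp c sc a sa b sb p q k) (hq : 2 ≤ q) :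
    MMArgs sp (c + q / 2) sc a sa (b + q / 2 * sb) sb p (q - q / 2) k :=
  h.sub h.hp (by omega) h.hk (by have := h.hs; omega) (fun _ => Blk.right (by omega)) (fun _ => id)
    (fun _ => Blk.bottom (by omega))

theorem push (h : MMArgs sp c sc a sa b sb p q k) {sp' : ℕ} (hs : sp ≤ sp') :
    MMArgs sp' c sc a sa b sb p q k :=
  ⟨h.hp, h.hq, h.hk, h.hs, fun x hx => (h.hC x hx).trans_le hs, fun x hx => (h.hA x hx).trans_le hs,
    fun x hx => (h.hB x hx).trans_le hs, h.hCA, h.hCB⟩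

theorem temp (h : MMArgs sp c sc a sa b sb p q k) : MMArgs (sp + p * q) sp q a sa b sb p q k :=
  ⟨h.hp, h.hq, h.hk, le_rfl, fun x hx => hx.compact.2, fun x hx => (h.hA x hx).trans_le (by omega),
    fun x hx => (h.hB x hx).trans_le (by omega),
    fun x hx hx' => (h.hA x hx').not_ge hx.compact.1, fun x hx hx' => (h.hB x hx').not_ge hx.compact.1⟩

end MMArgs

theorem touches_mmC {o : Kernel σ} {r sa sb sp c sc a b p q k : ℕ}
    (h : MMArgs sp c sc a sa b sb p q k) :
    (mmC o r sa sb sp c sc a b p q k).Touches (fun x => Blk c sc p q x ∨ sp ≤ x)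
      (fun x => Blk c sc p q x ∨ Blk a sa p k x ∨ Blk b sb q k x ∨ sp ≤ x) := by
  fun_induction mmC o r sa sb sp c sc a b p q k with
  | case1 sp c sc a b p q k h₁ h₂ h₃ =>
    have hc := Blk.intro (b := c) (s := sc) h.hp h.hq
    have ha := Blk.intro (b := a) (s := sa) h.hp h.hk
    have hb := Blk.intro (b := b) (s := sb) h.hq h.hk
    simp only [zero_mul, add_zero] at hc ha hb
    exact .tick (.tick (.tick (.tick (.alloc (.seq
      (.op (.inr le_rfl) (.inr (.inl ha)) (.inr (.inr (.inl hb))))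
      (.op (.inl hc) (.inl hc) (.inr (.inr (.inr le_rfl)))))))))
  | case2 sp c sc a b p q k h₁ h₂ h₃ ih₁ ih₂ =>
    refine .tick (.tick (.tick (.tick (.seq ((ih₁ (h.kLeft (by omega))).mono (fun _ => id) ?_)
      ((ih₂ (h.kRight (by omega))).mono (fun _ => id) ?_)))))
    · exact fun x => .imp id (.imp (Blk.left (by omega)) (.imp (Blk.left (by omega)) id))
    · exact fun x => .imp id (.imp (Blk.right (by omega)) (.imp (Blk.right (by omega)) id))
  | case3 sp c sc a b p q k h₁ h₂ h₃ ih₁ ih₂ =>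
    refine .tick (.tick (.tick (.tick (.fork ((ih₁ (h.pTop (by omega))).mono ?_ ?_)
      ((ih₂ (h.pBottom (by omega))).mono ?_ ?_)))))
    · exact fun x => .imp (Blk.top (by omega)) id
    · exact fun x => .imp (Blk.top (by omega)) (.imp (Blk.top (by omega)) id)
    · exact fun x => .imp (Blk.bottom (by omega)) id
    · exact fun x => .imp (Blk.bottom (by omega)) (.imp (Blk.bottom (by omega)) id)
  | case4 sp c sc a b p q k h₁ h₂ h₃ ih₁ ih₂ =>
    refine .tick (.tick (.tick (.tick (.fork ((ih₁ (h.qLeft (by omega))).mono ?_ ?_)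
      ((ih₂ (h.qRight (by omega))).mono ?_ ?_)))))
    · exact fun x => .imp (Blk.left (by omega)) id
    · exact fun x => .imp (Blk.left (by omega)) (.imp id (.imp (Blk.top (by omega)) id))
    · exact fun x => .imp (Blk.right (by omega)) id
    · exact fun x => .imp (Blk.right (by omega)) (.imp id (.imp (Blk.bottom (by omega)) id))
  | case5 sp c sc a b p q k h₁ ih₁ ih₂ =>
    have hT : ∀ i < p, ∀ j < q, sp ≤ sp + i * q + j := fun i _ j _ => by omega
    refine .tick (.tick (.alloc (.seq (.fork (.seq ?_ ?_) ?_) ?_)))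
    · refine touches_mapC h.hp h.hq (fun i hi j hj => .inr (hT i hi j hj)) (fun i hi j hj => ⟨?_, ?_⟩)
      exacts [.inr (.inr (.inr (hT i hi j hj))), .inr (.inr (.inr (by omega)))]
    · refine (ih₁ (h.temp.kLeft (by omega))).mono (fun x => ?_) (fun x => ?_)
      · rintro (hx | hx)
        exacts [.inr hx.compact.1, .inr (by omega)]
      · rintro (hx | hx | hx | hx)
        exacts [.inr (.inr (.inr hx.compact.1)), .inr (.inl (hx.left (by omega))),
          .inr (.inr (.inl (hx.left (by omega)))), .inr (.inr (.inr (by omega)))]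
    · refine (ih₂ ((h.kRight (by omega)).push (by omega))).mono (fun x => ?_) (fun x => ?_)
      · rintro (hx | hx)
        exacts [.inl hx, .inr (by omega)]
      · rintro (hx | hx | hx | hx)
        exacts [.inl hx, .inr (.inl (hx.right (by omega))),
          .inr (.inr (.inl (hx.right (by omega)))), .inr (.inr (.inr (by omega)))]
    · refine touches_mapC h.hp h.hq (fun i hi j hj => .inl (.intro hi hj))
        (fun i hi j hj => ⟨.inl (.intro hi hj), .inr (.inr (.inr (by omega)))⟩)

theorem inScope_mmC {o : Kernel σ} {r sa sb sp c sc a b p q k : ℕ}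
    (h : MMArgs sp c sc a sa b sb p q k) : (mmC o r sa sb sp c sc a b p q k).InScope sp := by
  fun_induction mmC o r sa sb sp c sc a b p q k with
  | case1 sp c sc a b p q k h₁ h₂ h₃ =>
    have hc := h.hC _ (Blk.intro h.hp h.hq)
    have ha := h.hA _ (Blk.intro h.hp h.hk)
    have hb := h.hB _ (Blk.intro h.hq h.hk)
    simp only [zero_mul, add_zero] at hc ha hb
    exact ⟨trivial, trivial, trivial, trivial, ⟨by omega, by omega, by omega⟩, by omega, by omega,
      by omega⟩
  | case2 sp c sc a b p q k h₁ h₂ h₃ ih₁ ih₂ =>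
    exact ⟨trivial, trivial, trivial, trivial, ih₁ (h.kLeft (by omega)), ih₂ (h.kRight (by omega))⟩
  | case3 sp c sc a b p q k h₁ h₂ h₃ ih₁ ih₂ =>
    exact ⟨trivial, trivial, trivial, trivial, ih₁ (h.pTop (by omega)), ih₂ (h.pBottom (by omega))⟩
  | case4 sp c sc a b p q k h₁ h₂ h₃ ih₁ ih₂ =>
    exact ⟨trivial, trivial, trivial, trivial, ih₁ (h.qLeft (by omega)), ih₂ (h.qRight (by omega))⟩
  | case5 sp c sc a b p q k h₁ ih₁ ih₂ =>
    have hT : ∀ i < p, ∀ j < q, sp + i * q + j < sp + p * q := fun i hi j hj =>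
      (Blk.intro (b := sp) (s := q) hi hj).compact.2
    refine ⟨trivial, trivial, ⟨⟨?_, ih₁ (h.temp.kLeft (by omega))⟩,
      ih₂ ((h.kRight (by omega)).push (by omega))⟩, ?_⟩
    · exact inScope_mapC h.hp h.hq fun i hi j hj => ⟨hT i hi j hj, by simpa using hT i hi j hj⟩
    · exact inScope_mapC h.hp h.hq fun i hi j hj =>
        ⟨(h.hC _ (.intro hi hj)).trans_le (by omega), by simpa using hT i hi j hj⟩

/-- Splits of `p` or `q` write disjoint parts of `C` and only share what they read. A split of `k`
would make both halves write all of `C`; the temporary above `sp` separates them. In a single cell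
the halves run sequentially and need none. -/
theorem raceFree_mmC {o : Kernel σ} {r sa sb sp c sc a b p q k : ℕ}
    (h : MMArgs sp c sc a sa b sb p q k) : (mmC o r sa sb sp c sc a b p q k).RaceFree sp := by
  fun_induction mmC o r sa sb sp c sc a b p q k with
  | case1 => exact ⟨trivial, trivial, trivial, trivial, trivial, trivial⟩
  | case2 sp c sc a b p q k h₁ h₂ h₃ ih₁ ih₂ =>
    exact ⟨trivial, trivial, trivial, trivial, ih₁ (h.kLeft (by omega)), ih₂ (h.kRight (by omega))⟩
  | case3 sp c sc a b p q k h₁ h₂ h₃ ih₁ ih₂ =>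
    have h₄ := h.pTop (by omega)
    have h₅ := h.pBottom (by omega)
    refine ⟨trivial, trivial, trivial, trivial,
      (touches_mmC h₄).raceFree_fork (ih₁ h₄) (ih₂ h₅) (touches_mmC h₅) (fun x hx hW => ?_)
        (fun x hx hW => ?_)⟩
    · have hW := hW.resolve_right (by omega)
      have hd := hW.rows_disjoint (i := p / 2) (p'' := p - p / 2) h.hs le_rfl
      refine ⟨?_, fun hh => hd (hh.resolve_right (by omega))⟩
      rintro (hx | hx | hx | hx)
      exacts [hd hx, h.hCA x (hW.top (by omega)) (hx.bottom (by omega)),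
        h.hCB x (hW.top (by omega)) hx, by omega]
    · have hW := hW.resolve_right (by omega)
      have hd : ¬ Blk c sc (p / 2) q x := fun hh => hh.rows_disjoint h.hs le_rfl hW
      refine ⟨?_, fun hh => hd (hh.resolve_right (by omega))⟩
      rintro (hx | hx | hx | hx)
      exacts [hd hx, h.hCA x (hW.bottom (by omega)) (hx.top (by omega)),
        h.hCB x (hW.bottom (by omega)) hx, by omega]
  | case4 sp c sc a b p q k h₁ h₂ h₃ ih₁ ih₂ =>
    have h₄ := h.qLeft (by omega)
    have h₅ := h.qRight (by omega)
    have hs := h.hs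
    refine ⟨trivial, trivial, trivial, trivial,
      (touches_mmC h₄).raceFree_fork (ih₁ h₄) (ih₂ h₅) (touches_mmC h₅) (fun x hx hW => ?_)
        (fun x hx hW => ?_)⟩
    · have hW := hW.resolve_right (by omega)
      have hd := hW.cols_disjoint (j := q / 2) (q'' := q - q / 2) (by omega) le_rfl
      refine ⟨?_, fun hh => hd (hh.resolve_right (by omega))⟩
      rintro (hx | hx | hx | hx)
      exacts [hd hx, h.hCA x (hW.left (by omega)) hx,
        h.hCB x (hW.left (by omega)) (hx.bottom (by omega)), by omega]
    · have hW := hW.resolve_right (by omega)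
      have hd : ¬ Blk c sc p (q / 2) x := fun hh => hh.cols_disjoint (by omega) le_rfl hW
      refine ⟨?_, fun hh => hd (hh.resolve_right (by omega))⟩
      rintro (hx | hx | hx | hx)
      exacts [hd hx, h.hCA x (hW.right (by omega)) hx,
        h.hCB x (hW.right (by omega)) (hx.top (by omega)), by omega]
  | case5 sp c sc a b p q k h₁ ih₁ ih₂ =>
    have h₄ := h.temp.kLeft (by omega)
    have h₅ := (h.kRight (by omega)).push (show sp ≤ sp + p * q by omega)
    have h₆ : (Comp.seq (mapC o.zero q q 1 sp sp p q)
        (mmC o r sa sb (sp + p * q) sp q a b p q (k / 2))).Touches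
        (fun x => Blk sp q p q x ∨ sp + p * q ≤ x)
        (fun x => Blk sp q p q x ∨ Blk a sa p (k / 2) x ∨ Blk b sb q (k / 2) x ∨ sp + p * q ≤ x) := by
      refine .seq (touches_mapC h.hp h.hq (fun i hi j hj => .inl (.intro hi hj))
        (fun i hi j hj => ⟨.inl (.intro hi hj), .inl ?_⟩)) (touches_mmC h₄)
      exact ⟨i, hi, j, hj, by ring⟩
    refine ⟨trivial, trivial, h₆.raceFree_fork ⟨?_, ih₁ h₄⟩ (ih₂ h₅) (touches_mmC h₅)
        (fun x hx hW => ?_) (fun x hx hW => ?_), ?_⟩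
    · refine raceFree_mapC h.hp h.hq le_rfl fun i hi j hj i' hi' j' hj' hh => ?_
      exact index_unique hj hj' (by linarith)
    · have hW := (hW.resolve_right (by omega)).compact
      have hc : ¬ Blk c sc p q x := fun hh => (h.hC x hh).not_ge hW.1
      refine ⟨?_, fun hh => hc (hh.resolve_right (by omega))⟩
      rintro (hx | hx | hx | hx)
      exacts [hc hx, (h.hA x (hx.right (by omega))).not_ge hW.1,
        (h.hB x (hx.right (by omega))).not_ge hW.1, by omega]
    · have hW := hW.resolve_right (by omega)
      have hc : ¬ Blk sp q p q x := fun hh => (h.hC x hW).not_ge hh.compact.1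
      refine ⟨?_, fun hh => hc (hh.resolve_right (by omega))⟩
      rintro (hx | hx | hx | hx)
      exacts [hc hx, h.hCA x hW (hx.left (by omega)), h.hCB x hW (hx.left (by omega)), by omega]
    · refine raceFree_mapC h.hp h.hq h.hs fun i hi j hj i' hi' j' hj' hh => ?_
      have := h.hC _ (.intro hi hj)
      omega

/-- Additivity of `φ` is what lets the sum over `k` be cut at any place, with the parts accumulated
separately. Commutativity of multiplication is never used, so arbitrary semirings are covered. The
operands keep their values because `C` and the stack are disjoint from them. -/
theorem run_mmC {R : Type u} [Semiring R] {I : σ → R → R → R} {φ : R →+ R} {o : Kernel σ}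
    (ho : o.Lawful I φ) (junk : ℕ → R) {r sa sb sp c sc a b p q k : ℕ}
    (h : MMArgs sp c sc a sa b sb p q k) (m : ℕ → R) :
    ∀ i < p, ∀ j < q, (mmC o r sa sb sp c sc a b p q k).run I junk sp m (c + i * sc + j) =
      m (c + i * sc + j) + φ (∑ l ∈ Finset.range k, m (a + i * sa + l) * m (b + j * sb + l)) := by
  fun_induction mmC o r sa sb sp c sc a b p q k generalizing m with
  | case1 sp c sc a b p q k h₁ h₂ h₃ =>
    intro i hi j hj
    have := h.hk
    obtain rfl : i = 0 := by omega
    obtain rfl : j = 0 := by omega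
    obtain rfl : k = 1 := by omega
    have hc := h.hC _ (Blk.intro h.hp h.hq)
    have ha := h.hA _ (Blk.intro h.hp h.hk)
    have hb := h.hB _ (Blk.intro h.hq h.hk)
    simp only [zero_mul, add_zero] at hc ha hb
    simp [Comp.run, ho.acc, ho.mul, hc.ne, not_le.2 hc, not_le.2 ha, not_le.2 hb]
  | case2 sp c sc a b p q k h₁ h₂ h₃ ih₁ ih₂ =>
    intro i hi j hj
    have h₄ := h.kLeft (by omega)
    simp only [Comp.run]
    rw [ih₂ (h.kRight (by omega)) _ i hi j hj, ih₁ h₄ _ i hi j hj, add_assoc, ← map_add]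
    congr 2
    conv_rhs => rw [show k = k / 2 + (k - k / 2) by omega, Finset.sum_range_add]
    congr 1
    refine Finset.sum_congr rfl fun l hl => ?_
    have hl := Finset.mem_range.1 hl
    have ha : Blk a sa p k (a + i * sa + (k / 2 + l)) := .intro hi (by omega)
    have hb : Blk b sb q k (b + j * sb + (k / 2 + l)) := .intro hj (by omega)
    rw [show a + k / 2 + i * sa + l = a + i * sa + (k / 2 + l) by ring,
      show b + k / 2 + j * sb + l = b + j * sb + (k / 2 + l) by ring,
      (touches_mmC h₄).run_eq (h.hA _ ha), (touches_mmC h₄).run_eq (h.hB _ hb)]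
    · rintro (hx | hx)
      exacts [h.hCB _ hx hb, (h.hB _ hb).not_ge hx]
    · rintro (hx | hx)
      exacts [h.hCA _ hx ha, (h.hA _ ha).not_ge hx]
  | case3 sp c sc a b p q k h₁ h₂ h₃ ih₁ ih₂ =>
    intro i hi j hj
    have h₄ := h.pTop (by omega)
    have h₅ := h.pBottom (by omega)
    simp only [Comp.run]
    by_cases hi' : i < p / 2
    · rw [(touches_mmC h₅).run_eq (h.hC _ (.intro hi hj)), ih₁ h₄ _ i hi' j hj]
      rintro (hx | hx)
      exacts [Blk.rows_disjoint h.hs le_rfl (.intro hi' hj) hx, (h.hC _ (.intro hi hj)).not_ge hx]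
    · obtain ⟨i, rfl⟩ := Nat.exists_eq_add_of_le (not_lt.1 hi')
      have e := ih₂ h₅ ((mmC o r sa sb sp c sc a b (p / 2) q k).run I junk sp m) i (by omega) j hj
      rw [show c + p / 2 * sc + i * sc + j = c + (p / 2 + i) * sc + j by ring,
        show a + p / 2 * sa + i * sa = a + (p / 2 + i) * sa by ring] at e
      rw [e, (touches_mmC h₄).run_eq (h.hC _ (.intro hi hj))]
      · congr 2
        refine Finset.sum_congr rfl fun l hl => ?_
        have hl := Finset.mem_range.1 hl
        have ha : Blk a sa p k (a + (p / 2 + i) * sa + l) := .intro hi hl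
        have hb : Blk b sb q k (b + j * sb + l) := .intro hj hl
        rw [(touches_mmC h₄).run_eq (h.hA _ ha), (touches_mmC h₄).run_eq (h.hB _ hb)]
        · rintro (hx | hx)
          exacts [h₄.hCB _ hx hb, (h.hB _ hb).not_ge hx]
        · rintro (hx | hx)
          exacts [h.hCA _ (hx.top (by omega)) ha, (h.hA _ ha).not_ge hx]
      · rintro (hx | hx)
        · refine hx.rows_disjoint (i := p / 2) (p'' := p - p / 2) h.hs le_rfl ?_
          exact ⟨i, by omega, j, hj, by ring⟩
        · exact (h.hC _ (.intro hi hj)).not_ge hx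
  | case4 sp c sc a b p q k h₁ h₂ h₃ ih₁ ih₂ =>
    intro i hi j hj
    have h₄ := h.qLeft (by omega)
    have h₅ := h.qRight (by omega)
    have hs := h.hs
    simp only [Comp.run]
    by_cases hj' : j < q / 2
    · rw [(touches_mmC h₅).run_eq (h.hC _ (.intro hi hj)), ih₁ h₄ _ i hi j hj']
      rintro (hx | hx)
      exacts [Blk.cols_disjoint (by omega) le_rfl (.intro hi hj') hx,
        (h.hC _ (.intro hi hj)).not_ge hx]
    · obtain ⟨j, rfl⟩ := Nat.exists_eq_add_of_le (not_lt.1 hj')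
      have e := ih₂ h₅ ((mmC o r sa sb sp c sc a b p (q / 2) k).run I junk sp m) i hi j (by omega)
      rw [show c + q / 2 + i * sc + j = c + i * sc + (q / 2 + j) by ring,
        show b + q / 2 * sb + j * sb = b + (q / 2 + j) * sb by ring] at e
      rw [e, (touches_mmC h₄).run_eq (h.hC _ (.intro hi hj))]
      · congr 2
        refine Finset.sum_congr rfl fun l hl => ?_
        have hl := Finset.mem_range.1 hl
        have ha : Blk a sa p k (a + i * sa + l) := .intro hi hl
        have hb : Blk b sb q k (b + (q / 2 + j) * sb + l) := .intro hj hl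
        rw [(touches_mmC h₄).run_eq (h.hA _ ha), (touches_mmC h₄).run_eq (h.hB _ hb)]
        · rintro (hx | hx)
          exacts [h.hCB _ (hx.left (by omega)) hb, (h.hB _ hb).not_ge hx]
        · rintro (hx | hx)
          exacts [h₄.hCA _ hx ha, (h.hA _ ha).not_ge hx]
      · rintro (hx | hx)
        · refine hx.cols_disjoint (j := q / 2) (q'' := q - q / 2) (by omega) le_rfl ?_
          exact ⟨i, hi, j, by omega, by ring⟩
        · exact (h.hC _ (.intro hi hj)).not_ge hx
  | case5 sp c sc a b p q k h₁ ih₁ ih₂ =>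
    intro i hi j hj
    have h₄ := h.temp.kLeft (by omega)
    have h₅ := (h.kRight (by omega)).push (show sp ≤ sp + p * q by omega)
    have hT : ∀ i < p, ∀ j < q, sp + i * q + j < sp + p * q := fun i hi j hj =>
      (Blk.intro (b := sp) (s := q) hi hj).compact.2
    simp only [Comp.run]
    set m₀ : ℕ → R := fun x => if sp ≤ x ∧ x < sp + p * q then junk x else m x
    set m₁ := (mapC o.zero q q 1 sp sp p q).run I junk (sp + p * q) m₀
    set m₂ := (mmC o r sa sb (sp + p * q) sp q a b p q (k / 2)).run I junk (sp + p * q) m₁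
    set m₃ := (mmC o r sa sb (sp + p * q) c sc (a + k / 2) (b + k / 2) p q (k - k / 2)).run I junk
      (sp + p * q) m₂
    have e₁ : ∀ x < sp, m₁ x = m x := fun x hx => by
      have : m₁ x = m₀ x := (touches_mapC (W := fun y => sp ≤ y) (X := fun _ => True) h.hp h.hq
        (fun i hi j hj => by omega) (fun _ _ _ _ => ⟨trivial, trivial⟩)).run_eq
        (hx.trans_le (Nat.le_add_right _ _)) (by omega)
      rw [this]
      simp [m₀, not_le.2 hx]
    have e₁' : m₁ (sp + i * q + j) = 0 := by
      have := run_mapC I junk (o := o.zero) (ds := q) (ar := q) (ac := 1) (d := sp) (a := sp)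
        (sp := sp + p * q) h.hp h.hq le_rfl
        (fun i hi j hj => ⟨hT i hi j hj, by simpa using hT i hi j hj⟩)
        (fun i hi j hj i' hi' j' hj' hh => index_unique hj hj' (by linarith)) m₀ i hi j hj
      rw [ho.zero] at this
      exact this
    have e₂ : ∀ x < sp, m₂ x = m x := fun x hx => by
      rw [← e₁ x hx]
      refine (touches_mmC h₄).run_eq (hx.trans_le (Nat.le_add_right _ _)) ?_
      rintro (hh | hh)
      · exact hx.not_ge hh.compact.1
      · omega
    have e₂' : m₂ (sp + i * q + j) =
        φ (∑ l ∈ Finset.range (k / 2), m (a + i * sa + l) * m (b + j * sb + l)) := by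
      have := ih₁ h₄ m₁ i hi j hj
      rw [e₁', zero_add] at this
      refine this.trans ?_
      congr 1
      refine Finset.sum_congr rfl fun l hl => ?_
      have hl := Finset.mem_range.1 hl
      rw [e₁ _ (h.hA _ (.intro hi (by omega))), e₁ _ (h.hB _ (.intro hj (by omega)))]
    have e₃ : m₃ (sp + i * q + j) = m₂ (sp + i * q + j) := by
      refine (touches_mmC h₅).run_eq (hT i hi j hj) ?_
      rintro (hh | hh)
      · have := h.hC _ hh
        omega
      · exact (hT i hi j hj).not_ge hh
    have e₃' : m₃ (c + i * sc + j) = m (c + i * sc + j) + φ (∑ l ∈ Finset.range (k - k / 2),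
        m (a + i * sa + (k / 2 + l)) * m (b + j * sb + (k / 2 + l))) := by
      have := ih₂ h₅ m₂ i hi j hj
      rw [e₂ _ (h.hC _ (.intro hi hj))] at this
      refine this.trans ?_
      congr 2
      refine Finset.sum_congr rfl fun l hl => ?_
      have hl := Finset.mem_range.1 hl
      rw [show a + k / 2 + i * sa + l = a + i * sa + (k / 2 + l) by ring,
        show b + k / 2 + j * sb + l = b + j * sb + (k / 2 + l) by ring,
        e₂ _ (h.hA _ (.intro hi (by omega))), e₂ _ (h.hB _ (.intro hj (by omega)))]
    have e₄ := run_mapC I junk (o := o.add) (ds := sc) (ar := q) (ac := 1) (d := c) (a := sp)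
        (sp := sp + p * q) h.hp h.hq h.hs
        (fun i hi j hj => ⟨(h.hC _ (.intro hi hj)).trans_le (by omega), by simpa using hT i hi j hj⟩)
        (fun i hi j hj i' hi' j' hj' hh => by
          have := h.hC _ (.intro hi hj)
          omega) m₃ i hi j hj
    rw [e₄, ho.add, mul_one, e₃, e₂', e₃', add_left_comm, ← map_add, ← Finset.sum_range_add]
    congr 4
    omega

/-! ### Costs of matrix multiplication -/

/-- A temporary of `p q` cells is charged to the part of `k` that each branch below the split loses.
In bricks with `k = O(r (p + q))` the stack is therefore `O((p + q)²)`, with no factor `r`. -/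
theorem extent_mmC_le {o : Kernel σ} {r sa sb sp c sc a b p q k : ℕ} (hp : 1 ≤ p)
    (hq : 1 ≤ q) (hk : 1 ≤ k) :
    r * (mmC o r sa sb sp c sc a b p q k).extent + 2 * q ≤ r + 2 * (q * k) := by
  fun_induction mmC o r sa sb sp c sc a b p q k with
  | case1 sp c sc a b p q k h₁ h₂ h₃ =>
    simp only [Comp.extent]
    have := Nat.mul_le_mul_left q hk
    simp
    omega
  | case2 sp c sc a b p q k h₁ h₂ h₃ ih₁ ih₂ =>
    have h₄ := ih₁ hp hq (by omega)
    have h₅ := ih₂ hp hq (by omega)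
    have h₆ : q * (k / 2) ≤ q * k := Nat.mul_le_mul_left _ (by omega)
    have h₇ : q * (k - k / 2) ≤ q * k := Nat.mul_le_mul_left _ (by omega)
    simp only [Comp.extent, Nat.zero_max]
    rcases le_total (mmC o r sa sb sp c sc a b p q (k / 2)).extent
      (mmC o r sa sb sp c sc (a + k / 2) (b + k / 2) p q (k - k / 2)).extent with h | h
    · rw [max_eq_right h]; omega
    · rw [max_eq_left h]; omega
  | case3 sp c sc a b p q k h₁ h₂ h₃ ih₁ ih₂ =>
    have h₄ := ih₁ (by omega) hq hk
    have h₅ := ih₂ (by omega) hq hk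
    simp only [Comp.extent, Nat.zero_max]
    rcases max_choice (mmC o r sa sb sp c sc a b (p / 2) q k).extent
      (mmC o r sa sb sp (c + p / 2 * sc) sc (a + p / 2 * sa) b (p - p / 2) q k).extent with h | h
    · rw [h]; exact h₄
    · rw [h]; exact h₅
  | case4 sp c sc a b p q k h₁ h₂ h₃ ih₁ ih₂ =>
    have h₄ := ih₁ hp (by omega) hk
    have h₅ := ih₂ hp (by omega) hk
    have h₆ : q / 2 * k + (q - q / 2) * k = q * k := by rw [← add_mul]; congr 1; omega
    have h₇ := Nat.mul_le_mul_left (q / 2) hk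
    have h₈ := Nat.mul_le_mul_left (q - q / 2) hk
    simp only [Comp.extent, Nat.zero_max]
    rcases max_choice (mmC o r sa sb sp c sc a b p (q / 2) k).extent
      (mmC o r sa sb sp (c + q / 2) sc a (b + q / 2 * sb) p (q - q / 2) k).extent with h | h
    · rw [h]; omega
    · rw [h]; omega
  | case5 sp c sc a b p q k h₁ ih₁ ih₂ =>
    have h₄ := ih₁ hp hq (by omega)
    have h₅ := ih₂ hp hq (by omega)
    have h₆ : q * (k / 2) + q * (k - k / 2) = q * k := by rw [← mul_add]; congr 1; omega
    have h₇ : q * (k / 2) ≤ q * (k - k / 2) := Nat.mul_le_mul_left _ (by omega)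
    -- The test has failed, so `k ≥ r (p + q) + 2`; the `+ 1` in the test makes the rounded half
    -- large enough.
    have h₈ : q * (r * (p + q)) ≤ q * (2 * (k / 2)) := Nat.mul_le_mul_left _ (by omega)
    have h₉ : r * (p * q) ≤ q * (r * (p + q)) := by nlinarith [Nat.zero_le (q * (r * q))]
    simp only [Comp.extent, Nat.zero_max, extent_mapC, Nat.max_zero]
    rcases max_choice (mmC o r sa sb (sp + p * q) sp q a b p q (k / 2)).extent
      (mmC o r sa sb (sp + p * q) c sc (a + k / 2) (b + k / 2) p q (k - k / 2)).extent with h | h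
    · rw [h, mul_add]; linarith
    · rw [h, mul_add]; linarith

/-- Both extra terms are potentials. A split of `k` doubles `16 p q` and releases enough for zeroing
and adding a temporary, at most `8 p q` each; the `5` pays for control at inner nodes. A leaf does
`7` operations, and `7 + 5 + 16 = 28`. -/
theorem work_mmC_le {o : Kernel σ} {r sa sb sp c sc a b p q k : ℕ} (hp : 1 ≤ p)
    (hq : 1 ≤ q) (hk : 1 ≤ k) :
    (mmC o r sa sb sp c sc a b p q k).work + 5 + 16 * (p * q) ≤ 28 * (p * q * k) := by
  fun_induction mmC o r sa sb sp c sc a b p q k with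
  | case1 sp c sc a b p q k h₁ h₂ h₃ =>
    obtain rfl : p = 1 := by omega
    obtain rfl : q = 1 := by omega
    obtain rfl : k = 1 := by omega
    simp [Comp.work]
  | case2 sp c sc a b p q k h₁ h₂ h₃ ih₁ ih₂ =>
    have h₄ := ih₁ hp hq (by omega)
    have h₅ := ih₂ hp hq (by omega)
    obtain rfl : p = 1 := by omega
    obtain rfl : q = 1 := by omega
    simp only [Comp.work]
    omega
  | case3 sp c sc a b p q k h₁ h₂ h₃ ih₁ ih₂ =>
    have h₄ := ih₁ (by omega) hq hk
    have h₅ := ih₂ (by omega) hq hk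
    have h₆ : p / 2 * q + (p - p / 2) * q = p * q := by rw [← add_mul]; congr 1; omega
    have h₇ : p / 2 * q * k + (p - p / 2) * q * k = p * q * k := by rw [← add_mul, h₆]
    simp only [Comp.work]
    omega
  | case4 sp c sc a b p q k h₁ h₂ h₃ ih₁ ih₂ =>
    have h₄ := ih₁ hp (by omega) hk
    have h₅ := ih₂ hp (by omega) hk
    have h₆ : p * (q / 2) + p * (q - q / 2) = p * q := by rw [← mul_add]; congr 1; omega
    have h₇ : p * (q / 2) * k + p * (q - q / 2) * k = p * q * k := by rw [← add_mul, h₆]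
    simp only [Comp.work]
    omega
  | case5 sp c sc a b p q k h₁ ih₁ ih₂ =>
    have h₄ := ih₁ hp hq (by omega)
    have h₅ := ih₂ hp hq (by omega)
    have h₆ : p * q * (k / 2) + p * q * (k - k / 2) = p * q * k := by rw [← mul_add]; congr 1; omega
    have h₇ := work_mapC_le o.zero (ds := q) (ar := q) (ac := 1) (d := sp) (a := sp) hp hq
    have h₈ := work_mapC_le o.add (ds := sc) (ar := q) (ac := 1) (d := c) (a := sp) hp hq
    simp only [Comp.work]
    omega

/-- Each scalar product is one operation of some leaf, and the volumes of the leaves add up. -/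
theorem le_work_mmC {o : Kernel σ} {r sa sb sp c sc a b p q k : ℕ} :
    p * q * k ≤ (mmC o r sa sb sp c sc a b p q k).work := by
  fun_induction mmC o r sa sb sp c sc a b p q k with
  | case1 sp c sc a b p q k h₁ h₂ h₃ =>
    have h₄ : p * q ≤ 1 := by
      have : p ≤ 2 := by omega
      interval_cases p <;> omega
    have := Nat.mul_le_mul h₄ h₃
    simp only [Comp.work]
    omega
  | case2 sp c sc a b p q k h₁ h₂ h₃ ih₁ ih₂ =>
    have h₆ : p * q * (k / 2) + p * q * (k - k / 2) = p * q * k := by rw [← mul_add]; congr 1; omega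
    simp only [Comp.work]
    omega
  | case3 sp c sc a b p q k h₁ h₂ h₃ ih₁ ih₂ =>
    have h₇ : p / 2 * q * k + (p - p / 2) * q * k = p * q * k := by
      rw [← add_mul, ← add_mul]; congr 2; omega
    simp only [Comp.work]
    omega
  | case4 sp c sc a b p q k h₁ h₂ h₃ ih₁ ih₂ =>
    have h₇ : p * (q / 2) * k + p * (q - q / 2) * k = p * q * k := by
      rw [← add_mul, ← mul_add]; congr 2; omega
    simp only [Comp.work]
    omega
  | case5 sp c sc a b p q k h₁ ih₁ ih₂ =>
    have h₆ : p * q * (k / 2) + p * q * (k - k / 2) = p * q * k := by rw [← mul_add]; congr 1; omega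
    simp only [Comp.work]
    omega

/-- A single cell accumulates its `k` products one after the other. This sequential part is the
source of the term `r` in every span bound. -/
theorem span_mmC_cell_le {o : Kernel σ} {r sa sb sp c sc a b p q k : ℕ} (hp : 1 ≤ p)
    (hq : 1 ≤ q) (hk : 1 ≤ k) (hpq : p + q ≤ 2) (hkr : k ≤ r * (p + q) + 1) :
    (mmC o r sa sb sp c sc a b p q k).span + 4 ≤ 11 * k := by
  fun_induction mmC o r sa sb sp c sc a b p q k with
  | case1 sp c sc a b p q k h₁ h₂ h₃ =>
    simp only [Comp.span]
    omega
  | case2 sp c sc a b p q k h₁ h₂ h₃ ih₁ ih₂ =>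
    have h₄ := ih₁ hp hq (by omega) hpq (by omega)
    have h₅ := ih₂ hp hq (by omega) hpq (by omega)
    simp only [Comp.span]
    omega
  | case3 sp c sc a b p q k h₁ h₂ h₃ ih₁ ih₂ => omega
  | case4 sp c sc a b p q k h₁ h₂ h₃ ih₁ ih₂ => omega
  | case5 sp c sc a b p q k h₁ ih₁ ih₂ => omega

/-- Every split above the cells is a fork and lowers `L` by one. A level costs at most two parallel
loops, which is linear in `L`, so the levels sum to a quadratic. A cell has `k ≤ 2 r + 1`, hence `11
(2 r + 1) = 22 r + 11`. -/
theorem span_mmC_le {o : Kernel σ} {r sa sb sp c sc a b p q k L : ℕ} (hp : 1 ≤ p)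
    (hq : 1 ≤ q) (hk : 1 ≤ k) (hL : Nat.clog 2 p + Nat.clog 2 q + Nat.clog 2 k ≤ L) :
    (mmC o r sa sb sp c sc a b p q k).span ≤ 22 * r + 11 + 4 * L ^ 2 + 14 * L := by
  by_cases hcell : p + q ≤ 2 ∧ k ≤ r * (p + q) + 1
  · have h₁ := span_mmC_cell_le (o := o) (sa := sa) (sb := sb) (sp := sp) (c := c) (sc := sc) (a := a)
      (b := b) hp hq hk hcell.1 hcell.2
    have h₂ : r * (p + q) ≤ r * 2 := Nat.mul_le_mul_left _ hcell.1
    have := Nat.zero_le (L ^ 2)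
    omega
  rw [mmC]
  split_ifs with h₁ h₂ h₃ h₄
  · omega
  · omega
  · have e₁ := clog_half (m := p) (h := p / 2) (by omega) (by omega)
    have e₂ := clog_half (m := p) (h := p - p / 2) (by omega) (by omega)
    obtain ⟨L, rfl⟩ : ∃ L', L = L' + 1 := ⟨L - 1, by omega⟩
    have i₁ := span_mmC_le (o := o) (r := r) (sa := sa) (sb := sb) (sp := sp) (c := c) (sc := sc) (a := a)
      (b := b) (p := p / 2) (q := q) (k := k) (L := L) (by omega) hq hk (by omega)
    have i₂ := span_mmC_le (o := o) (r := r) (sa := sa) (sb := sb) (sp := sp) (c := c + p / 2 * sc)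
      (sc := sc) (a := a + p / 2 * sa) (b := b) (p := p - p / 2) (q := q) (k := k) (L := L)
      (by omega) hq hk (by omega)
    have e₃ : (L + 1) ^ 2 = L ^ 2 + 2 * L + 1 := by ring
    simp only [Comp.span]
    omega
  · have e₁ := clog_half (m := q) (h := q / 2) (by omega) (by omega)
    have e₂ := clog_half (m := q) (h := q - q / 2) (by omega) (by omega)
    obtain ⟨L, rfl⟩ : ∃ L', L = L' + 1 := ⟨L - 1, by omega⟩
    have i₁ := span_mmC_le (o := o) (r := r) (sa := sa) (sb := sb) (sp := sp) (c := c) (sc := sc) (a := a)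
      (b := b) (p := p) (q := q / 2) (k := k) (L := L) hp (by omega) hk (by omega)
    have i₂ := span_mmC_le (o := o) (r := r) (sa := sa) (sb := sb) (sp := sp) (c := c + q / 2)
      (sc := sc) (a := a) (b := b + q / 2 * sb) (p := p) (q := q - q / 2) (k := k) (L := L)
      hp (by omega) hk (by omega)
    have e₃ : (L + 1) ^ 2 = L ^ 2 + 2 * L + 1 := by ring
    simp only [Comp.span]
    omega
  · have e₁ := clog_half (m := k) (h := k / 2) (by omega) (by omega)
    have e₂ := clog_half (m := k) (h := k - k / 2) (by omega) (by omega)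
    obtain ⟨L, rfl⟩ : ∃ L', L = L' + 1 := ⟨L - 1, by omega⟩
    have i₁ := span_mmC_le (o := o) (r := r) (sa := sa) (sb := sb) (sp := sp + p * q) (c := sp) (sc := q)
      (a := a) (b := b) (p := p) (q := q) (k := k / 2) (L := L) hp hq (by omega) (by omega)
    have i₂ := span_mmC_le (o := o) (r := r) (sa := sa) (sb := sb) (sp := sp + p * q) (c := c)
      (sc := sc) (a := a + k / 2) (b := b + k / 2) (p := p) (q := q) (k := k - k / 2) (L := L)
      hp hq (by omega) (by omega)
    have i₃ := span_mapC_le o.zero (ds := q) (ar := q) (ac := 1) (d := sp) (a := sp) hp hq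
    have i₄ := span_mapC_le o.add (ds := sc) (ar := q) (ac := 1) (d := c) (a := sp) hp hq
    have e₃ : (L + 1) ^ 2 = L ^ 2 + 2 * L + 1 := by ring
    simp only [Comp.span]
    omega
termination_by p + q + k

/-! ### Cache complexity of the multiplication. -/

theorem cast_half (n : ℕ) : ((n / 2 : ℕ) : ℝ) + ((n - n / 2 : ℕ) : ℝ) = n := by
  rw [← Nat.cast_add]
  congr 1
  omega

/-- Expanding `(3q - p)(3p - q) ≥ 0` gives `3p² + 3q² ≤ 10pq`. This turns perimeters of balanced
blocks into areas. -/
theorem sq_add_le_of_le_three_mul {p q : ℝ} (hpq : p ≤ 3 * q) (hqp : q ≤ 3 * p) :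
    (p + q) ^ 2 * 3 ≤ 16 * (p * q) := by
  nlinarith [mul_nonneg (sub_nonneg.2 hpq) (sub_nonneg.2 hqp)]

/-- A block whose operands fit into the part of the cache that is not resident. -/
theorem streams_mmC_small {θ : ℝ} {M B t : ℕ} (hT : Tall θ M B t) {F : Finset ℕ} {o : Kernel σ}
    {r sa sb sp c sc a b p q k top : ℕ} (hr : 1 ≤ r) (h : MMArgs sp c sc a sa b sb p q k)
    (hF : ∀ x, Blk c sc p q x → x / B ∈ F)
    (htop : sp + (mmC o r sa sb sp c sc a b p q k).extent ≤ top)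
    (hF' : ∀ x, sp ≤ x → x < top → x / B ∈ F) (hcap : F.card * B + t ^ 2 + 2 * t * B ≤ M)
    (hpqt : p + q ≤ t) (hpq : p ≤ 3 * q) (hqp : q ≤ 3 * p) (hk : k ≤ 3 * (r * (p + q) + 1))
    (hlow : (t : ℝ) ^ 2 ≤ 3 * θ * ((p + q) * k)) (hsize : (p + q) * k ≤ t ^ 2) :
    Streams M B F (mmC o r sa sb sp c sc a b p q k).trace
      (154 * θ ^ 3 * (√r / (B * t)) * (p * q * k)) := by
  obtain ⟨hB, ht₂, hθ, hBt, hM⟩ := hT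
  have hB' : (1 : ℝ) ≤ B := by exact_mod_cast hB
  have ht' : (2 : ℝ) ≤ t := by exact_mod_cast ht₂
  have hp' : (1 : ℝ) ≤ p := by exact_mod_cast h.hp
  have hq' : (1 : ℝ) ≤ q := by exact_mod_cast h.hq
  have hk' : (1 : ℝ) ≤ k := by exact_mod_cast h.hk
  have hr' : (1 : ℝ) ≤ r := by exact_mod_cast hr
  have hpqt' : (p + q : ℝ) ≤ t := by exact_mod_cast hpqt
  have hpq' : (p : ℝ) ≤ 3 * q := by exact_mod_cast hpq
  have hqp' : (q : ℝ) ≤ 3 * p := by exact_mod_cast hqp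
  have hkr : (k : ℝ) ≤ 3 * (r * (p + q) + 1) := by exact_mod_cast hk
  have hsize' : (p + q : ℝ) * k ≤ t ^ 2 := by exact_mod_cast hsize
  have hcap' : (F.card : ℝ) * B + t ^ 2 + 2 * t * B ≤ M := by exact_mod_cast hcap
  set A := blkLines B a sa p k ∪ blkLines B b sb q k
  have hA : (A.card : ℝ) ≤ (p + q) * (k / B + 2) := by
    have h₁ : (A.card : ℝ) ≤ (blkLines B a sa p k).card + (blkLines B b sb q k).card := by
      exact_mod_cast Finset.card_union_le _ _
    have h₂ := card_blkLines_le hB a sa p k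
    have h₃ := card_blkLines_le hB b sb q k
    linarith
  have hAB : (A.card : ℝ) * B ≤ t ^ 2 + 2 * t * B := by
    calc (A.card : ℝ) * B ≤ (p + q) * (k / B + 2) * B := by gcongr
      _ = (p + q) * k + 2 * (p + q) * B := by field_simp
      _ ≤ t ^ 2 + 2 * t * B := by gcongr
  have hFA : (F ∪ A).card * B ≤ M := by
    have h₁ : ((F ∪ A).card : ℝ) ≤ F.card + A.card := by exact_mod_cast Finset.card_union_le _ _
    have : ((F ∪ A).card : ℝ) * B ≤ M := by
      calc ((F ∪ A).card : ℝ) * B ≤ (F.card + A.card) * B := by gcongr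
        _ = F.card * B + A.card * B := by ring
        _ ≤ M := by linarith
    exact_mod_cast this
  refine (streams_of_lines (F := F) (A := A) (fun e he => ?_) hFA).mono (hA.trans ?_)
  · have e₁ := touches_mmC h e he
    have e₂ := (inScope_mmC h).touches e he
    have stack : ∀ x, sp ≤ x → x < sp + (mmC o r sa sb sp c sc a b p q k).extent → x / B ∈ F :=
      fun x h₁ h₂ => hF' x h₁ (h₂.trans_le htop)
    have src : ∀ x, (Blk c sc p q x ∨ Blk a sa p k x ∨ Blk b sb q k x ∨ sp ≤ x) →
        x < sp + (mmC o r sa sb sp c sc a b p q k).extent → x / B ∈ F ∪ A := by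
      rintro x (hx | hx | hx | hx) hx'
      · exact Finset.mem_union_left _ (hF x hx)
      · exact Finset.mem_union_right _ (Finset.mem_union_left _ (mem_blkLines hx))
      · exact Finset.mem_union_right _ (Finset.mem_union_right _ (mem_blkLines hx))
      · exact Finset.mem_union_left _ (stack x hx hx')
    exact ⟨e₁.1.elim (hF _) fun hx => stack _ hx e₂.1, src _ e₁.2.1 e₂.2.1, src _ e₁.2.2 e₂.2.2⟩
  -- It remains to charge the lines of the operands to the volume `p q k`. Three facts are needed:
  -- the rows of the copies, of length `k`, are long compared with `t` and hence with `B`, and `p +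
  -- q` is at least of order `t/√r`.
  · have h₁ : (t : ℝ) ≤ 3 * θ * k := by
      have : (t : ℝ) * t ≤ 3 * θ * k * t := by
        calc (t : ℝ) * t = t ^ 2 := by ring
          _ ≤ 3 * θ * ((p + q) * k) := hlow
          _ ≤ 3 * θ * (t * k) := by gcongr
          _ = _ := by ring
      exact le_of_mul_le_mul_right this (by linarith)
    have h₂ : 2 * (B : ℝ) ≤ 6 * θ ^ 2 * k := by
      calc 2 * (B : ℝ) ≤ 2 * (θ * t) := by gcongr
        _ ≤ 2 * (θ * (3 * θ * k)) := by gcongr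
        _ = _ := by ring
    -- From `t² ≲ (p + q) k` and `k ≲ r (p + q)`. This is where the factor `√r` enters the reads.
    have h₃ : (t : ℝ) ≤ 4 * θ * √r * (p + q) := by
      refine le_of_sq_le_sq ?_ (by positivity)
      rw [mul_pow, mul_pow, mul_pow, Real.sq_sqrt (by positivity)]
      have e₁ : (k : ℝ) ≤ 5 * (r * (p + q)) := by nlinarith
      calc (t : ℝ) ^ 2 ≤ 3 * θ * ((p + q) * k) := hlow
        _ ≤ 3 * θ * ((p + q) * (5 * (r * (p + q)))) := by gcongr
        _ = 15 * θ * (r * (p + q) ^ 2) := by ring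
        _ ≤ 16 * θ ^ 2 * (r * (p + q) ^ 2) := by
          have : 15 * θ ≤ 16 * θ ^ 2 := by nlinarith
          exact mul_le_mul_of_nonneg_right this (by positivity)
        _ = _ := by ring
    have h₄ : (p + q : ℝ) * t ≤ 22 * θ * √r * (p * q) := by
      have h₅ := sq_add_le_of_le_three_mul hpq' hqp'
      have h₆ : (0 : ℝ) ≤ p * q := by positivity
      have h₇ : (p + q : ℝ) ^ 2 ≤ 22 / 4 * (p * q) := by linarith
      calc (p + q : ℝ) * t ≤ (p + q) * (4 * θ * √r * (p + q)) := by gcongr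
        _ = 4 * θ * √r * (p + q) ^ 2 := by ring
        _ ≤ 4 * θ * √r * (22 / 4 * (p * q)) := by gcongr
        _ = _ := by ring
    have h₅ : (k : ℝ) / B + 2 ≤ 7 * θ ^ 2 * k / B := by
      rw [div_add' _ _ _ (by positivity), div_le_div_iff_of_pos_right (by positivity)]
      have : (k : ℝ) ≤ θ ^ 2 * k := by nlinarith
      linarith
    have h₆ : (0 : ℝ) < B * t := by positivity
    calc (p + q : ℝ) * (k / B + 2) ≤ (p + q) * (7 * θ ^ 2 * k / B) := by gcongr
      _ = (p + q) * t * (7 * θ ^ 2 * k) / (B * t) := by field_simp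
      _ ≤ 22 * θ * √r * (p * q) * (7 * θ ^ 2 * k) / (B * t) := by gcongr
      _ = _ := by ring

/-- The resident set `F` holds the block of `C` and the stack up to `top`, so only the operands
cause reads. The recursion stops at the first brick with `(p + q) k ≤ t²`, whose operands fit beside
`F`. Reads per unit of volume are bounded there, and volumes add up. -/
theorem streams_mmC {θ : ℝ} {M B t : ℕ} (hT : Tall θ M B t) {F : Finset ℕ} {o : Kernel σ}
    {r sa sb sp c sc a b p q k top : ℕ} (hr : 1 ≤ r) (h : MMArgs sp c sc a sa b sb p q k)
    (hF : ∀ x, Blk c sc p q x → x / B ∈ F)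
    (htop : sp + (mmC o r sa sb sp c sc a b p q k).extent ≤ top)
    (hF' : ∀ x, sp ≤ x → x < top → x / B ∈ F) (hcap : F.card * B + t ^ 2 + 2 * t * B ≤ M)
    (hpqt : p + q ≤ t) (hpq : p ≤ 3 * q) (hqp : q ≤ 3 * p) (hk : k ≤ 3 * (r * (p + q) + 1))
    (hlow : (t : ℝ) ^ 2 ≤ 3 * θ * ((p + q) * k)) :
    Streams M B F (mmC o r sa sb sp c sc a b p q k).trace
      (154 * θ ^ 3 * (√r / (B * t)) * (p * q * k)) := by
  by_cases hsize : (p + q) * k ≤ t ^ 2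
  · exact streams_mmC_small hT hr h hF htop hF' hcap hpqt hpq hqp hk hlow hsize
  have hθ := hT.two_le_θ
  have ht₂ := hT.two_le_t
  -- One split shrinks `(p + q) k` by a factor of at most `3`, so a brick that is still too large
  -- has children that are not too small.
  have low : ∀ p' q' k' : ℕ, (p + q) * k ≤ 3 * ((p' + q') * k') →
      (t : ℝ) ^ 2 ≤ 3 * θ * ((p' + q') * k') := fun p' q' k' hh => by
    have h₁ : (t : ℝ) ^ 2 ≤ 3 * ((p' + q') * k') := by
      exact_mod_cast (not_le.1 hsize).le.trans hh
    have h₂ : (0 : ℝ) ≤ (p' + q') * k' := by positivity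
    nlinarith
  rw [mmC] at htop ⊢
  split_ifs at htop ⊢ with h₁ h₂ h₃ h₄
  -- A cell with `k ≤ 1` has `(p + q) k ≤ 2 < t²` and would have fitted.
  · exfalso
    have : (p + q) * k ≤ 2 * 1 := Nat.mul_le_mul h₂ h₃
    have : 2 ^ 2 ≤ t ^ 2 := Nat.pow_le_pow_left ht₂ 2
    omega
  · simp only [Comp.extent, Nat.zero_max] at htop
    have e₁ : (p + q) * k ≤ 3 * ((p + q) * (k / 2)) := by
      rw [mul_left_comm]; exact Nat.mul_le_mul_left _ (by omega)
    have e₂ : (p + q) * k ≤ 3 * ((p + q) * (k - k / 2)) := by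
      rw [mul_left_comm]; exact Nat.mul_le_mul_left _ (by omega)
    have i₁ := streams_mmC hT (F := F) (o := o) (top := top) hr (h.kLeft (by omega)) hF (by omega) hF' hcap
      hpqt hpq hqp (by omega) (low _ _ _ e₁)
    have i₂ := streams_mmC hT (F := F) (o := o) (top := top) hr (h.kRight (by omega)) hF (by omega) hF' hcap
      hpqt hpq hqp (by omega) (low _ _ _ e₂)
    refine (i₁.append i₂).mono (le_of_eq ?_)
    rw [← mul_add, ← mul_add, cast_half]
  · simp only [Comp.extent, Nat.zero_max] at htop
    have e₀ : p + q ≤ 3 * (p / 2 + q) := by omega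
    have e₀' : p + q ≤ 3 * (p - p / 2 + q) := by omega
    have e₁ : (p + q) * k ≤ 3 * ((p / 2 + q) * k) := by
      rw [← mul_assoc]; exact Nat.mul_le_mul_right _ e₀
    have e₂ : (p + q) * k ≤ 3 * ((p - p / 2 + q) * k) := by
      rw [← mul_assoc]; exact Nat.mul_le_mul_right _ e₀'
    have r₁ := Nat.mul_le_mul_left r e₀
    have r₂ := Nat.mul_le_mul_left r e₀'
    rw [mul_left_comm] at r₁ r₂
    have i₁ := streams_mmC hT (F := F) (o := o) (top := top) hr (h.pTop (by omega))
      (fun x hx => hF x (hx.top (by omega))) (by omega) hF' hcap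
      (by omega) (by omega) (by omega) (by omega) (low _ _ _ e₁)
    have i₂ := streams_mmC hT (F := F) (o := o) (top := top) hr (h.pBottom (by omega))
      (fun x hx => hF x (hx.bottom (by omega))) (by omega) hF' hcap
      (by omega) (by omega) (by omega) (by omega) (low _ _ _ e₂)
    refine (i₁.append i₂).mono (le_of_eq ?_)
    rw [← mul_add, ← add_mul, ← add_mul, cast_half]
  · simp only [Comp.extent, Nat.zero_max] at htop
    have e₀ : p + q ≤ 3 * (p + q / 2) := by omega
    have e₀' : p + q ≤ 3 * (p + (q - q / 2)) := by omega
    have e₁ : (p + q) * k ≤ 3 * ((p + q / 2) * k) := by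
      rw [← mul_assoc]; exact Nat.mul_le_mul_right _ e₀
    have e₂ : (p + q) * k ≤ 3 * ((p + (q - q / 2)) * k) := by
      rw [← mul_assoc]; exact Nat.mul_le_mul_right _ e₀'
    have r₁ := Nat.mul_le_mul_left r e₀
    have r₂ := Nat.mul_le_mul_left r e₀'
    rw [mul_left_comm] at r₁ r₂
    have i₁ := streams_mmC hT (F := F) (o := o) (top := top) hr (h.qLeft (by omega))
      (fun x hx => hF x (hx.left (by omega))) (by omega) hF' hcap
      (by omega) (by omega) (by omega) (by omega) (low _ _ _ e₁)
    have i₂ := streams_mmC hT (F := F) (o := o) (top := top) hr (h.qRight (by omega))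
      (fun x hx => hF x (hx.right (by omega))) (by omega) hF' hcap
      (by omega) (by omega) (by omega) (by omega) (low _ _ _ e₂)
    refine (i₁.append i₂).mono (le_of_eq ?_)
    rw [← mul_add, ← add_mul, ← mul_add, cast_half]
  · simp only [Comp.extent, Nat.zero_max, extent_mapC, Nat.max_zero] at htop
    have e₁ : (p + q) * k ≤ 3 * ((p + q) * (k / 2)) := by
      rw [mul_left_comm]; exact Nat.mul_le_mul_left _ (by omega)
    have e₂ : (p + q) * k ≤ 3 * ((p + q) * (k - k / 2)) := by
      rw [mul_left_comm]; exact Nat.mul_le_mul_left _ (by omega)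
    have hT' : ∀ x, Blk sp q p q x → x / B ∈ F := fun x hx =>
      hF' x hx.compact.1 (hx.compact.2.trans_le (by omega))
    have hFM : (F ∪ ∅).card * B ≤ M := by
      rw [Finset.union_empty]
      omega
    have i₁ := streams_mmC hT (F := F) (o := o) (top := top) hr (h.temp.kLeft (by omega)) hT' (by omega)
      (fun x hx => hF' x (by omega)) hcap hpqt hpq hqp (by omega) (low _ _ _ e₁)
    have i₂ := streams_mmC hT (F := F) (o := o) (top := top) hr
      ((h.kRight (by omega)).push (show sp ≤ sp + p * q by omega)) hF (by omega)
      (fun x hx => hF' x (by omega)) hcap hpqt hpq hqp (by omega) (low _ _ _ e₂)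
    -- The temporary and `C` are both resident, so zeroing and adding cost no transfer here.
    have i₃ : Streams M B F (mapC o.zero q q 1 sp sp p q).trace 0 := by
      refine (streams_of_lines (A := ∅) (fun e he => ?_) hFM).mono (by simp)
      obtain ⟨i, hi, j, hj, rfl⟩ := mem_trace_mapC h.hp h.hq he
      have := hT' _ (Blk.intro hi hj)
      simpa using this
    have i₄ : Streams M B F (mapC o.add sc q 1 c sp p q).trace 0 := by
      refine (streams_of_lines (A := ∅) (fun e he => ?_) hFM).mono (by simp)
      obtain ⟨i, hi, j, hj, rfl⟩ := mem_trace_mapC h.hp h.hq he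
      have := hT' _ (Blk.intro hi hj)
      have := hF _ (Blk.intro hi hj)
      simp_all
    refine (((i₃.append i₁).append i₂).append i₄).mono (le_of_eq ?_)
    rw [zero_add, add_zero, ← mul_add, ← mul_add, cast_half]
termination_by p + q + k

/-- A block of `C` that stays in the cache. -/
theorem serves_mmC_small {θ : ℝ} {M B t : ℕ} (hT : Tall θ M B t) {o : Kernel σ}
    {r sa sb sp c sc a b p q k : ℕ} (hr : 1 ≤ r) (h : MMArgs sp c sc a sa b sb p q k)
    (hpq : p ≤ 3 * q) (hqp : q ≤ 3 * p) (hk : k ≤ 3 * (r * (p + q) + 1))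
    (ht : t ≤ 3 * (p + q)) (hrt : (r * t : ℝ) ≤ θ * k)
    (hsize : p + q ≤ t) :
    Serves M B (mmC o r sa sb sp c sc a b p q k).trace
      ((564 * θ ^ 2 * (1 / (B * r * t)) + 154 * θ ^ 3 * (√r / (B * t))) * (p * q * k)
        - 132 * θ * (p * q / B))
      (564 * θ ^ 2 * (1 / (B * r * t)) * (p * q * k) - 132 * θ * (p * q / B)) := by
  have hB' : (1 : ℝ) ≤ B := by exact_mod_cast hT.one_le_B
  have ht' : (2 : ℝ) ≤ t := by exact_mod_cast hT.two_le_t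
  have hr' : (1 : ℝ) ≤ r := by exact_mod_cast hr
  have hθ := hT.two_le_θ
  have hBt := hT.B_le
  have htpq : (t : ℝ) ≤ 3 * (p + q) := by exact_mod_cast ht
  have hp' : (1 : ℝ) ≤ p := by exact_mod_cast h.hp
  have hq' : (1 : ℝ) ≤ q := by exact_mod_cast h.hq
  have hpq' : (p : ℝ) ≤ 3 * q := by exact_mod_cast hpq
  have hqp' : (q : ℝ) ≤ 3 * p := by exact_mod_cast hqp
  have hpqt : (p + q : ℝ) ≤ t := by exact_mod_cast hsize
  have hM : (20 * (t ^ 2 + t * B) : ℝ) ≤ M := by exact_mod_cast hT.fits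
  set E := (mmC o r sa sb sp c sc a b p q k).extent with hE
  -- The stack bound divided by `r`, with `k = O(r (p + q))` and `p + q ≤ t`, leaves `O(t²)`
  -- independently of `r`.
  have hEt : (E : ℝ) ≤ 10 * t ^ 2 := by
    have h₁ : (r * E + 2 * q : ℝ) ≤ r + 2 * (q * k) := by
      exact_mod_cast extent_mmC_le (o := o) (sa := sa) (sb := sb) (sp := sp) (c := c) (sc := sc) (a := a)
        (b := b) h.hp h.hq h.hk
    have h₂ : (k : ℝ) ≤ 3 * (r * (p + q) + 1) := by exact_mod_cast hk
    have h₃ : (q * k : ℝ) ≤ q * (3 * (r * (p + q) + 1)) := by gcongr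
    have h₄ : (q * (p + q) : ℝ) ≤ t * t := by
      gcongr
      linarith
    have h₅ : (r * E : ℝ) ≤ r * (1 + 6 * (q * (p + q)) + 6 * q) := by nlinarith
    have h₆ : (E : ℝ) ≤ 1 + 6 * (q * (p + q)) + 6 * q := le_of_mul_le_mul_left h₅ (by linarith)
    nlinarith
  set F := blkLines B c sc p q ∪ blkLines B sp 0 1 E
  have hF : (F.card : ℝ) * B ≤ 11 * t ^ 2 + 3 * t * B := by
    have h₁ : (F.card : ℝ) ≤ (blkLines B c sc p q).card + (blkLines B sp 0 1 E).card := by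
      exact_mod_cast Finset.card_union_le _ _
    have h₂ := card_blkLines_le hT.one_le_B c sc p q
    have h₃ := card_blkLines_le hT.one_le_B sp 0 1 E
    have h₄ : (p * q : ℝ) ≤ t ^ 2 := by nlinarith
    have h₅ : (p : ℝ) ≤ t := by linarith
    rw [Nat.cast_one, one_mul] at h₃
    calc (F.card : ℝ) * B ≤ (p * (q / B + 2) + (E / B + 2)) * B := by gcongr; linarith
      _ = p * q + 2 * p * B + E + 2 * B := by field_simp; ring
      _ ≤ t ^ 2 + 2 * t * B + 10 * t ^ 2 + t * B := by gcongr
      _ = _ := by ring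
  have hcap : F.card * B + t ^ 2 + 2 * t * B ≤ M := by
    have : (F.card : ℝ) * B + t ^ 2 + 2 * t * B ≤ M := by nlinarith
    exact_mod_cast this
  have hs := (streams_mmC hT (o := o) (top := sp + E) (F := F) hr h
    (fun x hx => Finset.mem_union_left _ (mem_blkLines hx)) le_rfl
    (fun x h₁ h₂ => Finset.mem_union_right _ (mem_lines_interval h₁ h₂)) hcap hsize hpq hqp hk (by
      have h₁ : (t : ℝ) ≤ θ * k := le_trans (by nlinarith) hrt
      calc (t : ℝ) ^ 2 = t * t := by ring
        _ ≤ 3 * (p + q) * (θ * k) := by gcongr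
        _ = _ := by ring)).serves (by
          have := Nat.zero_le (t ^ 2)
          have := Nat.zero_le (2 * t * B)
          omega)
  -- The resident lines number `O(t²/B)` while the volume is of order `r t³`, because `k ≳ r t`.
  -- Here `564 = 432 + 132`: the lines need `432`, and the rest offsets the subtracted reserve.
  have key : (F.card : ℝ) ≤ 564 * θ ^ 2 * (1 / (B * r * t)) * (p * q * k) - 132 * θ * (p * q / B) := by
    have h₁ : (p * q / B : ℝ) ≤ θ * (p * q * k / (B * r * t)) := by
      rw [← mul_div_assoc, div_le_div_iff₀ (by positivity) (by positivity)]
      calc (p * q * (B * r * t) : ℝ) = p * q * B * (r * t) := by ring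
        _ ≤ p * q * B * (θ * k) := by gcongr
        _ = _ := by ring
    have h₂ : (F.card : ℝ) ≤ 432 * θ ^ 2 * (p * q * k / (B * r * t)) := by
      have h₃ : (F.card : ℝ) * B ≤ 9 * θ * t ^ 2 := by
        refine hF.trans ?_
        have : (t : ℝ) * B ≤ t * (θ * t) := by gcongr
        nlinarith [sq_nonneg (t : ℝ)]
      have h₄ : (t : ℝ) ^ 2 * (r * t) ≤ 48 * θ * (p * q * k) := by
        have h₅ := sq_add_le_of_le_three_mul hpq' hqp'
        calc (t : ℝ) ^ 2 * (r * t) ≤ (3 * (p + q)) ^ 2 * (θ * k) := by gcongr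
          _ = 3 * ((p + q) ^ 2 * 3) * (θ * k) := by ring
          _ ≤ 3 * (16 * (p * q)) * (θ * k) := by gcongr
          _ = _ := by ring
      rw [← mul_div_assoc, le_div_iff₀ (by positivity)]
      calc (F.card : ℝ) * (B * r * t) = F.card * B * (r * t) := by ring
        _ ≤ 9 * θ * t ^ 2 * (r * t) := by gcongr
        _ = 9 * θ * (t ^ 2 * (r * t)) := by ring
        _ ≤ 9 * θ * (48 * θ * (p * q * k)) := by gcongr
        _ = _ := by ring
    calc (F.card : ℝ) ≤ 432 * θ ^ 2 * (p * q * k / (B * r * t)) := h₂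
      _ = 564 * θ ^ 2 * (1 / (B * r * t)) * (p * q * k)
          - 132 * θ * (θ * (p * q * k / (B * r * t))) := by ring
      _ ≤ _ := by gcongr
  refine hs.mono ?_ key
  rw [add_mul, add_sub_right_comm]
  gcongr

/-- Above the bricks the traces are served one after the other. The subtracted `132 θ p q / B` is a
reserve: a split of `k` has two children, hence two reserves, and one pays for the zeroing and the
adding, `66 θ p q / B` each. -/
theorem serves_mmC {θ : ℝ} {M B t : ℕ} (hT : Tall θ M B t) {o : Kernel σ}
    {r sa sb sp c sc a b p q k : ℕ} (hr : 1 ≤ r) (h : MMArgs sp c sc a sa b sb p q k)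
    (hpq : p ≤ 3 * q) (hqp : q ≤ 3 * p) (hk : k ≤ 3 * (r * (p + q) + 1))
    (ht : t ≤ 3 * (p + q)) (hrt : (r * t : ℝ) ≤ θ * k) :
    Serves M B (mmC o r sa sb sp c sc a b p q k).trace
      ((564 * θ ^ 2 * (1 / (B * r * t)) + 154 * θ ^ 3 * (√r / (B * t))) * (p * q * k)
        - 132 * θ * (p * q / B))
      (564 * θ ^ 2 * (1 / (B * r * t)) * (p * q * k) - 132 * θ * (p * q / B)) := by
  by_cases hsize : p + q ≤ t
  · exact serves_mmC_small hT hr h hpq hqp hk ht hrt hsize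
  · have hr' : (1 : ℝ) ≤ r := by exact_mod_cast hr
    have hθ := hT.two_le_θ
    have hθ0 : 0 < θ := by linarith
    -- After a split of `k` the hypothesis `r t ≤ θ k` survives because `p + q > t` and the failed
    -- test made `k` exceed `r (p + q)`.
    have hhalf : ∀ k' : ℕ, r * (p + q) ≤ 2 * k' → (r * t : ℝ) ≤ θ * k' := fun k' hh => by
      have h₁ : (r * (p + q) : ℝ) ≤ 2 * k' := by exact_mod_cast hh
      have h₂ : (t : ℝ) ≤ p + q := by exact_mod_cast (not_le.1 hsize).le
      calc (r * t : ℝ) ≤ r * (p + q) := by gcongr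
        _ ≤ 2 * k' := h₁
        _ ≤ θ * k' := by gcongr
    have ht₂ := hT.two_le_t
    rw [mmC]
    split_ifs with h₁ h₂ h₃ h₄
    · omega
    · omega
    · have r₁ := Nat.mul_le_mul_left r (show p + q ≤ 3 * (p / 2 + q) by omega)
      have r₂ := Nat.mul_le_mul_left r (show p + q ≤ 3 * (p - p / 2 + q) by omega)
      rw [mul_left_comm] at r₁ r₂
      have i₁ := serves_mmC hT (o := o) hr (h.pTop (by omega)) (by omega) (by omega)
        (by omega) (by omega) hrt
      have i₂ := serves_mmC hT (o := o) hr (h.pBottom (by omega)) (by omega) (by omega)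
        (by omega) (by omega) hrt
      refine (i₁.append i₂).mono (le_of_eq ?_) (le_of_eq ?_) <;>
      · rw [← cast_half p]
        ring
    · have r₁ := Nat.mul_le_mul_left r (show p + q ≤ 3 * (p + q / 2) by omega)
      have r₂ := Nat.mul_le_mul_left r (show p + q ≤ 3 * (p + (q - q / 2)) by omega)
      rw [mul_left_comm] at r₁ r₂
      have i₁ := serves_mmC hT (o := o) hr (h.qLeft (by omega)) (by omega) (by omega)
        (by omega) (by omega) hrt
      have i₂ := serves_mmC hT (o := o) hr (h.qRight (by omega)) (by omega) (by omega)
        (by omega) (by omega) hrt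
      refine (i₁.append i₂).mono (le_of_eq ?_) (le_of_eq ?_) <;>
      · rw [← cast_half q]
        ring
    · have i₁ := serves_mmC hT (o := o) hr (h.temp.kLeft (by omega)) hpq hqp (by omega) ht
        (hhalf _ (by omega))
      have i₂ := serves_mmC hT (o := o) hr ((h.kRight (by omega)).push (show sp ≤ sp + p * q by omega))
        hpq hqp (by omega) ht (hhalf _ (by omega))
      have i₃ := serves_mapC hT o.zero (ds := q) (ar := q) (ac := 1) (d := sp) (a := sp) h.hp h.hq
        hpq hqp ht (.inl rfl)
      have i₄ := serves_mapC hT o.add (ds := sc) (ar := q) (ac := 1) (d := c) (a := sp) h.hp h.hq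
        hpq hqp ht (.inl rfl)
      refine (((i₃.append i₁).append i₂).append i₄).mono (le_of_eq ?_) (le_of_eq ?_) <;>
      · rw [← cast_half k]
        ring
termination_by p + q + k

/-! ## Matrix multiplication with copied operands -/

/-- `C ← C + φ(A B)` for `C` of size `p × q` at `c`, `A` of size `p × k` at `a` and `B` of size
`k × q` at `b`, by multiplying copies of `A` and of the transpose of `B`.
The registers hold `c, sc, a, sa, b, br, bc, p, q, k, r`, where `sc, sa` are row strides and `br, bc`
are the two strides of `B`. -/
def gemmStmt : Stmt σ :=
  .alloc (reg 7 * reg 9)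
    (.seq (.call 3 [reg 0, reg 10, reg 3, reg 4, 1, reg 8, reg 10])
      (.alloc (reg 9 * reg 10)
        (.seq (.call 3 [reg 0, reg 11, reg 6, reg 8, reg 7, reg 10, reg 11])
          (.call 4 [reg 2, reg 3, reg 1, reg 11, reg 0, reg 11, reg 9, reg 10, reg 11, reg 12]))))

/-- The computation of `gemmStmt`. -/
def gemmC (o : Kernel σ) (sp c sc a sa b br bc p q k r : ℕ) : Comp σ :=
  .tick (.alloc (p * k) (.seq (mapC o.copy k sa 1 sp a p k)
    (.alloc (q * k) (.seq (mapC o.copy k bc br (sp + p * k) b q k)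
      (mmC o r k k (sp + p * k + q * k) c sc sp (sp + p * k) p q k)))))

/-- The program contains the loops and the two multiplication procedures. -/
structure HasGemm (P : Program σ) (o : Kernel σ) : Prop extends HasMM P o where
  copy : P[3]? = some (mapStmt 3 o.copy)
  gemm : P[5]? = some gemmStmt

theorem unfolds_gemmC {P : Program σ} {o : Kernel σ} (hP : HasGemm P o)
    {sp c sc a sa b br bc p q k r : ℕ} {ρ : List ℕ} {args : List IExpr}
    (hρ : args.map (IExpr.eval ρ) = [c, sc, a, sa, b, br, bc, p, q, k, r]) :
    Unfolds P sp ρ (.call 5 args) (gemmC o sp c sc a sa b br bc p q k r) :=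
  .call hP.gemm (hρ ▸ .alloc (.seq (unfolds_mapC hP.copy _ _ _ _ _ _ _ _ _ _ rfl)
    (.alloc (.seq (unfolds_mapC hP.copy _ _ _ _ _ _ _ _ _ _ rfl)
      (unfolds_mmC hP.toHasMM _ _ _ _ _ _ _ _ _ _ _ _ _ rfl)))))

/-- The cells of a `p × q` matrix with general strides. -/
def Grid (b br bc p q : ℕ) (x : ℕ) : Prop := ∃ i < p, ∃ j < q, x = b + i * br + j * bc

theorem Grid.of_rows {b br p q x : ℕ} (h : Grid b br 1 p q x) : Blk b br p q x := by
  obtain ⟨i, hi, j, hj, rfl⟩ := h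
  exact ⟨i, hi, j, hj, by rw [mul_one]⟩

theorem Grid.of_cols {b bc p q x : ℕ} (h : Grid b 1 bc p q x) : Blk b bc q p x := by
  obtain ⟨i, hi, j, hj, rfl⟩ := h
  exact ⟨j, hj, i, hi, by ring⟩

/-- The arguments of `gemmC` are in order. -/
structure GemmArgs (sp c sc a sa b br bc p q k : ℕ) : Prop where
  hp : 1 ≤ p
  hq : 1 ≤ q
  hk : 1 ≤ k
  hs : q ≤ sc
  hC : ∀ x, Blk c sc p q x → x < sp
  hA : ∀ x, Blk a sa p k x → x < sp
  hB : ∀ x, Grid b br bc k q x → x < sp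

/-- The copies lie above `sp` and `C` lies below it, so disjointness holds even if `C` overlaps the
original operands. -/
theorem GemmArgs.mmArgs {sp c sc a sa b br bc p q k : ℕ} (h : GemmArgs sp c sc a sa b br bc p q k) :
    MMArgs (sp + p * k + q * k) c sc sp k (sp + p * k) k p q k := by
  refine ⟨h.hp, h.hq, h.hk, h.hs, fun x hx => ?_, fun x hx => ?_, fun x hx => ?_, fun x hx hx' => ?_,
    fun x hx hx' => ?_⟩
  · have := h.hC x hx; omega
  · have := hx.compact; omega
  · have := hx.compact; omega
  · have := h.hC x hx; have := hx'.compact; omega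
  · have := h.hC x hx; have := hx'.compact; omega

theorem touches_gemmC {o : Kernel σ} {sp c sc a sa b br bc p q k r : ℕ}
    (h : GemmArgs sp c sc a sa b br bc p q k) :
    (gemmC o sp c sc a sa b br bc p q k r).Touches (fun x => Blk c sc p q x ∨ sp ≤ x)
      (fun x => Blk c sc p q x ∨ Blk a sa p k x ∨ Grid b br bc k q x ∨ sp ≤ x) := by
  refine .tick (.alloc (.seq ?_ (.alloc (.seq ?_ ?_))))
  · refine touches_mapC h.hp h.hk (fun i hi j hj => .inr (by omega)) (fun i hi j hj => ⟨?_, ?_⟩)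
    · exact .inr (.inr (.inr (by omega)))
    · rw [mul_one]
      exact .inr (.inl (.intro hi hj))
  · refine touches_mapC h.hq h.hk (fun i hi j hj => .inr (by omega)) (fun i hi j hj => ⟨?_, ?_⟩)
    · exact .inr (.inr (.inr (by omega)))
    · exact .inr (.inr (.inl ⟨j, hj, i, hi, by ring⟩))
  · refine (touches_mmC h.mmArgs).mono (fun x => .imp id (by omega)) (fun x hx => .imp id (fun hx => ?_) hx)
    rcases hx with hx | hx | hx
    · exact .inr (.inr hx.compact.1)
    · have := hx.compact.1
      exact .inr (.inr (by omega))
    · exact .inr (.inr (by omega))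

theorem inScope_gemmC {o : Kernel σ} {sp c sc a sa b br bc p q k r : ℕ}
    (h : GemmArgs sp c sc a sa b br bc p q k) : (gemmC o sp c sc a sa b br bc p q k r).InScope sp := by
  refine ⟨trivial, inScope_mapC h.hp h.hk fun i hi j hj => ?_,
    inScope_mapC h.hq h.hk fun i hi j hj => ?_, inScope_mmC h.mmArgs⟩
  · have := (Blk.intro (b := sp) (s := k) hi hj).compact
    have := h.hA _ (.intro hi hj)
    omega
  · have := (Blk.intro (b := sp + p * k) (s := k) hi hj).compact
    have := h.hB (b + i * bc + j * br) ⟨j, hj, i, hi, by ring⟩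
    omega

theorem raceFree_gemmC {o : Kernel σ} {sp c sc a sa b br bc p q k r : ℕ}
    (h : GemmArgs sp c sc a sa b br bc p q k) :
    (gemmC o sp c sc a sa b br bc p q k r).RaceFree sp := by
  refine ⟨trivial, raceFree_mapC h.hp h.hk le_rfl fun i hi j hj i' hi' j' hj' hh => ?_,
    raceFree_mapC h.hq h.hk le_rfl fun i hi j hj i' hi' j' hj' hh => ?_, raceFree_mmC h.mmArgs⟩
  · have := h.hA _ (.intro hi' hj')
    omega
  · have := h.hB (b + i' * bc + j' * br) ⟨j', hj', i', hi', by ring⟩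
    omega

/-- The sum is over the original memory: the operands are copied before the first write to `C`.
In-place updates such as `A₀₁ ← A₀₁ + A₀₀ A₀₁` are therefore correct. -/
theorem run_gemmC {R : Type u} [Semiring R] {I : σ → R → R → R} {φ : R →+ R} {o : Kernel σ}
    (ho : o.Lawful I φ) (junk : ℕ → R) {sp c sc a sa b br bc p q k r : ℕ}
    (h : GemmArgs sp c sc a sa b br bc p q k) (m : ℕ → R) {i j : ℕ} (hi : i < p) (hj : j < q) :
    (gemmC o sp c sc a sa b br bc p q k r).run I junk sp m (c + i * sc + j) =
      m (c + i * sc + j) +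
        φ (∑ l ∈ Finset.range k, m (a + i * sa + l) * m (b + l * br + j * bc)) := by
  simp only [gemmC, Comp.run]
  set m₀ : ℕ → R := fun x => if sp ≤ x ∧ x < sp + p * k then junk x else m x with hm₀
  set m₁ := (mapC o.copy k sa 1 sp a p k).run I junk (sp + p * k) m₀ with hm₁
  set m₂ : ℕ → R := fun x =>
    if sp + p * k ≤ x ∧ x < sp + p * k + q * k then junk x else m₁ x with hm₂
  set m₃ := (mapC o.copy k bc br (sp + p * k) b q k).run I junk (sp + p * k + q * k) m₂ with hm₃
  have e₀ : ∀ x < sp, m₀ x = m x := fun x hx => by simp [hm₀, not_le.2 hx]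
  have e₁ : ∀ x < sp, m₁ x = m x := fun x hx => by
    rw [← e₀ x hx]
    exact (touches_mapC (W := fun y => sp ≤ y) (X := fun _ => True) h.hp h.hk
      (fun i hi j hj => by omega) (fun _ _ _ _ => ⟨trivial, trivial⟩)).run_eq
      (hx.trans_le (Nat.le_add_right _ _)) (by omega)
  have e₂ : ∀ x < sp + p * k, m₂ x = m₁ x := fun x hx => by simp [hm₂, not_le.2 hx]
  have e₃ : ∀ x < sp + p * k, m₃ x = m₁ x := fun x hx => by
    rw [← e₂ x hx]
    exact (touches_mapC (W := fun y => sp + p * k ≤ y) (X := fun _ => True) h.hq h.hk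
      (fun i hi j hj => by omega) (fun _ _ _ _ => ⟨trivial, trivial⟩)).run_eq
      (hx.trans_le (Nat.le_add_right _ _)) (by omega)
  have eA : ∀ l < k, m₃ (sp + i * k + l) = m (a + i * sa + l) := fun l hl => by
    rw [e₃ _ (Blk.intro (b := sp) (s := k) hi hl).compact.2, hm₁,
      run_mapC I junk (sp := sp + p * k) h.hp h.hk le_rfl (fun i hi j hj => ?_)
        (fun i hi j hj i' hi' j' hj' hh => ?_) m₀ i hi l hl, ho.copy, mul_one,
      e₀ _ (h.hA _ (.intro hi hl))]
    · have := (Blk.intro (b := sp) (s := k) hi hj).compact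
      have := h.hA _ (.intro hi hj)
      omega
    · have := h.hA _ (.intro hi' hj')
      omega
  have eB : ∀ l < k, m₃ (sp + p * k + j * k + l) = m (b + l * br + j * bc) := fun l hl => by
    have hh : b + j * bc + l * br < sp := h.hB _ ⟨l, hl, j, hj, by ring⟩
    rw [hm₃, run_mapC I junk (sp := sp + p * k + q * k) h.hq h.hk le_rfl (fun i hi j hj => ?_)
        (fun i hi j hj i' hi' j' hj' hh => ?_) m₂ j hj l hl, ho.copy,
      e₂ _ (by omega), e₁ _ hh]
    · congr 1; ring
    · have := (Blk.intro (b := sp + p * k) (s := k) hi hj).compact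
      have := h.hB (b + i * bc + j * br) ⟨j, hj, i, hi, by ring⟩
      omega
    · have := h.hB (b + i' * bc + j' * br) ⟨j', hj', i', hi', by ring⟩
      omega
  have hc := h.hC _ (.intro hi hj)
  rw [run_mmC ho junk h.mmArgs m₃ i hi j hj, e₃ _ (by omega), e₁ _ hc]
  congr 2
  refine Finset.sum_congr rfl fun l hl => ?_
  rw [eA l (Finset.mem_range.1 hl), eB l (Finset.mem_range.1 hl)]

theorem extent_gemmC_le {o : Kernel σ} {sp c sc a sa b br bc p q k r : ℕ} (hr : 1 ≤ r) (hp : 1 ≤ p)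
    (hq : 1 ≤ q) (hk : 1 ≤ k) :
    (gemmC o sp c sc a sa b br bc p q k r).extent ≤ p * k + 3 * (q * k) := by
  have h₁ := extent_mmC_le (o := o) (r := r) (sa := k) (sb := k) (sp := sp + p * k + q * k) (c := c)
    (sc := sc) (a := sp) (b := sp + p * k) hp hq hk
  have h₂ : (mmC o r k k (sp + p * k + q * k) c sc sp (sp + p * k) p q k).extent ≤ 2 * (q * k) := by
    by_contra hh
    have h₃ := Nat.mul_le_mul_left r (not_le.1 hh)
    have h₄ : 2 * (q * k) ≤ r * (2 * (q * k)) := Nat.le_mul_of_pos_left _ hr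
    rw [Nat.succ_eq_add_one, mul_add] at h₃
    omega
  simp only [gemmC, Comp.extent, extent_mapC]
  omega

theorem work_gemmC_le {o : Kernel σ} {sp c sc a sa b br bc p q k r : ℕ} (hp : 1 ≤ p)
    (hq : 1 ≤ q) (hk : 1 ≤ k) :
    (gemmC o sp c sc a sa b br bc p q k r).work ≤ 44 * (p * q * k) := by
  have h₁ := work_mmC_le (o := o) (r := r) (sa := k) (sb := k) (sp := sp + p * k + q * k) (c := c)
    (sc := sc) (a := sp) (b := sp + p * k) hp hq hk
  have h₂ := work_mapC_le o.copy (ds := k) (ar := sa) (ac := 1) (d := sp) (a := a) hp hk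
  have h₃ := work_mapC_le o.copy (ds := k) (ar := bc) (ac := br) (d := sp + p * k) (a := b) hq hk
  have h₄ : p * k ≤ p * q * k := by nlinarith [Nat.mul_le_mul_left (p * k) hq]
  have h₅ : q * k ≤ p * q * k := by nlinarith [Nat.mul_le_mul_left (q * k) hp]
  simp only [gemmC, Comp.work]
  omega

theorem le_work_gemmC {o : Kernel σ} {sp c sc a sa b br bc p q k r : ℕ} :
    p * q * k ≤ (gemmC o sp c sc a sa b br bc p q k r).work := by
  have := le_work_mmC (o := o) (r := r) (sa := k) (sb := k) (sp := sp + p * k + q * k) (c := c)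
    (sc := sc) (a := sp) (b := sp + p * k) (p := p) (q := q) (k := k)
  simp only [gemmC, Comp.work]
  omega

theorem span_gemmC_le {o : Kernel σ} {sp c sc a sa b br bc p q k r L : ℕ} (hp : 1 ≤ p)
    (hq : 1 ≤ q) (hk : 1 ≤ k) (hpL : Nat.clog 2 p ≤ L) (hqL : Nat.clog 2 q ≤ L)
    (hkL : Nat.clog 2 k ≤ L) :
    (gemmC o sp c sc a sa b br bc p q k r).span ≤ 22 * r + 36 * L ^ 2 + 58 * L + 20 := by
  have h₁ := span_mmC_le (o := o) (r := r) (sa := k) (sb := k) (sp := sp + p * k + q * k) (c := c)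
    (sc := sc) (a := sp) (b := sp + p * k) (L := 3 * L) hp hq hk (by omega)
  have h₂ := span_mapC_le o.copy (ds := k) (ar := sa) (ac := 1) (d := sp) (a := a) hp hk
  have h₃ := span_mapC_le o.copy (ds := k) (ar := bc) (ac := br) (d := sp + p * k) (a := b) hq hk
  have h₄ : (3 * L) ^ 2 = 9 * L ^ 2 := by ring
  simp only [gemmC, Comp.span]
  omega

/-- The transfers of a balanced multiplication are `O(√r p q k / (B t))` reads and
`O(p q k / (B r t))` writes. -/
theorem serves_gemmC {θ : ℝ} {M B t : ℕ} (hT : Tall θ M B t) {o : Kernel σ}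
    {sp c sc a sa b br bc p q k r : ℕ} (hr : 1 ≤ r) (h : GemmArgs sp c sc a sa b br bc p q k)
    (hpq : p ≤ 3 * q) (hqp : q ≤ 3 * p) (hpk : p ≤ 3 * k) (hkp : k ≤ 3 * p) (hqk : q ≤ 3 * k)
    (hkq : k ≤ 3 * q) (ht : t ≤ 3 * (p + q)) (htp : t ≤ 3 * (p + k)) (htq : t ≤ 3 * (q + k))
    (hrt : (r * t : ℝ) ≤ θ * k) (hb : br = 1 ∨ bc = 1) :
    Serves M B (gemmC o sp c sc a sa b br bc p q k r).trace
      (640 * θ ^ 3 * (√r / (B * t)) * (p * q * k)) (640 * θ ^ 3 * (1 / (B * r * t)) * (p * q * k)) := by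
  have hB' : (1 : ℝ) ≤ B := by exact_mod_cast hT.one_le_B
  have ht' : (2 : ℝ) ≤ t := by exact_mod_cast hT.two_le_t
  have hr' : (1 : ℝ) ≤ r := by exact_mod_cast hr
  have hθ := hT.two_le_θ
  have hkr : k ≤ 3 * (r * (p + q) + 1) := by
    have : 1 * (p + q) ≤ r * (p + q) := Nat.mul_le_mul_right _ hr
    omega
  have i₁ := serves_mmC hT (o := o) hr h.mmArgs hpq hqp hkr ht hrt
  have i₂ := serves_mapC hT o.copy (ds := k) (ar := sa) (ac := 1) (d := sp) (a := a) h.hp h.hk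
    hpk hkp htp (.inl rfl)
  have i₃ := serves_mapC hT o.copy (ds := k) (ar := bc) (ac := br) (d := sp + p * k) (a := b) h.hq h.hk
    hqk hkq htq hb
  -- Copying an operand is dominated by the writes of the product, since `r t ≤ θ k` and all sides
  -- are comparable.
  have e : ∀ x y : ℕ, k ≤ 3 * y → (x * k / B : ℝ) ≤ 3 * θ * (1 / (B * r * t) * (x * y * k)) :=
    fun x y hy => by
      have hy' : (k : ℝ) ≤ 3 * y := by exact_mod_cast hy
      rw [one_div_mul_eq_div, ← mul_div_assoc, div_le_div_iff₀ (by positivity) (by positivity)]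
      calc (x * k * (B * r * t) : ℝ) = x * k * B * (r * t) := by ring
        _ ≤ x * k * B * (θ * k) := by gcongr
        _ ≤ x * k * B * (θ * (3 * y)) := by gcongr
        _ = _ := by ring
  have e₁ := e p q hkq
  have e₂ := e q p hkp
  rw [mul_comm (q : ℝ) p] at e₂
  have e₃ : (0 : ℝ) ≤ 132 * θ * (p * q / B) := by positivity
  set V : ℝ := 1 / (B * r * t) * (p * q * k) with hV
  have hV0 : 0 ≤ V := by positivity
  have hVr : V ≤ √r / (B * t) * (p * q * k) := by
    refine mul_le_mul_of_nonneg_right ?_ (by positivity)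
    rw [div_le_div_iff₀ (by positivity) (by positivity)]
    have : 1 ≤ √(r : ℝ) := Real.one_le_sqrt.2 hr'
    have : 1 * 1 ≤ √(r : ℝ) * r := by gcongr
    calc (1 * (B * t) : ℝ) = (B * t) * (1 * 1) := by ring
      _ ≤ (B * t) * (√r * r) := by gcongr
      _ = _ := by ring
  have hW : 564 * θ ^ 2 * V + 396 * θ ^ 2 * V ≤ 480 * θ ^ 3 * V := by
    have : 960 * θ ^ 2 ≤ 480 * θ ^ 3 := by nlinarith [sq_nonneg θ]
    nlinarith
  have hc : 66 * θ * (p * k / B) + 66 * θ * (q * k / B) ≤ 396 * θ ^ 2 * V := by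
    calc 66 * θ * (p * k / B) + 66 * θ * (q * k / B) ≤ 66 * θ * (3 * θ * V) + 66 * θ * (3 * θ * V) := by
          gcongr
      _ = _ := by ring
  refine (i₂.append (i₃.append i₁)).mono ?_ ?_
  · have : 480 * θ ^ 3 * V ≤ 480 * θ ^ 3 * (√r / (B * t) * (p * q * k)) := by gcongr
    have : 0 ≤ θ ^ 3 * (√r / (B * t) * (p * q * k)) := by positivity
    linarith
  · have : 0 ≤ θ ^ 3 * V := by positivity
    linarith

/-! ## Updates between the quadrants of a square block -/

/-- The first index of a half of `0, …, m - 1`. -/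
def offset (m : ℕ) (x : Bool) : ℕ := bif x then m / 2 else 0

/-- The number of indices in a half of `0, …, m - 1`. -/
def halfLen (m : ℕ) (x : Bool) : ℕ := bif x then m - m / 2 else m / 2

def offsetE (m : IExpr) (x : Bool) : IExpr := bif x then m / 2 else 0

def halfLenE (m : IExpr) (x : Bool) : IExpr := bif x then m - m / 2 else m / 2

/-- `A[x,y] ← A[x,y] + φ(A[x,z] A[z,y])` for quadrants of the `m × m` block at `a` with row stride `s`,
where the registers hold `a, s, m, r`. -/
def quadStmt (x y z : Bool) : Stmt σ :=
  .call 5 [reg 0 + offsetE (reg 2) x * reg 1 + offsetE (reg 2) y, reg 1,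
    reg 0 + offsetE (reg 2) x * reg 1 + offsetE (reg 2) z, reg 1,
    reg 0 + offsetE (reg 2) z * reg 1 + offsetE (reg 2) y, reg 1, 1,
    halfLenE (reg 2) x, halfLenE (reg 2) y, halfLenE (reg 2) z, reg 3]

/-- The computation of `quadStmt`. -/
def quadC (o : Kernel σ) (sp a s m r : ℕ) (x y z : Bool) : Comp σ :=
  gemmC o sp (a + offset m x * s + offset m y) s (a + offset m x * s + offset m z) s
    (a + offset m z * s + offset m y) s 1 (halfLen m x) (halfLen m y) (halfLen m z) r

theorem unfolds_quadC {P : Program σ} {o : Kernel σ} (hP : HasGemm P o) (sp a s m r : ℕ)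
    (ρ : List ℕ) (x y z : Bool) :
    Unfolds P sp (a :: s :: m :: r :: ρ) (quadStmt x y z) (quadC o sp a s m r x y z) := by
  refine unfolds_gemmC hP ?_
  cases x <;> cases y <;> cases z <;> rfl

/-- The `m × m` block at `a` with row stride `s` is allocated. -/
structure SqArgs (sp a s m : ℕ) : Prop where
  hm : 1 ≤ m
  hs : m ≤ s
  hA : ∀ x, Blk a s m m x → x < sp

/-- The cells of a quadrant. -/
def Quad (a s m : ℕ) (x y : Bool) : ℕ → Prop :=
  Blk (a + offset m x * s + offset m y) s (halfLen m x) (halfLen m y)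

theorem offset_add_halfLen_le (m : ℕ) (x : Bool) : offset m x + halfLen m x ≤ m := by
  cases x <;> simp only [offset, halfLen, cond_true, cond_false] <;> omega

theorem halfLen_bounds {m : ℕ} (hm : 2 ≤ m) (x : Bool) :
    1 ≤ halfLen m x ∧ m ≤ 3 * halfLen m x ∧ 2 * halfLen m x ≤ m + 1 ∧ m ≤ 2 * halfLen m x + 1 := by
  cases x <;> simp only [halfLen, cond_true, cond_false] <;> omega

theorem Quad.blk {a s m x : ℕ} {y z : Bool} (h : Quad a s m y z x) : Blk a s m m x :=
  h.sub (offset_add_halfLen_le m y) (offset_add_halfLen_le m z)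

theorem Quad.disjoint {a s m x : ℕ} (hs : m ≤ s) {y z y' z' : Bool} (hne : (y, z) ≠ (y', z'))
    (h : Quad a s m y z x) : ¬ Quad a s m y' z' x := by
  refine Blk.disjoint hs ?_ (offset_add_halfLen_le m z) (offset_add_halfLen_le m z') h
  cases y <;> cases z <;> cases y' <;> cases z' <;>
    simp only [offset, halfLen, cond_true, cond_false, ne_eq, not_true_eq_false] at hne ⊢ <;> omega

theorem SqArgs.gemmArgs {sp a s m : ℕ} (h : SqArgs sp a s m) (hm : 2 ≤ m) (x y z : Bool) :
    GemmArgs sp (a + offset m x * s + offset m y) s (a + offset m x * s + offset m z) s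
      (a + offset m z * s + offset m y) s 1 (halfLen m x) (halfLen m y) (halfLen m z) := by
  have hx := halfLen_bounds hm x
  have hy := halfLen_bounds hm y
  have hz := halfLen_bounds hm z
  have hs := h.hs
  have := offset_add_halfLen_le m y
  exact ⟨by omega, by omega, by omega, by omega, fun w hw => h.hA w (Quad.blk hw),
    fun w hw => h.hA w (Quad.blk hw), fun w hw => h.hA w (Quad.blk (Grid.of_rows hw))⟩

theorem SqArgs.quad {sp a s m : ℕ} (h : SqArgs sp a s m) (hm : 2 ≤ m) (x : Bool) :
    SqArgs sp (a + offset m x * s + offset m x) s (halfLen m x) := by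
  have hx := halfLen_bounds hm x
  have := h.hs
  have := offset_add_halfLen_le m x
  exact ⟨by omega, by omega, fun w hw => h.hA w (Quad.blk hw)⟩

theorem touches_quadC {o : Kernel σ} {sp a s m r : ℕ} (h : SqArgs sp a s m) (hm : 2 ≤ m)
    (x y z : Bool) :
    (quadC o sp a s m r x y z).Touches (fun w => Quad a s m x y w ∨ sp ≤ w)
      (fun w => Blk a s m m w ∨ sp ≤ w) := by
  refine (touches_gemmC (h.gemmArgs hm x y z)).mono (fun _ => id) fun w => ?_
  rintro (hw | hw | hw | hw)
  exacts [.inl (Quad.blk hw), .inl (Quad.blk hw), .inl (Quad.blk (Grid.of_rows hw)), .inr hw]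

theorem touches_quadC' {o : Kernel σ} {sp a s m r : ℕ} (h : SqArgs sp a s m) (hm : 2 ≤ m)
    (x y z : Bool) :
    (quadC o sp a s m r x y z).Touches (fun w => Blk a s m m w ∨ sp ≤ w)
      (fun w => Blk a s m m w ∨ sp ≤ w) :=
  (touches_quadC h hm x y z).mono (fun _ => .imp Quad.blk id) (fun _ => id)

theorem inScope_quadC {o : Kernel σ} {sp a s m r : ℕ} (h : SqArgs sp a s m) (hm : 2 ≤ m)
    (x y z : Bool) : (quadC o sp a s m r x y z).InScope sp := inScope_gemmC (h.gemmArgs hm x y z)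

theorem raceFree_quadC {o : Kernel σ} {sp a s m r : ℕ} (h : SqArgs sp a s m) (hm : 2 ≤ m)
    (x y z : Bool) : (quadC o sp a s m r x y z).RaceFree sp := raceFree_gemmC (h.gemmArgs hm x y z)

theorem extent_quadC_le {o : Kernel σ} {sp a s m r : ℕ} (hr : 1 ≤ r) (hm : 2 ≤ m)
    (x y z : Bool) : (quadC o sp a s m r x y z).extent ≤ 4 * m ^ 2 := by
  have hx := halfLen_bounds hm x
  have hy := halfLen_bounds hm y
  have hz := halfLen_bounds hm z
  have h₁ : halfLen m x * halfLen m z ≤ m * m := Nat.mul_le_mul (by omega) (by omega)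
  have h₂ : halfLen m y * halfLen m z ≤ m * m := Nat.mul_le_mul (by omega) (by omega)
  refine (extent_gemmC_le hr hx.1 hy.1 hz.1).trans ?_
  rw [sq]
  omega

theorem work_quadC_le {o : Kernel σ} {sp a s m r : ℕ} (hm : 2 ≤ m) (x y z : Bool) :
    (quadC o sp a s m r x y z).work ≤ 44 * m ^ 3 := by
  have hx := halfLen_bounds hm x
  have hy := halfLen_bounds hm y
  have hz := halfLen_bounds hm z
  refine (work_gemmC_le hx.1 hy.1 hz.1).trans ?_
  rw [pow_succ, sq]
  gcongr <;> omega

theorem le_work_quadC {o : Kernel σ} {sp a s m r : ℕ} (hm : 2 ≤ m) (x y z : Bool) :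
    m ^ 3 ≤ 27 * (quadC o sp a s m r x y z).work := by
  have hx := halfLen_bounds hm x
  have hy := halfLen_bounds hm y
  have hz := halfLen_bounds hm z
  calc m ^ 3 = m * m * m := by ring
    _ ≤ (3 * halfLen m x) * (3 * halfLen m y) * (3 * halfLen m z) :=
      Nat.mul_le_mul (Nat.mul_le_mul hx.2.1 hy.2.1) hz.2.1
    _ = 27 * (halfLen m x * halfLen m y * halfLen m z) := by ring
    _ ≤ _ := Nat.mul_le_mul_left _ le_work_gemmC

theorem span_quadC_le {o : Kernel σ} {sp a s m r : ℕ} (hm : 2 ≤ m) (x y z : Bool) :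
    (quadC o sp a s m r x y z).span ≤
      22 * r + 36 * Nat.clog 2 m ^ 2 + 58 * Nat.clog 2 m + 20 := by
  have hx := halfLen_bounds hm x
  have hy := halfLen_bounds hm y
  have hz := halfLen_bounds hm z
  exact span_gemmC_le hx.1 hy.1 hz.1 (Nat.clog_mono_right _ (by omega))
    (Nat.clog_mono_right _ (by omega)) (Nat.clog_mono_right _ (by omega))

/-! ### Recurrences -/

/-- The aspect ratio for subproblems of half the size. -/
def nextRatio (r : ℕ) : ℕ := (2 * r + 4) / 5

def nextRatioE (r : IExpr) : IExpr := (2 * r + 4) / 5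

theorem one_le_nextRatio {r : ℕ} (hr : 1 ≤ r) : 1 ≤ nextRatio r := by
  unfold nextRatio
  omega

/-- A bound `O(√r m³ / (B t))` for the reads and `O(m³ / (B r t))` for the writes. -/
def Cheap (C : ℝ) (M B t r m : ℕ) (tr : List (ℕ × ℕ × ℕ)) : Prop :=
  Serves M B tr (C * (√r / (B * t) * m ^ 3)) (C * (1 / (B * r * t) * m ^ 3))

theorem Cheap.append {C C' : ℝ} {M B t r m : ℕ} {tr tr' : List (ℕ × ℕ × ℕ)}
    (h : Cheap C M B t r m tr) (h' : Cheap C' M B t r m tr') :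
    Cheap (C + C') M B t r m (tr ++ tr') := by
  unfold Cheap
  rw [add_mul, add_mul]
  exact Serves.append h h'

theorem Cheap.mono {C C' : ℝ} {M B t r m m' : ℕ} {tr : List (ℕ × ℕ × ℕ)} (h : Cheap C M B t r m tr)
    (hC' : 0 ≤ C') (hC : C ≤ C') (hm : m ≤ m') : Cheap C' M B t r m' tr := by
  refine Serves.mono h ?_ ?_ <;> gcongr

theorem Cheap.nil {M B t r m : ℕ} : Cheap 0 M B t r m [] := by
  simpa [Cheap] using Serves.nil

/-- The factor is `3` rather than `4` because of odd sizes; `m = 3` gives equality, `3 (1 + 8) =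
27`. -/
theorem cube_halves_le {m : ℕ} (hm : 2 ≤ m) :
    3 * (((m / 2 : ℕ) : ℝ) ^ 3 + ((m - m / 2 : ℕ) : ℝ) ^ 3) ≤ (m : ℝ) ^ 3 := by
  obtain ⟨h, hh⟩ : ∃ h, m = 2 * h ∨ m = 2 * h + 1 := ⟨m / 2, by omega⟩
  have h1 : 1 ≤ h := by omega
  have h1' : (1 : ℝ) ≤ h := by exact_mod_cast h1
  rcases hh with rfl | rfl
  · rw [show 2 * h / 2 = h by omega, show 2 * h - h = h by omega]
    push_cast
    nlinarith [pow_pos (show (0 : ℝ) < h by linarith) 3]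
  · rw [show (2 * h + 1) / 2 = h by omega, show 2 * h + 1 - h = h + 1 by omega]
    push_cast
    nlinarith [mul_nonneg (show (0 : ℝ) ≤ h - 1 by linarith) (sq_nonneg (h : ℝ)),
      mul_nonneg (show (0 : ℝ) ≤ h - 1 by linarith) (show (0 : ℝ) ≤ h by linarith)]

/-- For the reads it suffices that the ratio does not grow; the factor `1/3` from the cubes is
weakened to the `5/6` needed for the writes. -/
theorem reads_halves_le {C : ℝ} (hC : 0 ≤ C) {B t r m : ℕ} (hr : 1 ≤ r) (hm : 2 ≤ m) :
    C * (√(nextRatio r) / (B * t) * (m / 2 : ℕ) ^ 3) +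
      C * (√(nextRatio r) / (B * t) * (m - m / 2 : ℕ) ^ 3) ≤ 5 / 6 * C * (√r / (B * t) * m ^ 3) := by
  have h₁ : (nextRatio r : ℝ) ≤ r := by
    have : nextRatio r ≤ r := by unfold nextRatio; omega
    exact_mod_cast this
  have h₂ := cube_halves_le hm
  have h₃ : (0 : ℝ) ≤ (m : ℝ) ^ 3 := by positivity
  calc C * (√(nextRatio r) / (B * t) * (m / 2 : ℕ) ^ 3) +
        C * (√(nextRatio r) / (B * t) * (m - m / 2 : ℕ) ^ 3)
      = C * (√(nextRatio r) / (B * t)) *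
        (((m / 2 : ℕ) : ℝ) ^ 3 + ((m - m / 2 : ℕ) : ℝ) ^ 3) := by ring
    _ ≤ C * (√r / (B * t)) * (5 / 6 * m ^ 3) := by
      gcongr
      linarith
    _ = _ := by ring

/-- The writes per product grow by at most `5/2` when the ratio shrinks, and the volume falls to a
third: `5/2 · 1/3 = 5/6 < 1`. A shrinking factor of `1/3` or less could not be absorbed at odd
sizes. -/
theorem writes_halves_le {C : ℝ} (hC : 0 ≤ C) {B t r m : ℕ} (hr : 1 ≤ r) (hm : 2 ≤ m) :
    C * (1 / (B * nextRatio r * t) * (m / 2 : ℕ) ^ 3) +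
      C * (1 / (B * nextRatio r * t) * (m - m / 2 : ℕ) ^ 3) ≤
      5 / 6 * C * (1 / (B * r * t) * m ^ 3) := by
  have hr' : (1 : ℝ) ≤ r := by exact_mod_cast hr
  have h₁ : 2 * (r : ℝ) ≤ 5 * nextRatio r := by
    have : 2 * r ≤ 5 * nextRatio r := by unfold nextRatio; omega
    exact_mod_cast this
  have h₂ := cube_halves_le hm
  have h₃ : (1 : ℝ) / nextRatio r ≤ 5 / 2 * (1 / r) := by
    rw [div_mul_div_comm, div_le_div_iff₀ (by linarith) (by linarith)]
    linarith
  calc C * (1 / (B * nextRatio r * t) * (m / 2 : ℕ) ^ 3) +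
        C * (1 / (B * nextRatio r * t) * (m - m / 2 : ℕ) ^ 3)
      = C * (1 / nextRatio r) * (1 / (B * t)) *
        (((m / 2 : ℕ) : ℝ) ^ 3 + ((m - m / 2 : ℕ) : ℝ) ^ 3) := by
        field_simp
    _ ≤ C * (5 / 2 * (1 / r)) * (1 / (B * t)) * (m ^ 3 / 3) := by
      gcongr
      linarith
    _ = _ := by
      field_simp
      ring

/-- The recursive calls for the two halves and further costs of lower order. -/
theorem Cheap.of_halves {C C' : ℝ} (hC : 6 * C' ≤ C) (hC' : 0 ≤ C') {M B t r m : ℕ} (hr : 1 ≤ r)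
    (hm : 2 ≤ m) {tr₀ tr₁ tr₂ tr₃ : List (ℕ × ℕ × ℕ)}
    (h₀ : Cheap C M B t (nextRatio r) (m / 2) tr₀)
    (h₁ : ∃ C₁ C₂, C₁ + C₂ ≤ C' ∧ Cheap C₁ M B t r m tr₁ ∧ Cheap C₂ M B t r m tr₃)
    (h₂ : Cheap C M B t (nextRatio r) (m - m / 2) tr₂) :
    Cheap C M B t r m (tr₀ ++ (tr₁ ++ (tr₂ ++ tr₃))) := by
  obtain ⟨C₁, C₂, hC₁, h₁, h₃⟩ := h₁
  have hR := reads_halves_le (C := C) (by linarith) (B := B) (t := t) hr hm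
  have hW := writes_halves_le (C := C) (by linarith) (B := B) (t := t) hr hm
  refine (Serves.append h₀ (Serves.append h₁ (Serves.append h₂ h₃))).mono ?_ ?_
  · have : (C₁ + C₂) * (√r / (B * t) * m ^ 3) ≤ 1 / 6 * C * (√r / (B * t) * m ^ 3) := by
      gcongr
      linarith
    linarith
  · have : (C₁ + C₂) * (1 / (B * r * t) * m ^ 3 : ℝ) ≤ 1 / 6 * C * (1 / (B * r * t) * m ^ 3) := by
      gcongr
      linarith
    linarith

/-! ### Admissible sizes, and the costs at one level of recursion. -/

/-- The sizes for which the cost recurrences hold. -/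
structure Level (θ : ℝ) (t r m : ℕ) : Prop where
  hθ : 3 ≤ θ
  hr : 1 ≤ r
  hm : 1 ≤ m
  ht : (t : ℝ) ≤ θ * m
  hrt : (3 * r * t : ℝ) ≤ θ * (m + 1) + 4 * t

/-- The invariant keeps `θ` unchanged over all levels. The size shrinks to no less than a third,
whence `3 ≤ θ`. The ratio shrinks by `2/5`, faster than `m + 1` does. -/
theorem Level.half {θ : ℝ} {t r m : ℕ} (h : Level θ t r m) (ht : 2 ≤ t) (hm : t < m) (x : Bool) :
    Level θ t (nextRatio r) (halfLen m x) := by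
  obtain ⟨h₁, h₂, h₃, h₄⟩ := halfLen_bounds (m := m) (by omega) x
  have hθ := h.hθ
  have h₂' : (m : ℝ) ≤ 3 * halfLen m x := by exact_mod_cast h₂
  have h₄' : (m : ℝ) ≤ 2 * halfLen m x + 1 := by exact_mod_cast h₄
  have hm' : (t : ℝ) ≤ m := by exact_mod_cast hm.le
  refine ⟨hθ, one_le_nextRatio h.hr, h₁, ?_, ?_⟩
  · have : (0 : ℝ) ≤ halfLen m x := by positivity
    nlinarith
  -- Rounding up adds at most `4/5` to the ratio. The term `4 t` in the invariant is the fixed point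
  -- of the resulting error: `2/5 · 4 t + 3 · 4/5 t = 4 t`.
  · have h₅ : (nextRatio r : ℝ) * 5 ≤ 2 * r + 4 := by
      have : nextRatio r * 5 ≤ 2 * r + 4 := by unfold nextRatio; omega
      exact_mod_cast this
    have h₆ : (nextRatio r : ℝ) * 5 * t ≤ (2 * r + 4) * t := by gcongr
    have h₇ := h.hrt
    have h₈ : θ * (m + 1) ≤ θ * (2 * (halfLen m x + 1)) := by gcongr; linarith
    have h₉ : 0 ≤ θ * (m + 1) := by positivity
    linarith

/-- Turns the invariant into the hypothesis on `r t` that the multiplication needs, at the price of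
the factor `4`. -/
theorem Level.ratio_mul_le {θ : ℝ} {t r m k : ℕ} (hl : Level θ t r m) (ht : 2 ≤ t) (hm : t < m)
    (hk : m ≤ 3 * k) : (r * t : ℝ) ≤ 4 * θ * k := by
  have hθ := hl.hθ
  have h₁ := hl.hrt
  have h₂ : (t : ℝ) + 1 ≤ m := by exact_mod_cast hm
  have h₃ : (2 : ℝ) ≤ t := by exact_mod_cast ht
  have h₄ : (m : ℝ) ≤ 3 * k := by exact_mod_cast hk
  nlinarith

/-- Multiplications of matrices whose sizes are comparable to `m`. -/
theorem cheap_gemmC {θ : ℝ} {M B t : ℕ} (hT : Tall θ M B t) {o : Kernel σ}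
    {sp c sc a sa b br bc p q k r m : ℕ} (h : GemmArgs sp c sc a sa b br bc p q k)
    (hl : Level θ t r m) (hm : t < m) (hp : m ≤ 3 * p) (hp' : p ≤ m) (hq : m ≤ 3 * q) (hq' : q ≤ m)
    (hk : m ≤ 3 * k) (hk' : k ≤ m) (hb : br = 1 ∨ bc = 1) :
    Cheap (40960 * θ ^ 3) M B t r m (gemmC o sp c sc a sa b br bc p q k r).trace := by
  have hθ := hl.hθ
  -- The multiplication is applied with `4 θ`, and `640 · 4³ = 40960`.
  have := serves_gemmC (hT.mono (θ' := 4 * θ) (by linarith)) (o := o) hl.hr h (by omega) (by omega)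
    (by omega) (by omega) (by omega) (by omega) (by omega) (by omega) (by omega)
    (hl.ratio_mul_le hT.two_le_t hm hk) hb
  have hv : (p * q * k : ℝ) ≤ m ^ 3 := by
    have := Nat.mul_le_mul (Nat.mul_le_mul hp' hq') hk'
    calc (p * q * k : ℝ) ≤ m * m * m := by exact_mod_cast this
      _ = _ := by ring
  refine this.mono ?_ ?_
  · calc _ = 40960 * θ ^ 3 * (√r / (B * t) * (p * q * k)) := by ring
      _ ≤ _ := by gcongr
  · calc _ = 40960 * θ ^ 3 * (1 / (B * r * t) * (p * q * k)) := by ring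
      _ ≤ _ := by gcongr

theorem cheap_quadC {θ : ℝ} {M B t : ℕ} (hT : Tall θ M B t) {o : Kernel σ} {sp a s m r : ℕ}
    (h : SqArgs sp a s m) (hl : Level θ t r m) (hm : t < m) (x y z : Bool) :
    Cheap (40960 * θ ^ 3) M B t r m (quadC o sp a s m r x y z).trace := by
  have hm₂ : 2 ≤ m := by have := hT.two_le_t; omega
  have hx := halfLen_bounds hm₂ x
  have hy := halfLen_bounds hm₂ y
  have hz := halfLen_bounds hm₂ z
  exact cheap_gemmC hT (h.gemmArgs hm₂ x y z) hl hm hx.2.1 (by omega) hy.2.1 (by omega) hz.2.1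
    (by omega) (.inr rfl)

theorem cheap_mapC {θ : ℝ} {M B t : ℕ} (hT : Tall θ M B t) (o : σ) {ds ar ac d a p q r m : ℕ}
    (hl : Level θ t r m) (hm : t < m) (hp : m ≤ 3 * p) (hp' : p ≤ m) (hq : m ≤ 3 * q) (hq' : q ≤ m)
    (hs : ac = 1 ∨ ar = 1) :
    Cheap (264 * θ ^ 2) M B t r m (mapC o ds ar ac d a p q).trace := by
  have hθ := hl.hθ
  have ht := hT.two_le_t
  have hB' : (1 : ℝ) ≤ B := by exact_mod_cast hT.one_le_B
  have ht' : (2 : ℝ) ≤ t := by exact_mod_cast ht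
  have hr' : (1 : ℝ) ≤ r := by exact_mod_cast hl.hr
  have hp₁ : (p : ℝ) ≤ m := by exact_mod_cast hp'
  have hq₁ : (q : ℝ) ≤ m := by exact_mod_cast hq'
  have hrt := hl.ratio_mul_le ht hm (k := m) (by omega)
  have h₁ : (p * q / B : ℝ) ≤ 4 * θ * (1 / (B * r * t) * m ^ 3) := by
    rw [one_div_mul_eq_div, ← mul_div_assoc, div_le_div_iff₀ (by positivity) (by positivity)]
    calc (p * q * (B * r * t) : ℝ) = p * q * B * (r * t) := by ring
      _ ≤ m * m * B * (4 * θ * m) := by gcongr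
      _ = _ := by ring
  have h₂ : (1 : ℝ) / (B * r * t) ≤ √r / (B * t) := by
    rw [div_le_div_iff₀ (by positivity) (by positivity)]
    have h₃ : 1 ≤ √(r : ℝ) := Real.one_le_sqrt.2 hr'
    calc (1 * (B * t) : ℝ) ≤ √r * (B * t) := by gcongr
      _ = √r * (B * 1 * t) := by ring
      _ ≤ _ := by gcongr
  have h₃ : 66 * θ * (p * q / B) ≤ 264 * θ ^ 2 * (1 / (B * r * t) * m ^ 3) := by
    calc _ ≤ 66 * θ * (4 * θ * (1 / (B * r * t) * m ^ 3)) := by gcongr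
      _ = _ := by ring
  refine (serves_mapC hT o (by omega) (by omega) (by omega) (by omega) (by omega) hs).mono
    (h₃.trans ?_) h₃
  gcongr

/-- Computations on a block that fits into the cache together with their stack. -/
theorem cheap_of_fits {θ : ℝ} {M B t : ℕ} (hT : Tall θ M B t) {c : Comp σ} {sp a s m r p : ℕ}
    (hl : Level θ t r m) (hm : m ≤ t) (hp : p ≤ 2 * m) (hs : c.InScope sp)
    (ht : c.Touches (fun w => Blk a s p m w ∨ sp ≤ w) (fun w => Blk a s p m w ∨ sp ≤ w))
    (he : c.extent ≤ 6 * m ^ 2 + 1) : Cheap (14 * θ ^ 4) M B t r m c.trace := by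
  have hB := hT.one_le_B
  have hB' : (1 : ℝ) ≤ B := by exact_mod_cast hB
  have ht' : (2 : ℝ) ≤ t := by exact_mod_cast hT.two_le_t
  have hr' : (1 : ℝ) ≤ r := by exact_mod_cast hl.hr
  have hm' : (1 : ℝ) ≤ m := by exact_mod_cast hl.hm
  have hmt : (m : ℝ) ≤ t := by exact_mod_cast hm
  have hM : (20 * (t ^ 2 + t * B) : ℝ) ≤ M := by exact_mod_cast hT.fits
  have he' : (c.extent : ℝ) ≤ 6 * m ^ 2 + 1 := by exact_mod_cast he
  have hp' : (p : ℝ) ≤ 2 * m := by exact_mod_cast hp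
  have hθ := hl.hθ
  set F := blkLines B a s p m ∪ blkLines B sp 0 1 c.extent
  have hF : (F.card : ℝ) * B ≤ 9 * m ^ 2 + 6 * m * B := by
    have h₁ : (F.card : ℝ) ≤ (blkLines B a s p m).card + (blkLines B sp 0 1 c.extent).card := by
      exact_mod_cast Finset.card_union_le _ _
    have h₂ := card_blkLines_le hB a s p m
    have h₃ := card_blkLines_le hB sp 0 1 c.extent
    rw [Nat.cast_one, one_mul] at h₃
    have h₄ : (1 : ℝ) ≤ m ^ 2 := one_le_pow₀ hm'
    have h₅ : (B : ℝ) ≤ m * B := by nlinarith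
    calc (F.card : ℝ) * B ≤ (2 * m * (m / B + 2) + (c.extent / B + 2)) * B := by
          gcongr
          have : p * ((m : ℝ) / B + 2) ≤ 2 * m * (m / B + 2) := by gcongr
          linarith
      _ = 2 * m ^ 2 + 4 * m * B + c.extent + 2 * B := by field_simp; ring
      _ ≤ _ := by linarith
  have hFM : F.card * B ≤ M := by
    have h₁ : (m : ℝ) ^ 2 ≤ t ^ 2 := by gcongr
    have h₂ : (m * B : ℝ) ≤ t * B := by gcongr
    have h₃ : (0 : ℝ) ≤ t ^ 2 := by positivity
    have h₄ : (0 : ℝ) ≤ t * B := by positivity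
    have : (F.card : ℝ) * B ≤ M := by linarith
    exact_mod_cast this
  have hF₂ : (F.card : ℝ) ≤ 7 * θ ^ 3 * (1 / (B * t) * m ^ 3) := by
    have h₁ : (F.card : ℝ) * B ≤ 7 * θ ^ 2 * m ^ 2 := by
      have h₂ : (m * B : ℝ) ≤ m * (θ * (θ * m)) := by
        gcongr
        exact hT.B_le.trans (by have := hl.ht; gcongr)
      have h₃ : 9 * (m : ℝ) ^ 2 ≤ θ ^ 2 * m ^ 2 := by
        gcongr
        nlinarith
      nlinarith
    rw [one_div_mul_eq_div, ← mul_div_assoc, le_div_iff₀ (by positivity)]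
    calc (F.card : ℝ) * (B * t) = F.card * B * t := by ring
      _ ≤ 7 * θ ^ 2 * m ^ 2 * (θ * m) := by have := hl.ht; gcongr
      _ = _ := by ring
  -- For blocks that fit, the invariant bounds the ratio by a constant, so the factor `1/r` in the
  -- writes does no harm.
  have hrθ : (r : ℝ) ≤ 2 * θ := by
    have h₁ := hl.hrt
    have h₂ : θ * (m + 1) ≤ θ * (3 / 2 * t) := by gcongr; linarith
    have h₃ : (3 * r : ℝ) * t ≤ (3 / 2 * θ + 4) * t := by linarith
    have h₄ := le_of_mul_le_mul_right h₃ (by linarith)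
    linarith
  refine (serves_of_lines (F := F) (fun e he => ?_) hFM).mono (hF₂.trans ?_) (hF₂.trans ?_)
  · have h₁ := ht e he
    have h₂ := hs.touches e he
    have key : ∀ w, (Blk a s p m w ∨ sp ≤ w) → w < sp + c.extent → w / B ∈ F := by
      rintro w (hw | hw) hw'
      exacts [Finset.mem_union_left _ (mem_blkLines hw),
        Finset.mem_union_right _ (mem_lines_interval hw hw')]
    exact ⟨key _ h₁.1 h₂.1, key _ h₁.2.1 h₂.2.1, key _ h₁.2.2 h₂.2.2⟩
  · have h₁ : 1 ≤ √(r : ℝ) := Real.one_le_sqrt.2 hr'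
    have h₂ : 7 * θ ^ 3 ≤ 14 * θ ^ 4 := by nlinarith [pow_pos (show 0 < θ by linarith) 3]
    gcongr
  · have h₁ : (1 : ℝ) / (B * t) ≤ 2 * θ * (1 / (B * r * t)) := by
      rw [mul_one_div, div_le_div_iff₀ (by positivity) (by positivity)]
      calc (1 * (B * r * t) : ℝ) = B * t * r := by ring
        _ ≤ B * t * (2 * θ) := by gcongr
        _ = _ := by ring
    calc 7 * θ ^ 3 * (1 / (B * t) * m ^ 3) ≤ 7 * θ ^ 3 * (2 * θ * (1 / (B * r * t)) * m ^ 3) := by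
          gcongr
      _ = _ := by ring

theorem clog_le_clog_half {m : ℕ} (hm : 2 ≤ m) : Nat.clog 2 m ≤ Nat.clog 2 (m / 2) + 2 := by
  have h : m ≤ 2 ^ (Nat.clog 2 (m / 2) + 2) := by
    have := Nat.le_pow_clog one_lt_two (m / 2)
    rw [pow_add]
    omega
  exact (Nat.clog_le_iff_le_pow one_lt_two).2 h

/-- The span recurrence of algorithms with two sequential recursive calls. -/
theorem span_halves_le {c m r S₀ S₁ : ℕ} (hm : 2 ≤ m)
    (h₀ : S₀ + c * (Nat.clog 2 (m / 2) + 20) ^ 3 ≤ c * (8001 * (m / 2) + 5 * nextRatio r))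
    (h₁ : S₁ + c * (Nat.clog 2 (m - m / 2) + 20) ^ 3 ≤ c * (8001 * (m - m / 2) + 5 * nextRatio r)) :
    S₀ + S₁ + c * (r + (Nat.clog 2 m + 1) ^ 3) + c * (Nat.clog 2 m + 20) ^ 3 ≤
      c * (8001 * m + 5 * r) := by
  set x := Nat.clog 2 (m / 2)
  have e₁ : (x + 20) ^ 3 ≤ (Nat.clog 2 (m - m / 2) + 20) ^ 3 :=
    Nat.pow_le_pow_left (Nat.add_le_add_right (Nat.clog_mono_right _ (by omega)) _) 3
  have e₂ : (Nat.clog 2 m + 20) ^ 3 ≤ (x + 22) ^ 3 :=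
    Nat.pow_le_pow_left (by have := clog_le_clog_half hm; omega) 3
  have e₃ : (Nat.clog 2 m + 1) ^ 3 ≤ (x + 3) ^ 3 :=
    Nat.pow_le_pow_left (by have := clog_le_clog_half hm; omega) 3
  -- The cube of `log m + 20` is a reserve subtracted from a linear bound. The two reserves of the
  -- children cover the parent's reserve, the polylogarithmic cost of the level, and the rounding
  -- error `8` of the ratios; the shift `20` is large enough for this at every `x`.
  have e₄ : (x + 22) ^ 3 + (x + 3) ^ 3 + 8 ≤ 2 * (x + 20) ^ 3 := by
    have : 2 * (x + 20) ^ 3 = (x + 22) ^ 3 + (x + 3) ^ 3 + 8 + (45 * x ^ 2 + 921 * x + 5317) := by ring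
    omega
  -- Two sequential calls together carry at most `4/5` of the ratio term, so the local cost `r` fits
  -- into the remaining fifth.
  have e₅ : 10 * nextRatio r ≤ 4 * r + 8 := by unfold nextRatio; omega
  have key : c * (r + (Nat.clog 2 m + 1) ^ 3) + c * (Nat.clog 2 m + 20) ^ 3
      + c * (8001 * (m / 2) + 5 * nextRatio r) + c * (8001 * (m - m / 2) + 5 * nextRatio r) ≤
      c * (8001 * m + 5 * r) + c * (x + 20) ^ 3 + c * (Nat.clog 2 (m - m / 2) + 20) ^ 3 := by
    rw [← mul_add, ← mul_add, ← mul_add, ← mul_add, ← mul_add]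
    exact Nat.mul_le_mul_left _ (by omega)
  omega

/-! ## Choosing the aspect ratio -/

/-- Search for a number `t` with `w² ≤ t³` or `n ≤ t`, then run `cont`. The registers hold `n, w, t`. -/
def searchStmt (self : ℕ) (cont : Stmt σ) : Stmt σ :=
  .ifLe (reg 1 * reg 1) (reg 2 * reg 2 * reg 2) cont
    (.ifLe (reg 0) (reg 2) cont (.call self [reg 0, reg 1, 2 * reg 2 + 1]))

/-- The computation of `searchStmt`. -/
def searchC (body : ℕ → Comp σ) (n w t : ℕ) : Comp σ :=
  if w * w ≤ t * t * t then .tick (.tick (body t))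
  else if n ≤ t then .tick (.tick (.tick (body t)))
  else .tick (.tick (.tick (searchC body n w (2 * t + 1))))
termination_by n - t

theorem unfolds_searchC {P : Program σ} {self : ℕ} {cont : Stmt σ}
    (hP : P[self]? = some (searchStmt self cont)) {body : ℕ → Comp σ} {sp n w : ℕ}
    (hb : ∀ t, Unfolds P sp [n, w, t] cont (body t)) (t : ℕ) : ∀ (ρ : List ℕ) (args : List IExpr),
    args.map (IExpr.eval ρ) = [n, w, t] →
      Unfolds P sp ρ (.call self args) (searchC body n w t) := by
  fun_induction searchC body n w t with
  | case1 t h => exact fun ρ args hρ => .call hP (hρ ▸ .ifTrue h (hb t))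
  | case2 t h h' => exact fun ρ args hρ => .call hP (hρ ▸ .ifFalse h (.ifTrue h' (hb t)))
  | case3 t h h' ih =>
    exact fun ρ args hρ => .call hP (hρ ▸ .ifFalse h (.ifFalse h' (ih _ _ rfl)))

/-- What the search guarantees for the aspect ratio. -/
structure IsRatio (n w r : ℕ) : Prop where
  one_le : 1 ≤ r
  le_two_mul : r ≤ 2 * n
  cube_le : r ^ 3 ≤ 27 * w ^ 2
  sq_le : w ^ 2 ≤ r ^ 3 ∨ n ≤ r

/-- The search ends with `r` equal to `w^(2/3)` up to a constant, or at least `n`. A rejected `t`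
satisfies `t³ < w²` and `t < n`, and `2 t + 1 ≤ 3 t`, which explains `27` and `2 n`. It takes few
steps, but a linear bound is enough for the span. -/
theorem searchC_eq (body : ℕ → Comp σ) {n w t : ℕ} (h₁ : 1 ≤ t) (h₂ : t ≤ 2 * n)
    (h₃ : t ^ 3 ≤ 27 * w ^ 2) :
    ∃ j r, j ≤ 3 * (n - t) + 3 ∧ IsRatio n w r ∧ searchC body n w t = Comp.tick^[j] (body r) := by
  fun_induction searchC body n w t with
  | case1 t h =>
    exact ⟨2, t, by omega, ⟨h₁, h₂, h₃, .inl (by rw [sq, pow_succ, sq]; exact h)⟩, rfl⟩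
  | case2 t h h' => exact ⟨3, t, by omega, ⟨h₁, h₂, h₃, .inr h'⟩, rfl⟩
  | case3 t h h' ih =>
    obtain ⟨j, r, hj, hr, e⟩ := ih (by omega) (by omega) (by
      calc (2 * t + 1) ^ 3 ≤ (3 * t) ^ 3 := Nat.pow_le_pow_left (by omega) 3
        _ = 27 * (t * t * t) := by ring
        _ ≤ 27 * (w * w) := Nat.mul_le_mul_left _ (by omega)
        _ = 27 * w ^ 2 := by rw [sq])
    refine ⟨j + 3, r, by omega, hr, ?_⟩
    rw [e, Function.iterate_add_apply _ j 3, ← Function.iterate_add_apply, add_comm j 3,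
      Function.iterate_add_apply]
    rfl

section Iterate

variable (j : ℕ) (c : Comp σ) (sp : ℕ)

theorem trace_iterate_tick : (Comp.tick^[j] c).trace = c.trace := by
  induction j with
  | zero => rfl
  | succ j ih => rw [Function.iterate_succ_apply']; exact ih

theorem work_iterate_tick : (Comp.tick^[j] c).work = j + c.work := by
  induction j with
  | zero => simp
  | succ j ih => rw [Function.iterate_succ_apply', Comp.work, ih, Comp.work]; ring

theorem span_iterate_tick : (Comp.tick^[j] c).span = j + c.span := by
  induction j with
  | zero => simp
  | succ j ih => rw [Function.iterate_succ_apply', Comp.span, ih, Comp.span]; ring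

theorem inScope_iterate_tick (h : c.InScope sp) : (Comp.tick^[j] c).InScope sp := by
  induction j with
  | zero => exact h
  | succ j ih => rw [Function.iterate_succ_apply']; exact ⟨trivial, ih⟩

theorem raceFree_iterate_tick (h : c.RaceFree sp) : (Comp.tick^[j] c).RaceFree sp := by
  induction j with
  | zero => exact h
  | succ j ih => rw [Function.iterate_succ_apply']; exact ⟨trivial, ih⟩

theorem run_iterate_tick {R : Type u} (I : σ → R → R → R) (junk : ℕ → R) (m : ℕ → R) :
    (Comp.tick^[j] c).run I junk sp m = c.run I junk sp m := by
  induction j generalizing m with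
  | zero => rfl
  | succ j ih => rw [Function.iterate_succ_apply']; exact ih m

end Iterate

/-- The entry point: start the search at `1`. -/
def mainStmt (search : ℕ) : Stmt σ := .call search [reg 0, reg 1, 1]

theorem generates_mainC {P : Program σ} {size : ℕ → ℕ} {search : ℕ} {cont : Stmt σ}
    {body : ℕ → ℕ → Comp σ} (h₀ : P[0]? = some (mainStmt search))
    (h₁ : P[search]? = some (searchStmt search cont))
    (hb : ∀ n w t, Unfolds P (size n) [n, w, t] cont (body n t)) :
    Generates P size fun n w => .tick (searchC (body n) n w 1) := fun n w _ _ =>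
  .call h₀ (unfolds_searchC h₁ (hb n w) 1 _ _ rfl)

/-- Reduces the whole program to its body at one suitable ratio: the search is pure control and
leaves the trace and the memory unchanged. -/
theorem exists_tick_eq (body : ℕ → ℕ → Comp σ) {n w : ℕ} (hn : 1 ≤ n) (hw : 1 ≤ w) :
    ∃ j r, j ≤ 4 * n ∧ IsRatio n w r ∧
      .tick (searchC (body n) n w 1) = Comp.tick^[j] (body n r) := by
  obtain ⟨j, r, hj, hr, e⟩ := searchC_eq (body n) (n := n) (w := w) (t := 1) le_rfl (by omega) (by
    have := Nat.pow_le_pow_left hw 2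
    omega)
  refine ⟨j + 1, r, by omega, hr, ?_⟩
  rw [e, Function.iterate_succ_apply']

/-! ## Cost bounds in terms of the cache size -/

/-- The analysis, not the program, chooses `t`. It has to be a small enough multiple of `√M` for
blocks of side `t` to fit, and a large enough one for rows of length `t` to fill lines. -/
theorem exists_tall {κ : ℝ} (hκ : 0 < κ) (hκ₁ : κ ≤ 1) {M B : ℕ} (hB : 1 ≤ B) (hM : 120 * B ≤ M)
    (hκM : κ * (B : ℝ) ^ 2 ≤ M) :
    ∃ t : ℕ, Tall (80 / κ) M B t ∧ √(M : ℝ) ≤ 80 / κ * t ∧ (t : ℝ) ≤ 2 * √M := by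
  have hB' : (1 : ℝ) ≤ B := by exact_mod_cast hB
  have hM' : (120 * B : ℝ) ≤ M := by exact_mod_cast hM
  have hM₁ : (1 : ℝ) ≤ M := by linarith
  set s := √(M : ℝ) with hs
  have hs₁ : 1 ≤ s := Real.one_le_sqrt.2 hM₁
  have hss : s ^ 2 = M := Real.sq_sqrt (by linarith)
  set k := √κ with hk
  have hkk : k ^ 2 = κ := Real.sq_sqrt hκ.le
  have hk0 : 0 < k := Real.sqrt_pos.2 hκ
  have hk1 : k ≤ 1 := Real.sqrt_le_one.2 hκ₁
  have hκk : κ ≤ k := by nlinarith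
  have hkB : k * B ≤ s := by
    refine Real.le_sqrt_of_sq_le ?_
    rwa [mul_pow, hkk]
  have hk80 : 80 / k ≤ 80 / κ := by gcongr
  have h80 : 80 ≤ 80 / κ := by rw [le_div_iff₀ hκ]; linarith
  have hfl : (⌊k / 40 * s⌋₊ : ℝ) ≤ k / 40 * s := Nat.floor_le (by positivity)
  have ht : k / 80 * s ≤ (max 2 ⌊k / 40 * s⌋₊ : ℕ) := by
    rcases le_total (k / 40 * s) 4 with h | h
    · have : ((2 : ℕ) : ℝ) ≤ (max 2 ⌊k / 40 * s⌋₊ : ℕ) := by exact_mod_cast le_max_left _ _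
      push_cast at this ⊢
      linarith
    · have h₁ := Nat.lt_floor_add_one (k / 40 * s)
      have : ((⌊k / 40 * s⌋₊ : ℕ) : ℝ) ≤ (max 2 ⌊k / 40 * s⌋₊ : ℕ) := by
        exact_mod_cast le_max_right _ _
      linarith
  have hst : s ≤ 80 / k * (max 2 ⌊k / 40 * s⌋₊ : ℕ) := by
    rw [div_mul_eq_mul_div, le_div_iff₀ hk0]
    linarith
  -- Up to rounding `t` is `√κ √M / 40`. The factor `√κ` makes `t B` at most `M / 40`, because `√κ B
  -- ≤ √M`.
  refine ⟨max 2 ⌊k / 40 * s⌋₊, ⟨hB, le_max_left _ _, by linarith, ?_, ?_⟩, ?_, ?_⟩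
  · have : (B : ℝ) * k ≤ 80 / k * (max 2 ⌊k / 40 * s⌋₊ : ℕ) := by linarith
    rw [← le_div_iff₀ hk0] at this
    refine this.trans (le_of_eq ?_)
    rw [← hkk]
    field_simp
  · rcases le_total 2 ⌊k / 40 * s⌋₊ with h | h
    · rw [max_eq_right h]
      have h₁ : ((⌊k / 40 * s⌋₊ : ℕ) : ℝ) ^ 2 ≤ (k / 40 * s) ^ 2 := by gcongr
      have h₂ : ((⌊k / 40 * s⌋₊ : ℕ) : ℝ) * B ≤ (k / 40 * s) * B := by gcongr
      have h₃ : (k / 40 * s) ^ 2 ≤ M / 1600 := by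
        rw [mul_pow, hss, div_pow, hkk]
        nlinarith
      have h₄ : (k / 40 * s) * B ≤ M / 40 := by
        calc (k / 40 * s) * B = s * (k * B) / 40 := by ring
          _ ≤ s * s / 40 := by gcongr
          _ = _ := by rw [← sq, hss]
      have h₅ : (20 * ((⌊k / 40 * s⌋₊ : ℕ) ^ 2 + (⌊k / 40 * s⌋₊ : ℕ) * B) : ℝ) ≤ M := by linarith
      exact_mod_cast h₅
    -- With `t = 2` the requirement is `80 + 40 B ≤ M`; this is where the `120` cache lines come
    -- from.
    · rw [max_eq_left h]
      omega
  · exact hst.trans (by gcongr)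
  · rw [Nat.cast_max]
    refine max_le (by push_cast; linarith) (hfl.trans ?_)
    nlinarith

/-- The costs of an algorithm with a given aspect ratio. -/
structure Efficient (size : ℕ → ℕ) (body : ℕ → ℕ → Comp σ) : Prop where
  inScope : ∀ n r, 1 ≤ n → 1 ≤ r → (body n r).InScope (size n)
  raceFree : ∀ n r, 1 ≤ n → 1 ≤ r → (body n r).RaceFree (size n)
  work_le : ∃ C : ℕ, ∀ n r, 1 ≤ n → 1 ≤ r → (body n r).work ≤ C * n ^ 3
  le_work : ∃ C : ℕ, ∀ n r, 1 ≤ n → 1 ≤ r → n ^ 3 ≤ C * (body n r).work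
  span_le : ∃ C : ℕ, ∀ n r, 1 ≤ n → 1 ≤ r → (body n r).span ≤ C * (n + r)
  cheap : ∀ θ : ℝ, 3 ≤ θ → ∃ C : ℝ, 0 ≤ C ∧ ∀ M B t n r : ℕ, Tall θ M B t → Level θ t r n →
    Cheap C M B t r n (body n r).trace

theorem symCacheBound_of_cheap {body : ℕ → ℕ → Comp σ}
    (h : ∀ θ : ℝ, 3 ≤ θ → ∃ C : ℝ, 0 ≤ C ∧ ∀ M B t n r : ℕ, Tall θ M B t → Level θ t r n →
      Cheap C M B t r n (body n r).trace) :
    SymCacheBound fun n w => .tick (searchC (body n) n w 1) := by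
  refine ⟨120, fun κ' hκ' => ?_⟩
  set κ := min κ' 1
  have hκ : 0 < κ := lt_min hκ' one_pos
  have hκ₁ : κ ≤ 1 := min_le_right _ _
  have h80 : 80 ≤ 80 / κ := by rw [le_div_iff₀ hκ]; linarith
  obtain ⟨C, hC, hcheap⟩ := h (80 / κ) (by linarith)
  refine ⟨3 * C * (80 / κ) + 1, by positivity, fun M B n hB hn hM hκB hκn => ?_⟩
  have hB' : (1 : ℝ) ≤ B := by exact_mod_cast hB
  have hn' : (1 : ℝ) ≤ n := by exact_mod_cast hn
  have hM1 : (1 : ℝ) ≤ M := by exact_mod_cast (show 1 ≤ M by omega)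
  obtain ⟨t, hT, hMt, htM⟩ := exists_tall hκ hκ₁ hB hM
    ((mul_le_mul_of_nonneg_right (min_le_left _ _) (by positivity)).trans hκB)
  obtain ⟨j, r, -, hr, e⟩ := exists_tick_eq body hn (le_refl 1)
  have ht : (0 : ℝ) < t := by
    have := hT.two_le_t
    exact_mod_cast (by omega : 0 < t)
  have hr1 : (1 : ℝ) ≤ r := by exact_mod_cast hr.one_le
  -- For `w = 1` the ratio is bounded, because `r³ ≤ 27`; the reads and the writes are then of the
  -- same order.
  have hr3 : r ≤ 3 := by
    by_contra hh
    have := Nat.pow_le_pow_left (show 4 ≤ r by omega) 3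
    have := hr.cube_le
    omega
  have hr3' : (r : ℝ) ≤ 3 := by exact_mod_cast hr3
  have hsn : κ * √(M : ℝ) ≤ n := by
    refine le_of_sq_le_sq ?_ (by positivity)
    rw [mul_pow, Real.sq_sqrt (by linarith)]
    calc κ ^ 2 * M ≤ κ' * M := by
          gcongr
          have : κ ≤ κ' := min_le_left _ _
          nlinarith
      _ ≤ _ := hκn
  have htn : (t : ℝ) ≤ 2 / κ * n := by
    rw [div_mul_eq_mul_div, le_div_iff₀ hκ]
    nlinarith
  have hκn0 : 0 ≤ 1 / κ * n := by positivity
  have e80 : 80 / κ * n = 80 * (1 / κ * n) := by ring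
  have e2 : 2 / κ * n = 2 * (1 / κ * n) := by ring
  have hl : Level (80 / κ) t r n := by
    refine ⟨by linarith, hr.one_le, hn, by linarith, ?_⟩
    have : (3 * r * t : ℝ) ≤ 3 * 3 * t := by gcongr
    have : 80 / κ * (n + 1) = 80 * (1 / κ * n) + 80 / κ := by ring
    linarith
  have hs := hcheap M B t n r hT hl
  rw [Cheap, ← trace_iterate_tick j, ← e] at hs
  refine hs.symCacheCost_le.trans (ENNReal.ofReal_le_ofReal ?_)
  have hM0 : 0 < √(M : ℝ) := Real.sqrt_pos.2 (by linarith)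
  have h₁ : (1 : ℝ) / t ≤ 80 / κ * (1 / √M) := by
    rw [mul_one_div, div_le_div_iff₀ ht hM0]
    linarith
  have h₂ : √(r : ℝ) ≤ 2 := by
    rw [Real.sqrt_le_left (by norm_num)]
    linarith
  have h₃ : (1 : ℝ) / r ≤ 1 := by
    rw [div_le_one (by linarith)]
    exact hr1
  calc C * (√r / (B * t) * n ^ 3) + C * (1 / (B * r * t) * n ^ 3)
      = C * (√r + 1 / r) * (1 / t) * (n ^ 3 / B) := by field_simp
    _ ≤ C * (2 + 1) * (80 / κ * (1 / √M)) * (n ^ 3 / B) := by gcongr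
    _ = 3 * C * (80 / κ) * (n ^ 3 / (B * √M)) := by field_simp; ring
    _ ≤ _ := by
      gcongr
      linarith

theorem asymCacheBound_of_cheap {body : ℕ → ℕ → Comp σ}
    (h : ∀ θ : ℝ, 3 ≤ θ → ∃ C : ℝ, 0 ≤ C ∧ ∀ M B t n r : ℕ, Tall θ M B t → Level θ t r n →
      Cheap C M B t r n (body n r).trace) :
    AsymCacheBound fun n w => .tick (searchC (body n) n w 1) := by
  refine ⟨120, fun κ' hκ' => ?_⟩
  set κ := min κ' 1
  have hκ : 0 < κ := lt_min hκ' one_pos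
  have hκ₁ : κ ≤ 1 := min_le_right _ _
  have hκκ' : κ ≤ κ' := min_le_left _ _
  have h80 : 80 ≤ 80 / κ := by rw [le_div_iff₀ hκ]; linarith
  obtain ⟨C, hC, hcheap⟩ := h (80 / κ) (by linarith)
  refine ⟨C * (3 + 1 / κ) * (80 / κ) + 1, by positivity, fun ω M B n hω hB hn hM hκB hκn => ?_⟩
  have hB' : (1 : ℝ) ≤ B := by exact_mod_cast hB
  have hn' : (1 : ℝ) ≤ n := by exact_mod_cast hn
  have hM1 : (1 : ℝ) ≤ M := by exact_mod_cast (show 1 ≤ M by omega)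
  obtain ⟨t, hT, hMt, htM⟩ := exists_tall hκ hκ₁ hB hM
    ((mul_le_mul_of_nonneg_right hκκ' (by positivity)).trans hκB)
  have hw : 1 ≤ ⌈ω⌉₊ := Nat.one_le_ceil_iff.2 (by linarith)
  obtain ⟨j, r, -, hr, e⟩ := exists_tick_eq body hn hw
  have ht : (0 : ℝ) < t := by
    have := hT.two_le_t
    exact_mod_cast (by omega : 0 < t)
  have hr1 : (1 : ℝ) ≤ r := by exact_mod_cast hr.one_le
  set v : ℝ := ω ^ (1 / 3 : ℝ) with hv
  have hv1 : 1 ≤ v := Real.one_le_rpow hω (by norm_num)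
  have hv3 : ω = v ^ 3 := by
    rw [hv, ← Real.rpow_natCast, ← Real.rpow_mul (by linarith)]
    norm_num
  have hv2 : ω ^ (2 / 3 : ℝ) = v ^ 2 := by
    rw [hv, ← Real.rpow_natCast, ← Real.rpow_mul (by linarith)]
    norm_num
  rw [hv2] at hκn
  have hκn' : κ * (v ^ 2 * M) ≤ n := (mul_le_mul_of_nonneg_right hκκ' (by positivity)).trans hκn
  have hceil : (⌈ω⌉₊ : ℝ) ≤ 2 * v ^ 3 := by
    have := Nat.ceil_lt_add_one (show 0 ≤ ω by linarith)
    linarith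
  have hceil' : v ^ 3 ≤ (⌈ω⌉₊ : ℝ) := hv3 ▸ Nat.le_ceil ω
  -- Rounding `ω` up at most doubles it, so `r³ ≤ 27 · 4 v⁶ ≤ (5 v²)³`.
  have hr_le : (r : ℝ) ≤ 5 * v ^ 2 := by
    refine le_of_pow_le_pow_left₀ (n := 3) (by norm_num) (by positivity) ?_
    have h₁ : (r : ℝ) ^ 3 ≤ 27 * (⌈ω⌉₊ : ℝ) ^ 2 := by exact_mod_cast hr.cube_le
    have h₂ : (⌈ω⌉₊ : ℝ) ^ 2 ≤ (2 * v ^ 3) ^ 2 := by gcongr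
    have h₃ : (0 : ℝ) ≤ v ^ 6 := by positivity
    calc (r : ℝ) ^ 3 ≤ 27 * (2 * v ^ 3) ^ 2 := by linarith
      _ = 108 * v ^ 6 := by ring
      _ ≤ 125 * v ^ 6 := by linarith
      _ = _ := by ring
  -- If the search stopped at the cap `n`, the hypothesis on `n` shows that `r` is still at least of
  -- order `ω^(2/3)`.
  have hle_r : κ * v ^ 2 ≤ r := by
    rcases hr.sq_le with h | h
    · have h₁ : (⌈ω⌉₊ : ℝ) ^ 2 ≤ (r : ℝ) ^ 3 := by exact_mod_cast h
      have h₂ : v ^ 2 ≤ r := by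
        refine le_of_pow_le_pow_left₀ (n := 3) (by norm_num) (by positivity) ?_
        calc (v ^ 2) ^ 3 = (v ^ 3) ^ 2 := by ring
          _ ≤ (⌈ω⌉₊ : ℝ) ^ 2 := by gcongr
          _ ≤ _ := h₁
      have : 0 ≤ v ^ 2 := by positivity
      nlinarith
    · have h₁ : (n : ℝ) ≤ r := by exact_mod_cast h
      have h₂ : κ * (v ^ 2 * 1) ≤ κ * (v ^ 2 * M) := by gcongr
      linarith
  have hsM : √(M : ℝ) ≤ M := Real.sqrt_le_iff.2 ⟨by linarith, by nlinarith⟩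
  have hvM : v ^ 2 * M ≤ 1 / κ * n := by
    rw [div_mul_eq_mul_div, one_mul, le_div_iff₀ hκ]
    linarith
  have hv2M : (M : ℝ) ≤ v ^ 2 * M := by
    have : 1 ≤ v ^ 2 := one_le_pow₀ hv1
    nlinarith
  have e80 : 80 / κ * n = 80 * (1 / κ * n) := by ring
  have hl : Level (80 / κ) t r n := by
    refine ⟨by linarith, hr.one_le, hn, by linarith, ?_⟩
    have : (3 * r * t : ℝ) ≤ 3 * (5 * v ^ 2) * (2 * M) := by gcongr; linarith
    have : 80 / κ * (n + 1) = 80 * (1 / κ * n) + 80 / κ := by ring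
    linarith
  have hs := hcheap M B t n r hT hl
  rw [Cheap, ← trace_iterate_tick j, ← e] at hs
  refine (hs.asymCacheCost_le (by linarith)).trans (ENNReal.ofReal_le_ofReal ?_)
  have hM0 : 0 < √(M : ℝ) := Real.sqrt_pos.2 (by linarith)
  have h₁ : (1 : ℝ) / t ≤ 80 / κ * (1 / √M) := by
    rw [mul_one_div, div_le_div_iff₀ ht hM0]
    linarith
  have h₂ : √(r : ℝ) ≤ 3 * v := by
    rw [Real.sqrt_le_left (by linarith)]
    nlinarith
  have h₃ : ω * (1 / r) ≤ 1 / κ * v := by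
    rw [mul_one_div, div_mul_eq_mul_div, div_le_div_iff₀ (by linarith) hκ, hv3]
    calc v ^ 3 * κ = v * (κ * v ^ 2) := by ring
      _ ≤ v * r := by gcongr
      _ = _ := by ring
  calc C * (√r / (B * t) * n ^ 3) + ω * (C * (1 / (B * r * t) * n ^ 3))
      = C * (√r + ω * (1 / r)) * (1 / t) * (n ^ 3 / B) := by field_simp
    _ ≤ C * (3 * v + 1 / κ * v) * (80 / κ * (1 / √M)) * (n ^ 3 / B) := by gcongr
    _ = C * (3 + 1 / κ) * (80 / κ) * (v * n ^ 3 / (B * √M)) := by field_simp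
    _ ≤ _ := by
      gcongr
      linarith

/-- All costs of the body are uniform in the ratio, except the term `r` in the span and the cache
costs, so the guarantees of the search finish the proof for any of the three algorithms. -/
theorem Efficient.bounds {size : ℕ → ℕ} {body : ℕ → ℕ → Comp σ} (h : Efficient size body) :
    Safe size (fun n w => .tick (searchC (body n) n w 1)) ∧
    CubicWork (fun n w => .tick (searchC (body n) n w 1)) ∧
    LinearSpan (fun n w => .tick (searchC (body n) n w 1)) ∧
    SymCacheBound (fun n w => .tick (searchC (body n) n w 1)) ∧
    AsymCacheBound (fun n w => .tick (searchC (body n) n w 1)) := by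
  refine ⟨fun n w hn hw => ?_, ?_, ?_, symCacheBound_of_cheap h.cheap,
    asymCacheBound_of_cheap h.cheap⟩
  · obtain ⟨j, r, -, hr, e⟩ := exists_tick_eq body hn hw
    beta_reduce
    rw [e]
    exact ⟨inScope_iterate_tick _ _ _ (h.inScope n r hn hr.one_le),
      raceFree_iterate_tick _ _ _ (h.raceFree n r hn hr.one_le)⟩
  · obtain ⟨C, hC⟩ := h.work_le
    obtain ⟨c, hc⟩ := h.le_work
    refine ⟨1 / (c + 1), C + 4, by positivity, by positivity, fun n w hn hw => ?_⟩
    obtain ⟨j, r, hj, hr, e⟩ := exists_tick_eq body hn hw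
    beta_reduce
    rw [e, work_iterate_tick]
    have h₁ : (n ^ 3 : ℝ) ≤ c * (body n r).work := by exact_mod_cast hc n r hn hr.one_le
    have h₂ : ((body n r).work : ℝ) ≤ C * n ^ 3 := by exact_mod_cast hC n r hn hr.one_le
    have h₃ : (j : ℝ) ≤ 4 * n := by exact_mod_cast hj
    have h₄ : (1 : ℝ) ≤ n := by exact_mod_cast hn
    have h₅ : (n : ℝ) ≤ n ^ 3 := le_self_pow₀ h₄ (by norm_num)
    have h₆ : (0 : ℝ) ≤ (body n r).work := by positivity
    have h₇ : (0 : ℝ) ≤ j := by positivity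
    push_cast
    constructor
    · rw [div_mul_eq_mul_div, one_mul, div_le_iff₀ (by positivity)]
      have : (0 : ℝ) ≤ c := by positivity
      nlinarith
    · linarith
  · obtain ⟨C, hC⟩ := h.span_le
    refine ⟨3 * C + 4, by positivity, fun n w hn hw => ?_⟩
    obtain ⟨j, r, hj, hr, e⟩ := exists_tick_eq body hn hw
    beta_reduce
    rw [e, span_iterate_tick]
    -- The cap `r ≤ 2 n` makes the span linear however large `ω` is.
    have h₂ : (body n r).span ≤ C * (3 * n) :=
      (hC n r hn hr.one_le).trans (Nat.mul_le_mul_left _ (by have := hr.le_two_mul; omega))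
    have h₃ : j + (body n r).span ≤ (3 * C + 4) * n := by linarith
    exact_mod_cast h₃

/-! ## Kleene's algorithm -/

/-- Call procedure `self` on the diagonal quadrant `x`. -/
def halfStmt (self : ℕ) (x : Bool) (rest : List IExpr) : Stmt σ :=
  .call self ((reg 0 + offsetE (reg 2) x * reg 1 + offsetE (reg 2) x) :: reg 1 ::
    halfLenE (reg 2) x :: nextRatioE (reg 3) :: rest)

theorem eval_half (x : Bool) (a s m r : ℕ) (ρ : List ℕ) :
    [reg 0 + offsetE (reg 2) x * reg 1 + offsetE (reg 2) x, reg 1, halfLenE (reg 2) x,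
      nextRatioE (reg 3)].map (IExpr.eval (a :: s :: m :: r :: ρ)) =
      [a + offset m x * s + offset m x, s, halfLen m x, nextRatio r] := by
  cases x <;> rfl

/-- Kleene's algorithm on the `m × m` block at `a` with row stride `s`; the registers hold
`a, s, m, r`. -/
def kleeneStmt : Stmt σ :=
  .ifLe (reg 2) 1 .skip
    (.seq (halfStmt 6 false [])
      (.seq (.seq (quadStmt false true false)
          (.seq (quadStmt true false false) (quadStmt true true false)))
        (.seq (halfStmt 6 true [])
          (.seq (quadStmt false true true)
            (.seq (quadStmt true false true) (quadStmt false false true))))))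

/-- The computation of `kleeneStmt`. -/
def kleeneC (o : Kernel σ) (sp s a m r : ℕ) : Comp σ :=
  if m ≤ 1 then .tick (.tick .step)
  else
    .tick (.tick
      (.seq (kleeneC o sp s (a + offset m false * s + offset m false) (halfLen m false) (nextRatio r))
        (.seq (.seq (quadC o sp a s m r false true false)
            (.seq (quadC o sp a s m r true false false) (quadC o sp a s m r true true false)))
          (.seq (kleeneC o sp s (a + offset m true * s + offset m true) (halfLen m true) (nextRatio r))
            (.seq (quadC o sp a s m r false true true)
              (.seq (quadC o sp a s m r true false true) (quadC o sp a s m r false false true)))))))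
termination_by m
decreasing_by all_goals simp only [halfLen, cond_true, cond_false]; omega

theorem unfolds_kleeneC {P : Program σ} {o : Kernel σ} (hP : HasGemm P o)
    (h₆ : P[6]? = some kleeneStmt) (sp s a m r : ℕ) : ∀ (ρ : List ℕ) (args : List IExpr),
    args.map (IExpr.eval ρ) = [a, s, m, r] →
      Unfolds P sp ρ (.call 6 args) (kleeneC o sp s a m r) := by
  fun_induction kleeneC o sp s a m r with
  | case1 a m r h => exact fun ρ args hρ => .call h₆ (hρ ▸ .ifTrue h (.skip ..))
  | case2 a m r h ih₁ ih₂ =>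
    have hq := unfolds_quadC hP sp a s m r []
    exact fun ρ args hρ => .call h₆ (hρ ▸ .ifFalse h (.seq (ih₁ _ _ (eval_half ..))
      (.seq (.seq (hq ..) (.seq (hq ..) (hq ..)))
        (.seq (ih₂ _ _ (eval_half ..)) (.seq (hq ..) (.seq (hq ..) (hq ..)))))))

theorem touches_of_quad {sp a s m : ℕ} {x y : Bool} {c : Comp σ}
    (h : c.Touches (fun w => Quad a s m x y w ∨ sp ≤ w) (fun w => Quad a s m x y w ∨ sp ≤ w)) :
    c.Touches (fun w => Blk a s m m w ∨ sp ≤ w) (fun w => Blk a s m m w ∨ sp ≤ w) :=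
  h.mono (fun _ => .imp Quad.blk id) (fun _ => .imp Quad.blk id)

theorem touches_kleeneC {o : Kernel σ} {sp s a m r : ℕ} (h : SqArgs sp a s m) :
    (kleeneC o sp s a m r).Touches (fun w => Blk a s m m w ∨ sp ≤ w)
      (fun w => Blk a s m m w ∨ sp ≤ w) := by
  fun_induction kleeneC o sp s a m r with
  | case1 a m r hm => exact .tick (.tick .step)
  | case2 a m r hm ih₁ ih₂ =>
    have hq := fun x y z => touches_quadC' (o := o) (r := r) h (by omega) x y z
    have i₁ := touches_of_quad (ih₁ (h.quad (by omega) _))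
    have i₂ := touches_of_quad (ih₂ (h.quad (by omega) _))
    exact .tick (.tick (.seq i₁ (.seq (.seq (hq _ _ _) (.seq (hq _ _ _) (hq _ _ _)))
      (.seq i₂ (.seq (hq _ _ _) (.seq (hq _ _ _) (hq _ _ _)))))))

theorem inScope_kleeneC {o : Kernel σ} {sp s a m r : ℕ} (h : SqArgs sp a s m) :
    (kleeneC o sp s a m r).InScope sp := by
  fun_induction kleeneC o sp s a m r with
  | case1 a m r hm => exact ⟨trivial, trivial, trivial⟩
  | case2 a m r hm ih₁ ih₂ =>
    have hq := fun x y z => inScope_quadC (o := o) (r := r) h (by omega) x y z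
    exact ⟨trivial, trivial, ih₁ (h.quad (by omega) _), ⟨hq .., hq .., hq ..⟩,
      ih₂ (h.quad (by omega) _), hq .., hq .., hq ..⟩

theorem raceFree_kleeneC {o : Kernel σ} {sp s a m r : ℕ} (h : SqArgs sp a s m) :
    (kleeneC o sp s a m r).RaceFree sp := by
  fun_induction kleeneC o sp s a m r with
  | case1 a m r hm => exact ⟨trivial, trivial, trivial⟩
  | case2 a m r hm ih₁ ih₂ =>
    have hq := fun x y z => raceFree_quadC (o := o) (r := r) h (by omega) x y z
    exact ⟨trivial, trivial, ih₁ (h.quad (by omega) _), ⟨hq .., hq .., hq ..⟩,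
      ih₂ (h.quad (by omega) _), hq .., hq .., hq ..⟩

theorem extent_kleeneC_le {o : Kernel σ} {sp s a m r : ℕ} (hr : 1 ≤ r) :
    (kleeneC o sp s a m r).extent ≤ 4 * m ^ 2 := by
  fun_induction kleeneC o sp s a m r with
  | case1 a m r hm => exact Nat.zero_le _
  | case2 a m r hm ih₁ ih₂ =>
    have hq := fun x y z => extent_quadC_le (o := o) (sp := sp) (a := a) (s := s) (m := m) hr
      (by omega) x y z
    have i₁ := (ih₁ (one_le_nextRatio hr)).trans (Nat.mul_le_mul_left 4 (Nat.pow_le_pow_left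
      ((Nat.le_add_left _ _).trans (offset_add_halfLen_le m false)) 2))
    have i₂ := (ih₂ (one_le_nextRatio hr)).trans (Nat.mul_le_mul_left 4 (Nat.pow_le_pow_left
      ((Nat.le_add_left _ _).trans (offset_add_halfLen_le m true)) 2))
    simp only [Comp.extent, Nat.zero_le, sup_of_le_right, sup_le_iff]
    exact ⟨i₁, ⟨hq .., hq .., hq ..⟩, i₂, hq .., hq .., hq ..⟩

/-- The work recurrence of algorithms with two recursive calls. -/
theorem work_halves_le {c m W₀ W₁ : ℕ} (hm : 2 ≤ m) (h₀ : W₀ ≤ c * (m / 2) ^ 3)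
    (h₁ : W₁ ≤ c * (m - m / 2) ^ 3) : 3 * (W₀ + W₁) ≤ c * m ^ 3 := by
  have h : 3 * ((m / 2) ^ 3 + (m - m / 2) ^ 3) ≤ m ^ 3 := by exact_mod_cast cube_halves_le hm
  have := Nat.mul_le_mul_left c h
  rw [mul_left_comm, mul_add c] at this
  omega

theorem work_kleeneC_le {o : Kernel σ} {sp s a m r : ℕ} (hm : 1 ≤ m) :
    (kleeneC o sp s a m r).work ≤ 450 * m ^ 3 := by
  fun_induction kleeneC o sp s a m r with
  | case1 a m r h =>
    have : 1 ≤ m ^ 3 := Nat.one_le_pow _ _ hm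
    simp only [Comp.work]
    omega
  | case2 a m r h ih₁ ih₂ =>
    have hq := fun x y z => work_quadC_le (o := o) (sp := sp) (a := a) (s := s) (m := m) (r := r)
      (by omega) x y z
    have hh := work_halves_le (by omega) (ih₁ (halfLen_bounds (by omega) false).1)
      (ih₂ (halfLen_bounds (by omega) true).1)
    have : 1 ≤ m ^ 3 := Nat.one_le_pow _ _ hm
    have := hq false true false
    have := hq true false false
    have := hq true true false
    have := hq false true true
    have := hq true false true
    have := hq false false true
    simp only [Comp.work]
    omega

theorem le_work_kleeneC {o : Kernel σ} {sp s a m r : ℕ} :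
    m ^ 3 ≤ 27 * (kleeneC o sp s a m r).work := by
  rw [kleeneC]
  split
  · have := Nat.pow_le_pow_left ‹m ≤ 1› 3
    simp only [Comp.work]
    omega
  · have := le_work_quadC (o := o) (sp := sp) (a := a) (s := s) (m := m) (r := r) (by omega)
      false true false
    simp only [Comp.work]
    omega

/-- The summand on the left is the reserve of the recurrence `span_halves_le`. The coefficient `8001
= 20³ + 1` lets the case `m = 1` provide that reserve and still pay for its own steps. -/
theorem span_kleeneC_le {o : Kernel σ} {sp s a m r : ℕ} (hm : 1 ≤ m) :
    (kleeneC o sp s a m r).span + 200 * (Nat.clog 2 m + 20) ^ 3 ≤ 200 * (8001 * m + 5 * r) := by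
  fun_induction kleeneC o sp s a m r with
  | case1 a m r h =>
    obtain rfl : m = 1 := by omega
    simp only [Comp.span, Nat.clog_one_right]
    omega
  | case2 a m r h ih₁ ih₂ =>
    have hq := fun x y z => span_quadC_le (o := o) (sp := sp) (a := a) (s := s) (m := m) (r := r)
      (by omega) x y z
    have hh := span_halves_le (by omega) (ih₁ (halfLen_bounds (by omega) false).1)
      (ih₂ (halfLen_bounds (by omega) true).1)
    have := hq false true false
    have := hq true false false
    have := hq true true false
    have := hq false true true
    have := hq true false true
    have := hq false false true
    have e : (Nat.clog 2 m + 1) ^ 3 =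
      Nat.clog 2 m ^ 3 + 3 * Nat.clog 2 m ^ 2 + 3 * Nat.clog 2 m + 1 := by ring
    simp only [Comp.span]
    omega

/-- The recursive calls cost `5/6` of the bound and the six products of a level the remaining sixth,
hence the constant `6 · 6 = 36`. Calls with `m ≤ t` are not unfolded but served as a whole. -/
theorem cheap_kleeneC {θ : ℝ} {M B t : ℕ} (hT : Tall θ M B t) {o : Kernel σ} {sp s a m r : ℕ}
    (h : SqArgs sp a s m) (hl : Level θ t r m) :
    Cheap (14 * θ ^ 4 + 36 * (40960 * θ ^ 3)) M B t r m (kleeneC o sp s a m r).trace := by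
  have hθ := hl.hθ
  have ht := hT.two_le_t
  have fits : ∀ {a m r}, SqArgs sp a s m → Level θ t r m → m ≤ t →
      Cheap (14 * θ ^ 4 + 36 * (40960 * θ ^ 3)) M B t r m (kleeneC o sp s a m r).trace :=
    fun h hl hm => (cheap_of_fits hT hl hm (by omega) (inScope_kleeneC h) (touches_kleeneC h)
      ((extent_kleeneC_le hl.hr).trans (by omega))).mono (by positivity)
        (le_add_of_nonneg_right (by positivity)) le_rfl
  by_cases hmt : m ≤ t
  · exact fits h hl hmt
  fun_induction kleeneC o sp s a m r with
  | case1 a m r hm => omega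
  | case2 a m r hm ih₁ ih₂ =>
    have hq := fun x y z => cheap_quadC hT (o := o) h hl (not_le.1 hmt) x y z
    have hx := fun x => hl.half ht (not_le.1 hmt) x
    have hs := fun x => h.quad (by omega) x
    simp only [Comp.trace, List.nil_append]
    refine Cheap.of_halves (C' := 6 * (40960 * θ ^ 3)) ?_ (by positivity) hl.hr (by omega) ?_
      ⟨_, _, ?_, (hq ..).append ((hq ..).append (hq ..)), (hq ..).append ((hq ..).append (hq ..))⟩ ?_
    · have : 0 ≤ 14 * θ ^ 4 := by positivity
      linarith
    · rcases le_or_gt (halfLen m false) t with h' | h'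
      exacts [fits (hs false) (hx false) h', ih₁ (hs false) (hx false) (not_le.2 h')]
    · linarith
    · rcases le_or_gt (halfLen m true) t with h' | h'
      exacts [fits (hs true) (hx true) h', ih₂ (hs true) (hx true) (not_le.2 h')]

/-! ### Correctness -/

theorem mem_indexBlock {n lo len : ℕ} {i : Fin n} :
    i ∈ indexBlock n lo len ↔ lo ≤ (i : ℕ) ∧ (i : ℕ) < lo + len := by simp [indexBlock]

theorem sum_indexBlock {R : Type u} [AddCommMonoid R] {n lo len : ℕ} (h : lo + len ≤ n) (g : ℕ → R) :
    ∑ k ∈ indexBlock n lo len, g k = ∑ l ∈ Finset.range len, g (lo + l) := by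
  refine (Finset.sum_bij (fun l hl => (⟨lo + l, by have := Finset.mem_range.1 hl; omega⟩ : Fin n))
    (fun l hl => ?_) (fun l _ l' _ hll => ?_) (fun k hk => ?_) fun _ _ => rfl).symm
  · have := Finset.mem_range.1 hl
    simp only [mem_indexBlock]
    omega
  · simp only [Fin.mk.injEq] at hll
    omega
  · rw [mem_indexBlock] at hk
    exact ⟨k - lo, Finset.mem_range.2 (by omega), Fin.ext (by simp only []; omega)⟩

theorem sqArgs_diagonal {sp n lo len : ℕ} (hlen : 1 ≤ len) (h : lo + len ≤ n) (hsp : n ^ 2 ≤ sp) :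
    SqArgs sp (lo * n + lo) n len := by
  refine ⟨hlen, by omega, fun x hx => ?_⟩
  rw [← zero_add (lo * n)] at hx
  have := (hx.sub (p := n) (q := n) h h).compact
  rw [sq] at hsp
  omega

theorem diagonal_quad (n lo len : ℕ) (x : Bool) :
    lo * n + lo + offset len x * n + offset len x = (lo + offset len x) * n + (lo + offset len x) := by
  ring

/-- A grid update reads only old values, and so does the multiplication with copied operands, so the
two agree even when target and source quadrants coincide. -/
theorem holds_quadC {R : Type u} [Semiring R] {I : σ → R → R → R} {o : Kernel σ}
    (ho : o.Lawful I (AddMonoidHom.id R)) (junk : ℕ → R) {sp n lo len r : ℕ} (hlen : 2 ≤ len)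
    (h : lo + len ≤ n) (hsp : n ^ 2 ≤ sp) (x y z : Bool) {m : ℕ → R} {A : Matrix (Fin n) (Fin n) R}
    (hA : Holds m 0 A) :
    Holds ((quadC o sp (lo * n + lo) n len r x y z).run I junk sp m) 0
      (gridUpdate (indexBlock n (lo + offset len x) (halfLen len x))
        (indexBlock n (lo + offset len y) (halfLen len y))
        (indexBlock n (lo + offset len z) (halfLen len z)) A) := by
  have hs := sqArgs_diagonal (by omega) h hsp (sp := sp)
  have hz := offset_add_halfLen_le len z
  intro i j
  rw [gridUpdate]
  split_ifs with hij
  · rw [mem_indexBlock, mem_indexBlock] at hij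
    obtain ⟨⟨hi₁, hi₂⟩, hj₁, hj₂⟩ := hij
    have e : 0 + (i : ℕ) * n + j = lo * n + lo + offset len x * n + offset len y +
        ((i : ℕ) - (lo + offset len x)) * n + (j - (lo + offset len y)) := by
      zify [hi₁, hj₁]
      ring
    rw [e, quadC, run_gemmC ho junk (hs.gemmArgs hlen x y z) m (by omega) (by omega), ← e, hA, AddMonoidHom.id_apply]
    congr 1
    calc _ = ∑ k ∈ indexBlock n (lo + offset len z) (halfLen len z), m (i * n + k) * m (k * n + j) := by
          rw [sum_indexBlock (by omega) fun k : ℕ => m (i * n + k) * m (k * n + j)]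
          refine Finset.sum_congr rfl fun l _ => ?_
          congr 2
          · zify [hi₁]
            ring
          · zify [hj₁]
            ring
      _ = _ := by
        refine Finset.sum_congr rfl fun k _ => ?_
        rw [← hA i k, ← hA k j, zero_add, zero_add]
  · have hn := (Blk.intro (b := 0) (s := n) i.2 j.2).compact.2
    rw [sq] at hsp
    rw [(touches_quadC hs hlen x y z).run_eq (by omega), hA]
    rintro (⟨i', hi', j', hj', e⟩ | hw)
    · have hy := offset_add_halfLen_le len y
      have := index_unique (s := n) (i := i) (j := j) (i' := lo + offset len x + i')
        (j' := lo + offset len y + j') j.2 (by omega) (by linarith)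
      rw [mem_indexBlock, mem_indexBlock] at hij
      omega
    · omega

theorem holds_kleeneC {R : Type u} [Semiring R] {I : σ → R → R → R} {o : Kernel σ}
    (ho : o.Lawful I (AddMonoidHom.id R)) (junk : ℕ → R) {sp n : ℕ} (hsp : n ^ 2 ≤ sp) (len : ℕ) :
    ∀ {lo r : ℕ} {m : ℕ → R} {A : Matrix (Fin n) (Fin n) R}, lo + len ≤ n → Holds m 0 A →
      Holds ((kleeneC o sp n (lo * n + lo) len r).run I junk sp m) 0 (kleene lo len A) := by
  induction len using Nat.strong_induction_on with
  | _ len ih =>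
    intro lo r m A h hA
    rw [kleeneC, kleene]
    by_cases hlen : len ≤ 1
    · rw [if_pos hlen, dif_pos hlen]
      exact hA
    rw [if_neg hlen, dif_neg hlen, diagonal_quad, diagonal_quad]
    have hq := fun x y z => @holds_quadC _ R _ I o ho junk sp n lo len r (by omega) h hsp x y z
    have i₁ := @ih (len / 2) (by omega) lo (nextRatio r) _ _ (by omega) hA
    have i₂ := hq true true false (hq true false false (hq false true false i₁))
    have i₃ := @ih (len - len / 2) (by omega) (lo + len / 2) (nextRatio r) _ _ (by omega) i₂
    exact hq false false true (hq true false true (hq false true true i₃))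

/-! ### The program for Kleene's algorithm and its costs. -/

def semiringKernel : Kernel SemiringOp := ⟨.zero, .copy, .add, .add, .mul⟩

theorem semiringKernel_lawful {R : Type u} [Semiring R] :
    semiringKernel.Lawful SemiringOp.interp (AddMonoidHom.id R) :=
  ⟨fun _ _ => rfl, fun _ _ => rfl, fun _ _ => rfl, fun _ _ => rfl, fun _ _ => rfl⟩

/-- The program for Kleene's algorithm. -/
def kleeneProgram : Program SemiringOp :=
  [mainStmt 7, mapStmt 1 .zero, mapStmt 2 .add, mapStmt 3 .copy, mmStmt semiringKernel, gemmStmt,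
    kleeneStmt, searchStmt 7 (.call 6 [0, reg 0, reg 0, reg 2])]

theorem generates_kleeneProgram : Generates kleeneProgram (fun n => n ^ 2) fun n w =>
    .tick (searchC (fun r => kleeneC semiringKernel (n ^ 2) n 0 n r) n w 1) :=
  generates_mainC (body := fun n r => kleeneC semiringKernel (n ^ 2) n 0 n r) rfl rfl
    fun _ _ _ => unfolds_kleeneC ⟨⟨rfl, rfl, rfl⟩, rfl, rfl⟩ rfl _ _ _ _ _ _ _ rfl

theorem sqArgs_whole {n : ℕ} (hn : 1 ≤ n) : SqArgs (n ^ 2) 0 n n := by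
  simpa using sqArgs_diagonal (lo := 0) hn (by omega) le_rfl

theorem efficient_kleeneC : Efficient (fun n => n ^ 2) fun n r =>
    kleeneC semiringKernel (n ^ 2) n 0 n r where
  inScope _ _ hn _ := inScope_kleeneC (sqArgs_whole hn)
  raceFree _ _ hn _ := raceFree_kleeneC (sqArgs_whole hn)
  work_le := ⟨450, fun _ _ hn _ => work_kleeneC_le hn⟩
  le_work := ⟨27, fun _ _ _ _ => le_work_kleeneC⟩
  span_le := ⟨200 * 8001, fun _ _ hn _ =>
    (Nat.le_add_right _ _).trans ((span_kleeneC_le hn).trans (by omega))⟩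
  cheap θ hθ := ⟨14 * θ ^ 4 + 36 * (40960 * θ ^ 3), by positivity, fun _ _ _ _ _ hT hl =>
    cheap_kleeneC hT (sqArgs_whole hl.hm) hl⟩

/-! ## Shortest paths -/

section ShortestPaths

variable {n : ℕ}

/-- Tropical sums are finite minima and are attained; this makes each grid update a case distinction
between keeping an entry and taking one detour. -/
theorem isLeast_add_sum {ι : Type} [DecidableEq ι] (c : Tropical (WithTop ℝ))
    (f : ι → Tropical (WithTop ℝ)) (K : Finset ι) :
    IsLeast {x | x = c ∨ ∃ k ∈ K, x = f k} (c + ∑ k ∈ K, f k) := by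
  induction K using Finset.induction_on with
  | empty => simp [IsLeast, lowerBounds]
  | insert a K ha ih =>
    rw [Finset.sum_insert ha, add_left_comm]
    rcases le_total (f a) (c + ∑ k ∈ K, f k) with h | h
    · rw [Tropical.add_eq_left h]
      refine ⟨.inr ⟨a, Finset.mem_insert_self _ _, rfl⟩, ?_⟩
      rintro x (rfl | ⟨k, hk, rfl⟩)
      · exact h.trans (ih.2 (.inl rfl))
      · rcases Finset.mem_insert.1 hk with rfl | hk
        exacts [le_rfl, h.trans (ih.2 (.inr ⟨k, hk, rfl⟩))]
    · rw [Tropical.add_eq_right h]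
      refine ⟨ih.1.imp id fun ⟨k, hk, e⟩ => ⟨k, Finset.mem_insert_of_mem hk, e⟩, ?_⟩
      rintro x (rfl | ⟨k, hk, rfl⟩)
      · exact ih.2 (.inl rfl)
      · rcases Finset.mem_insert.1 hk with rfl | hk
        exacts [h, ih.2 (.inr ⟨k, hk, rfl⟩)]

variable {I J K : Finset (Fin n)} {A : Matrix (Fin n) (Fin n) (Tropical (WithTop ℝ))} {i j k : Fin n}

theorem gridUpdate_of_notMem (h : ¬ (i ∈ I ∧ j ∈ J)) : gridUpdate I J K A i j = A i j := if_neg h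

theorem gridUpdate_le : gridUpdate I J K A i j ≤ A i j := by
  rw [gridUpdate]
  split_ifs
  exacts [(isLeast_add_sum (A i j) _ K).2 (.inl rfl), le_rfl]

theorem gridUpdate_le_mul (hi : i ∈ I) (hj : j ∈ J) (hk : k ∈ K) :
    gridUpdate I J K A i j ≤ A i k * A k j := by
  rw [gridUpdate, if_pos ⟨hi, hj⟩]
  exact (isLeast_add_sum (A i j) (fun k => A i k * A k j) K).2 (.inr ⟨k, hk, rfl⟩)

theorem gridUpdate_eq (I J K : Finset (Fin n)) (A : Matrix (Fin n) (Fin n) (Tropical (WithTop ℝ)))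
    (i j : Fin n) :
    gridUpdate I J K A i j = A i j ∨ ∃ k ∈ K, gridUpdate I J K A i j = A i k * A k j := by
  rw [gridUpdate]
  split_ifs
  exacts [(isLeast_add_sum (A i j) (fun k => A i k * A k j) K).1, .inl rfl]

theorem kleene_le {lo len : ℕ} : kleene lo len A i j ≤ A i j := by
  fun_induction kleene lo len A with
  | case1 => exact le_rfl
  | case2 lo len A h I₀ I₁ A₁ A₂ A₃ A₄ A₅ A₆ A₇ ih₁ ih₂ =>
    refine gridUpdate_le.trans (gridUpdate_le.trans (gridUpdate_le.trans (ih₂.trans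
      (gridUpdate_le.trans (gridUpdate_le.trans (gridUpdate_le.trans ih₁))))))

theorem kleene_of_notMem {lo len : ℕ} (h : ¬ (i ∈ indexBlock n lo len ∧ j ∈ indexBlock n lo len)) :
    kleene lo len A i j = A i j := by
  simp only [mem_indexBlock] at h
  fun_induction kleene lo len A with
  | case1 => rfl
  | case2 lo len A _ I₀ I₁ A₁ A₂ A₃ A₄ A₅ A₆ A₇ ih₁ ih₂ =>
    have h₁ := ih₁ (by omega)
    have h₂ := ih₂ (by omega)
    have e : ∀ {I J K A}, (I = I₀ ∨ I = I₁) → (J = I₀ ∨ J = I₁) → gridUpdate I J K A i j =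
        (A i j : Tropical (WithTop ℝ)) := fun hI hJ => gridUpdate_of_notMem (by
      rcases hI with rfl | rfl <;> rcases hJ with rfl | rfl <;>
        simp only [I₀, I₁, mem_indexBlock] <;> omega)
    exact (e (.inl rfl) (.inl rfl)).trans ((e (.inr rfl) (.inl rfl)).trans
      ((e (.inl rfl) (.inr rfl)).trans (h₂.trans ((e (.inr rfl) (.inr rfl)).trans
        ((e (.inr rfl) (.inl rfl)).trans ((e (.inl rfl) (.inr rfl)).trans h₁))))))

theorem WalkWeight.append {e : Fin n → Fin n → WithTop ℝ} {x y : WithTop ℝ} (h : WalkWeight e i k x)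
    (h' : WalkWeight e k j y) : WalkWeight e i j (x + y) := by
  induction h with
  | nil i => rwa [zero_add]
  | cons i h ih => exact add_assoc (e i _) _ y ▸ .cons i (ih h')

/-- The entries are weights of walks. -/
def Attained (e : Fin n → Fin n → WithTop ℝ) (A : Matrix (Fin n) (Fin n) (Tropical (WithTop ℝ))) :
    Prop := ∀ i j, WalkWeight e i j (Tropical.untrop (A i j))

theorem attained_distInit (e : Fin n → Fin n → WithTop ℝ) : Attained e (distInit e) := by
  intro i j
  rw [distInit, Tropical.untrop_trop]
  split_ifs with h
  · exact h ▸ .nil i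
  · exact add_zero (e i j) ▸ .cons i (.nil j)

variable {e : Fin n → Fin n → WithTop ℝ}

theorem Attained.gridUpdate (h : Attained e A) : Attained e (gridUpdate I J K A) := by
  intro i j
  rcases gridUpdate_eq I J K A i j with e | ⟨k, -, e⟩
  · exact e ▸ h i j
  · exact e ▸ (h i k).append (h k j)

theorem Attained.kleene {lo len : ℕ} (h : Attained e A) : Attained e (kleene lo len A) := by
  fun_induction _root_.kleene lo len A with
  | case1 => exact h
  | case2 lo len A _ I₀ I₁ A₁ A₂ A₃ A₄ A₅ A₆ A₇ ih₁ ih₂ =>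
    exact (ih₂ (ih₁ h).gridUpdate.gridUpdate.gridUpdate).gridUpdate.gridUpdate.gridUpdate

/-- The triangle inequality, tropical products being sums of weights. Write `P, Q, S, V` for the
quadrants `00, 01, 10, 11`. The recursive calls close `P` and `V`. A relation such as `Q ≤ P Q` is
proved by expanding a factor that was itself obtained through a detour and moving the detour to a
quadrant that is already closed. The final case distinction over the halves of `i, k, j` combines
these relations. -/
theorem kleene_le_mul (he : NoNegativeCycle e) {lo len : ℕ} (hA : Attained e A) :
    ∀ i ∈ indexBlock n lo len, ∀ k ∈ indexBlock n lo len, ∀ j ∈ indexBlock n lo len,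
      kleene lo len A i j ≤ kleene lo len A i k * kleene lo len A k j := by
  fun_induction kleene lo len A with
  | case1 lo len A h =>
    intro i hi k hk j hj
    rw [mem_indexBlock] at hi hk hj
    obtain rfl : i = j := Fin.ext (by omega)
    obtain rfl : k = i := Fin.ext (by omega)
    -- On one vertex the claim says that the diagonal weight is nonnegative. The entry is the weight
    -- of a closed walk, and this is the only place in the induction where negative cycles are
    -- excluded.
    exact le_mul_of_one_le_right' (he k _ (hA k k))
  | case2 lo len A h I₀ I₁ A₁ A₂ A₃ A₄ A₅ A₆ A₇ ih₁ ih₂ =>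
    have n₀ : ∀ {i}, i ∈ I₀ → i ∉ I₁ := fun hi hi' => by
      simp only [I₀, I₁, mem_indexBlock] at hi hi'
      omega
    have n₁ : ∀ {i}, i ∈ I₁ → i ∉ I₀ := fun hi hi' => n₀ hi' hi
    have tP := ih₁ hA
    have tV := ih₂ hA.kleene.gridUpdate.gridUpdate.gridUpdate
    have e₂ : ∀ {i j}, i ∈ I₀ → j ∈ I₀ → A₂ i j = A₁ i j := fun hi hj =>
      gridUpdate_of_notMem fun hh => n₀ hj hh.2
    have e₃ : ∀ {i j}, i ∈ I₀ → A₃ i j = A₂ i j := fun hi =>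
      gridUpdate_of_notMem fun hh => n₀ hi hh.1
    have e₄ : ∀ {i j}, i ∈ I₀ ∨ j ∈ I₀ → A₄ i j = A₃ i j := fun hi =>
      gridUpdate_of_notMem fun hh => hi.elim (fun h => n₀ h hh.1) (fun h => n₀ h hh.2)
    have e₅ : ∀ {i j}, i ∈ I₀ ∨ j ∈ I₀ → A₅ i j = A₄ i j := fun hi =>
      kleene_of_notMem fun hh => hi.elim (fun h => n₀ h hh.1) (fun h => n₀ h hh.2)
    have e₆ : ∀ {i j}, i ∈ I₁ ∨ j ∈ I₀ → A₆ i j = A₅ i j := fun hi =>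
      gridUpdate_of_notMem fun hh => hi.elim (fun h => n₁ h hh.1) (fun h => n₀ h hh.2)
    have e₇ : ∀ {i j}, i ∈ I₀ ∨ j ∈ I₁ → A₇ i j = A₆ i j := fun hi =>
      gridUpdate_of_notMem fun hh => hi.elim (fun h => n₀ h hh.1) (fun h => n₁ h hh.2)
    have e₈ : ∀ {i j}, i ∈ I₁ ∨ j ∈ I₁ → gridUpdate I₀ I₀ I₁ A₇ i j = A₇ i j := fun hi =>
      gridUpdate_of_notMem fun hh => hi.elim (fun h => n₁ h hh.1) (fun h => n₁ h hh.2)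
    -- the updates of the first half
    have PQ : ∀ i ∈ I₀, ∀ k ∈ I₀, ∀ j ∈ I₁, A₂ i j ≤ A₁ i k * A₂ k j := by
      intro i hi k hk j hj
      rcases gridUpdate_eq I₀ I₁ I₀ A₁ k j with e | ⟨l, hl, e⟩
      · exact (gridUpdate_le_mul hi hj hk).trans_eq (by rw [← e])
      · calc A₂ i j ≤ A₁ i l * A₁ l j := gridUpdate_le_mul hi hj hl
          _ ≤ A₁ i k * A₁ k l * A₁ l j := mul_le_mul_left (tP i hi k hk l hl) _
          _ = _ := by rw [mul_assoc, ← e]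
    have SP : ∀ i ∈ I₁, ∀ k ∈ I₀, ∀ j ∈ I₀, A₃ i j ≤ A₃ i k * A₁ k j := by
      intro i hi k hk j hj
      rcases gridUpdate_eq I₁ I₀ I₀ A₂ i k with e | ⟨l, hl, e⟩
      · exact (gridUpdate_le_mul hi hj hk).trans_eq (by rw [← e, e₂ hk hj])
      · calc A₃ i j ≤ A₂ i l * A₂ l j := gridUpdate_le_mul hi hj hl
          _ = A₂ i l * A₁ l j := by rw [e₂ hl hj]
          _ ≤ A₂ i l * (A₁ l k * A₁ k j) := mul_le_mul_right (tP l hl k hk j hj) _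
          _ = _ := by rw [← mul_assoc, ← e₂ hl hk, ← e]
    have SQ : ∀ i ∈ I₁, ∀ k ∈ I₀, ∀ j ∈ I₁, A₅ i j ≤ A₃ i k * A₂ k j := by
      intro i hi k hk j hj
      exact kleene_le.trans ((gridUpdate_le_mul hi hj hk).trans_eq (by rw [e₃ hk]))
    -- the updates of the second half
    have cQ : ∀ i ∈ I₀, ∀ j ∈ I₁, A₆ i j = A₂ i j ∨ ∃ l ∈ I₁, A₆ i j = A₂ i l * A₅ l j := by
      intro i hi j hj
      rcases gridUpdate_eq I₀ I₁ I₁ A₅ i j with e | ⟨l, hl, e⟩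
      · exact .inl (e.trans (by rw [e₅ (.inl hi), e₄ (.inl hi), e₃ hi]))
      · exact .inr ⟨l, hl, e.trans (by rw [e₅ (.inl hi), e₄ (.inl hi), e₃ hi])⟩
    have Q₆ : ∀ {i j}, i ∈ I₀ → A₆ i j ≤ A₂ i j := fun hi =>
      gridUpdate_le.trans_eq (by rw [e₅ (.inl hi), e₄ (.inl hi), e₃ hi])
    have QV₆ : ∀ {i k j}, i ∈ I₀ → k ∈ I₁ → j ∈ I₁ → A₆ i j ≤ A₂ i k * A₅ k j := fun hi hk hj =>
      (gridUpdate_le_mul hi hj hk).trans_eq (by rw [e₅ (.inl hi), e₄ (.inl hi), e₃ hi])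
    have cS : ∀ i ∈ I₁, ∀ j ∈ I₀, A₇ i j = A₃ i j ∨ ∃ l ∈ I₁, A₇ i j = A₅ i l * A₃ l j := by
      intro i hi j hj
      rcases gridUpdate_eq I₁ I₀ I₁ A₆ i j with e | ⟨l, hl, e⟩
      · exact .inl (e.trans (by rw [e₆ (.inl hi), e₅ (.inr hj), e₄ (.inr hj)]))
      · exact .inr ⟨l, hl, e.trans (by
          rw [e₆ (.inl hi), e₆ (.inl hl), e₅ (j := j) (.inr hj), e₄ (.inr hj)])⟩
    have S₇ : ∀ {i j}, i ∈ I₁ → j ∈ I₀ → A₇ i j ≤ A₃ i j := fun hi hj =>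
      gridUpdate_le.trans_eq (by rw [e₆ (.inl hi), e₅ (.inr hj), e₄ (.inr hj)])
    have VS₇ : ∀ {i k j}, i ∈ I₁ → k ∈ I₁ → j ∈ I₀ → A₇ i j ≤ A₅ i k * A₃ k j := fun {i k j} hi hk hj =>
      (gridUpdate_le_mul hi hj hk).trans_eq (by
        rw [e₆ (.inl hi), e₆ (.inl hk), e₅ (j := j) (.inr hj), e₄ (.inr hj)])
    have P₇ : ∀ {i j}, i ∈ I₀ → j ∈ I₀ → A₇ i j = A₁ i j := fun hi hj => by
      rw [e₇ (.inl hi), e₆ (.inr hj), e₅ (.inl hi), e₄ (.inl hi), e₃ hi, e₂ hi hj]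
    have PQ' : ∀ i ∈ I₀, ∀ k ∈ I₀, ∀ j ∈ I₁, A₆ i j ≤ A₁ i k * A₆ k j := by
      intro i hi k hk j hj
      rcases cQ k hk j hj with e | ⟨l, hl, e⟩
      · exact e ▸ (Q₆ hi).trans (PQ i hi k hk j hj)
      · rw [e, ← mul_assoc]
        exact (QV₆ hi hl hj).trans (mul_le_mul_left (PQ i hi k hk l hl) _)
    have SP' : ∀ i ∈ I₁, ∀ k ∈ I₀, ∀ j ∈ I₀, A₇ i j ≤ A₇ i k * A₁ k j := by
      intro i hi k hk j hj
      rcases cS i hi k hk with e | ⟨l, hl, e⟩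
      · exact e ▸ (S₇ hi hj).trans (SP i hi k hk j hj)
      · rw [e, mul_assoc]
        exact (VS₇ hi hl hj).trans (mul_le_mul_right (SP l hl k hk j hj) _)
    have QV' : ∀ i ∈ I₀, ∀ k ∈ I₁, ∀ j ∈ I₁, A₆ i j ≤ A₆ i k * A₅ k j := by
      intro i hi k hk j hj
      rcases cQ i hi k hk with e | ⟨l, hl, e⟩
      · exact e ▸ QV₆ hi hk hj
      · rw [e, mul_assoc]
        exact (QV₆ hi hl hj).trans (mul_le_mul_right (tV l hl k hk j hj) _)
    have VS' : ∀ i ∈ I₁, ∀ k ∈ I₁, ∀ j ∈ I₀, A₇ i j ≤ A₅ i k * A₇ k j := by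
      intro i hi k hk j hj
      rcases cS k hk j hj with e | ⟨l, hl, e⟩
      · exact e ▸ VS₇ hi hk hj
      · rw [e, ← mul_assoc]
        exact (VS₇ hi hl hj).trans (mul_le_mul_left (tV i hi k hk l hl) _)
    have SQ' : ∀ i ∈ I₁, ∀ k ∈ I₀, ∀ j ∈ I₁, A₅ i j ≤ A₇ i k * A₆ k j := by
      intro i hi k hk j hj
      have hh : ∀ i ∈ I₁, A₅ i j ≤ A₃ i k * A₆ k j := fun i hi => by
        rcases cQ k hk j hj with e | ⟨l, hl, e⟩
        · exact e ▸ SQ i hi k hk j hj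
        · rw [e, ← mul_assoc]
          exact (tV i hi l hl j hj).trans (mul_le_mul_left (SQ i hi k hk l hl) _)
      rcases cS i hi k hk with e | ⟨l, hl, e⟩
      · exact e ▸ hh i hi
      · rw [e, mul_assoc]
        exact (tV i hi l hl j hj).trans (mul_le_mul_right (hh l hl) _)
    -- the triangle inequality
    set D := gridUpdate I₀ I₀ I₁ A₇
    have dQ : ∀ {i j}, i ∈ I₀ → j ∈ I₁ → D i j = A₆ i j := fun hi hj => by
      rw [e₈ (.inr hj), e₇ (.inl hi)]
    have dS : ∀ {i j}, i ∈ I₁ → D i j = A₇ i j := fun hi => e₈ (.inl hi)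
    have dV : ∀ {i j}, i ∈ I₁ → j ∈ I₁ → D i j = A₅ i j := fun hi hj => by
      rw [e₈ (.inl hi), e₇ (.inr hj), e₆ (.inl hi)]
    have dP : ∀ {i j}, i ∈ I₀ → j ∈ I₀ → D i j ≤ A₁ i j := fun hi hj =>
      gridUpdate_le.trans_eq (P₇ hi hj)
    have dQS : ∀ {i k j}, i ∈ I₀ → k ∈ I₁ → j ∈ I₀ → D i j ≤ A₆ i k * A₇ k j := fun hi hk hj =>
      (gridUpdate_le_mul hi hj hk).trans_eq (by rw [e₇ (.inl hi)])
    have cP : ∀ i ∈ I₀, ∀ j ∈ I₀, D i j = A₁ i j ∨ ∃ l ∈ I₁, D i j = A₆ i l * A₇ l j := by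
      intro i hi j hj
      rcases gridUpdate_eq I₀ I₀ I₁ A₇ i j with e | ⟨l, hl, e⟩
      · exact .inl (e.trans (P₇ hi hj))
      · exact .inr ⟨l, hl, e.trans (by rw [e₇ (.inl hi)])⟩
    have mem : ∀ i ∈ indexBlock n lo len, i ∈ I₀ ∨ i ∈ I₁ := fun i hi => by
      simp only [I₀, I₁, mem_indexBlock] at hi ⊢
      omega
    intro i hi k hk j hj
    rcases mem i hi with hi | hi <;> rcases mem k hk with hk | hk <;> rcases mem j hj with hj | hj
    · rcases cP i hi k hk with e | ⟨l, hl, e⟩ <;> rcases cP k hk j hj with e' | ⟨l', hl', e'⟩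
      · exact e ▸ e' ▸ (dP hi hj).trans (tP i hi k hk j hj)
      · rw [e, e', ← mul_assoc]
        exact (dQS hi hl' hj).trans (mul_le_mul_left (PQ' i hi k hk l' hl') _)
      · rw [e, e', mul_assoc]
        exact (dQS hi hl hj).trans (mul_le_mul_right (SP' l hl k hk j hj) _)
      -- Two detours, through `l` and through `l'`. The middle part `l → k → l'` is shortened inside
      -- `V`, and what remains is a single detour through `l`.
      · rw [e, e', mul_assoc]
        refine (dQS hi hl hj).trans (mul_le_mul_right ?_ _)
        rw [← mul_assoc]
        exact (VS' l hl l' hl' j hj).trans (mul_le_mul_left (SQ' l hl k hk l' hl') _)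
    · rw [dQ hi hj, dQ hk hj]
      rcases cP i hi k hk with e | ⟨l, hl, e⟩
      · exact e ▸ PQ' i hi k hk j hj
      · rw [e, mul_assoc]
        exact (QV' i hi l hl j hj).trans (mul_le_mul_right (SQ' l hl k hk j hj) _)
    · exact dQ hi hk ▸ dS hk ▸ dQS hi hk hj
    · exact dQ hi hj ▸ dQ hi hk ▸ dV hk hj ▸ QV' i hi k hk j hj
    · rw [dS hi, dS hi]
      rcases cP k hk j hj with e | ⟨l, hl, e⟩
      · exact e ▸ SP' i hi k hk j hj
      · rw [e, ← mul_assoc]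
        exact (VS' i hi l hl j hj).trans (mul_le_mul_left (SQ' i hi k hk l hl) _)
    · rw [dV hi hj, dS hi, dQ hk hj]
      exact SQ' i hi k hk j hj
    · rw [dS hi, dV hi hk, dS hk]
      exact VS' i hi k hk j hj
    · rw [dV hi hj, dV hi hk, dV hk hj]
      exact tV i hi k hk j hj

/-- Entries are weights of walks, so they are attained. Conversely, entries are bounded by the edges
and the diagonal by `0`, so the triangle inequality bounds them by the weight of any walk, by
induction on the walk. -/
theorem isLeast_kleene (he : NoNegativeCycle e) (i j : Fin n) :
    IsLeast {x | WalkWeight e i j x} (Tropical.untrop (kleene 0 n (distInit e) i j)) := by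
  refine ⟨(attained_distInit e).kleene i j, fun x hx => ?_⟩
  have all : ∀ i : Fin n, i ∈ indexBlock n 0 n := fun i => by
    have := i.2
    rw [mem_indexBlock]
    omega
  induction hx with
  | nil i =>
    have h : kleene 0 n (distInit e) i i ≤ distInit e i i := kleene_le
    rw [distInit, if_pos rfl] at h
    exact h
  | @cons i k j x hx ih =>
    have h₁ : kleene 0 n (distInit e) i k ≤ Tropical.trop (e i k) := by
      refine kleene_le.trans ?_
      rw [distInit]
      split_ifs with h
      · subst h
        -- A loop was replaced by `0` on the diagonal, which is no larger because the loop is itself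
        -- a cycle.
        exact he i _ (add_zero (e i i) ▸ .cons i (.nil i))
      · exact le_rfl
    have h₂ : kleene 0 n (distInit e) k j ≤ Tropical.trop x := ih
    exact (kleene_le_mul he (attained_distInit e) i (all i) k (all k) j (all j)).trans
      (mul_le_mul' h₁ h₂)

end ShortestPaths

theorem holds_kleeneProgram {R : Type u} [Semiring R] {n w : ℕ} {A : Matrix (Fin n) (Fin n) R}
    {m : ℕ → R} (junk : ℕ → R) (hn : 1 ≤ n) (hw : 1 ≤ w) (hA : Holds m 0 A) :
    Holds ((Comp.tick (searchC (fun r => kleeneC semiringKernel (n ^ 2) n 0 n r) n w 1)).run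
      SemiringOp.interp junk (n ^ 2) m) 0 (kleene 0 n A) := by
  obtain ⟨j, r, -, -, e⟩ := exists_tick_eq (fun n r => kleeneC semiringKernel (n ^ 2) n 0 n r) hn hw
  rw [e, run_iterate_tick]
  simpa using holds_kleeneC semiringKernel_lawful junk le_rfl n (lo := 0) (r := r) (by omega) hA

theorem computesKleene_kleeneProgram : ComputesKleene.{u} fun n w =>
    .tick (searchC (fun r => kleeneC semiringKernel (n ^ 2) n 0 n r) n w 1) :=
  ⟨fun _ _ _ _ _ _ junk hn hw hA => holds_kleeneProgram junk hn hw hA,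
    fun _ _ _ _ junk hn hw he hA => ⟨_, isLeast_kleene he,
      holds_kleeneProgram junk hn hw hA⟩⟩

/-! ## Inverses of triangular matrices -/

def fieldKernel : Kernel FieldOp := ⟨.zero, .copy, .add, .sub, .mul⟩

theorem fieldKernel_lawful {K : Type u} [Field K] :
    fieldKernel.Lawful FieldOp.interp (negAddMonoidHom : K →+ K) :=
  ⟨fun _ _ => rfl, fun _ _ => rfl, fun _ _ => rfl, fun x y => sub_eq_add_neg x y, fun _ _ => rfl⟩

/-- Replace the lower triangular `m × m` block `V` at `v` with row stride `s` by `1 - V⁻¹`. The entries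
above the diagonal are taken to be `0`, those on it to be `1` unless `u = 0`. The registers hold
`v, s, m, r, u`. -/
def invStmt : Stmt FieldOp :=
  .ifLe (reg 2) 1
    (.ifLe (reg 4) 0
      (.alloc 1 (.seq (.op .one (reg 0) (reg 1) (reg 1))
        (.seq (.op .div (reg 1) (reg 0) (reg 1)) (.op .sub (reg 1) (reg 0) (reg 1)))))
      (.op .zero (reg 0) (reg 0) (reg 0)))
    (.seq (.fork (halfStmt 6 false [reg 4]) (halfStmt 6 true [reg 4]))
      (.seq (.call 1 [reg 0 + reg 2 / 2, reg 1, reg 0 + reg 2 / 2, reg 1, 1, reg 2 / 2,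
          reg 2 - reg 2 / 2])
        (.seq (quadStmt true false true) (quadStmt true false false))))

/-- The computation of `invStmt`. -/
def invC (sp s u v m r : ℕ) : Comp FieldOp :=
  if m ≤ 1 then
    if u ≤ 0 then
      .tick (.tick (.tick (.alloc 1 (.seq (.op .one sp v v)
        (.seq (.op .div v sp v) (.op .sub v sp v))))))
    else .tick (.tick (.tick (.op .zero v v v)))
  else
    .tick (.tick
      (.seq (.fork
          (invC sp s u (v + offset m false * s + offset m false) (halfLen m false) (nextRatio r))
          (invC sp s u (v + offset m true * s + offset m true) (halfLen m true) (nextRatio r)))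
        (.seq (mapC .zero s s 1 (v + m / 2) (v + m / 2) (m / 2) (m - m / 2))
          (.seq (quadC fieldKernel sp v s m r true false true)
            (quadC fieldKernel sp v s m r true false false)))))
termination_by m
decreasing_by all_goals simp only [halfLen, cond_true, cond_false]; omega

/-- The procedures that the algorithms over fields share. -/
structure HasInv (P : Program FieldOp) : Prop extends HasGemm P fieldKernel where
  inv : P[6]? = some invStmt

theorem unfolds_invC {P : Program FieldOp} (hP : HasInv P) (sp s u v m r : ℕ) :
    ∀ (ρ : List ℕ) (args : List IExpr), args.map (IExpr.eval ρ) = [v, s, m, r, u] →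
      Unfolds P sp ρ (.call 6 args) (invC sp s u v m r) := by
  have half : ∀ (x : Bool) (v m r : ℕ),
      [reg 0 + offsetE (reg 2) x * reg 1 + offsetE (reg 2) x, reg 1, halfLenE (reg 2) x,
        nextRatioE (reg 3), reg 4].map (IExpr.eval [v, s, m, r, u]) =
      [v + offset m x * s + offset m x, s, halfLen m x, nextRatio r, u] := by
    intro x v m r
    cases x <;> rfl
  fun_induction invC sp s u v m r with
  | case1 v m r h h' =>
    exact fun ρ args hρ => .call hP.inv (hρ ▸ .ifTrue h (.ifTrue h'
      (.alloc (.seq (.op ..) (.seq (.op ..) (.op ..))))))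
  | case2 v m r h h' =>
    exact fun ρ args hρ => .call hP.inv (hρ ▸ .ifTrue h (.ifFalse h' (.op ..)))
  | case3 v m r h ih₁ ih₂ =>
    have hq := unfolds_quadC hP.toHasGemm sp v s m r [u]
    exact fun ρ args hρ => .call hP.inv (hρ ▸ .ifFalse h (.seq (.fork (ih₁ _ _ (half ..))
      (ih₂ _ _ (half ..))) (.seq (unfolds_mapC hP.zero _ _ _ _ _ _ _ _ _ _ rfl)
        (.seq (hq ..) (hq ..)))))

theorem touches_zero {sp v s m : ℕ} (hm : 2 ≤ m) :
    (mapC FieldOp.zero s s 1 (v + m / 2) (v + m / 2) (m / 2) (m - m / 2)).Touches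
      (fun w => Quad v s m false true w ∨ sp ≤ w) (fun w => Quad v s m false true w ∨ sp ≤ w) := by
  have h : ∀ i < m / 2, ∀ j < m - m / 2, Quad v s m false true (v + m / 2 + i * s + j) := by
    intro i hi j hj
    refine ⟨i, hi, j, hj, ?_⟩
    simp [offset]
  refine touches_mapC (by omega) (by omega) (fun i hi j hj => .inl (h i hi j hj))
    fun i hi j hj => ⟨.inl (h i hi j hj), ?_⟩
  rw [mul_one]
  exact .inl (h i hi j hj)

theorem touches_invC {sp s u v m r : ℕ} (h : SqArgs sp v s m) :
    (invC sp s u v m r).Touches (fun w => Blk v s m m w ∨ sp ≤ w)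
      (fun w => Blk v s m m w ∨ sp ≤ w) := by
  fun_induction invC sp s u v m r with
  | case1 v m r hm hu =>
    have hv : Blk v s m m v := ⟨0, h.hm, 0, h.hm, by simp⟩
    exact .tick (.tick (.tick (.alloc (.seq (.op (.inr le_rfl) (.inl hv) (.inl hv))
      (.seq (.op (.inl hv) (.inr le_rfl) (.inl hv)) (.op (.inl hv) (.inr le_rfl) (.inl hv)))))))
  | case2 v m r hm hu =>
    have hv : Blk v s m m v := ⟨0, h.hm, 0, h.hm, by simp⟩
    exact .tick (.tick (.tick (.op (.inl hv) (.inl hv) (.inl hv))))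
  | case3 v m r hm ih₁ ih₂ =>
    have hq := fun x y z => touches_quadC' (o := fieldKernel) (r := r) h (by omega) x y z
    have i₁ := touches_of_quad (ih₁ (h.quad (by omega) _))
    have i₂ := touches_of_quad (ih₂ (h.quad (by omega) _))
    exact .tick (.tick (.seq (.fork i₁ i₂) (.seq (touches_of_quad (touches_zero (by omega)))
      (.seq (hq _ _ _) (hq _ _ _)))))

theorem inScope_zero {sp v s m : ℕ} (h : SqArgs sp v s m) (hm : 2 ≤ m) :
    (mapC FieldOp.zero s s 1 (v + m / 2) (v + m / 2) (m / 2) (m - m / 2)).InScope sp := by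
  refine inScope_mapC (by omega) (by omega) fun i hi j hj => ?_
  have : v + m / 2 + i * s + j < sp := h.hA _ (Quad.blk (y := false) (z := true) ⟨i, hi, j, hj, by
    simp [offset]⟩)
  omega

theorem inScope_invC {sp s u v m r : ℕ} (h : SqArgs sp v s m) : (invC sp s u v m r).InScope sp := by
  fun_induction invC sp s u v m r with
  | case1 v m r hm hu =>
    have hv : v < sp := h.hA _ ⟨0, h.hm, 0, h.hm, by simp⟩
    simp only [Comp.InScope, true_and]
    omega
  | case2 v m r hm hu =>
    have hv : v < sp := h.hA _ ⟨0, h.hm, 0, h.hm, by simp⟩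
    exact ⟨trivial, trivial, trivial, hv, hv, hv⟩
  | case3 v m r hm ih₁ ih₂ =>
    have hq := fun x y z => inScope_quadC (o := fieldKernel) (r := r) h (by omega) x y z
    exact ⟨trivial, trivial, ⟨ih₁ (h.quad (by omega) _), ih₂ (h.quad (by omega) _)⟩,
      inScope_zero h (by omega), hq .., hq ..⟩

/-- The forked calls touch only the two diagonal quadrants, which are disjoint. -/
theorem raceFree_invC {sp s u v m r : ℕ} (h : SqArgs sp v s m) : (invC sp s u v m r).RaceFree sp := by
  fun_induction invC sp s u v m r with
  | case1 v m r hm hu => exact ⟨trivial, trivial, trivial, trivial, trivial, trivial⟩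
  | case2 v m r hm hu => exact ⟨trivial, trivial, trivial, trivial⟩
  | case3 v m r hm ih₁ ih₂ =>
    have hq := fun x y z => raceFree_quadC (o := fieldKernel) (r := r) h (by omega) x y z
    have hs := h.hs
    have h₀ := h.quad (by omega) false
    have h₁ := h.quad (by omega) true
    have d : ∀ {y z : Bool}, y ≠ z → ∀ x < sp, (Quad v s m y y x ∨ sp ≤ x) →
        ¬ (Quad v s m z z x ∨ sp ≤ x) ∧ ¬ (Quad v s m z z x ∨ sp ≤ x) := fun {y z} hyz x hx hq => by
      have : ¬ (Quad v s m z z x ∨ sp ≤ x) := not_or.2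
        ⟨(hq.resolve_right (not_le.2 hx)).disjoint hs (by simp [hyz]), not_le.2 hx⟩
      exact ⟨this, this⟩
    refine ⟨trivial, trivial, Comp.Touches.raceFree_fork (ih₁ h₀) (ih₂ h₁) (touches_invC h₀)
      (touches_invC h₁) (d (by simp)) (d (by simp)), raceFree_mapC (by omega) (by omega) (by omega) ?_, hq .., hq ..⟩
    intro i hi j hj i' hi' j' hj' e
    exact index_unique (s := s) (by omega) (by omega) (by omega)

theorem extent_invC_le {sp s u v m r : ℕ} (hr : 1 ≤ r) :
    (invC sp s u v m r).extent ≤ 4 * m ^ 2 + 1 := by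
  fun_induction invC sp s u v m r with
  | case1 v m r hm hu => simp [Comp.extent]
  | case2 v m r hm hu => simp [Comp.extent]
  | case3 v m r hm ih₁ ih₂ =>
    have hq := fun x y z => extent_quadC_le (o := fieldKernel) (sp := sp) (a := v) (s := s) (m := m) hr
      (by omega) x y z
    have e := fun x => Nat.mul_le_mul_left 4 (Nat.pow_le_pow_left
      ((Nat.le_add_left _ _).trans (offset_add_halfLen_le m x)) 2)
    have i₁ := (ih₁ (one_le_nextRatio hr)).trans (Nat.add_le_add_right (e false) 1)
    have i₂ := (ih₂ (one_le_nextRatio hr)).trans (Nat.add_le_add_right (e true) 1)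
    simp only [Comp.extent, Nat.zero_le, sup_of_le_right, sup_le_iff, extent_mapC]
    exact ⟨⟨i₁, i₂⟩, (hq ..).trans (Nat.le_succ _), (hq ..).trans (Nat.le_succ _)⟩

theorem work_invC_le {sp s u v m r : ℕ} (hm : 1 ≤ m) : (invC sp s u v m r).work ≤ 200 * m ^ 3 := by
  have e := Nat.one_le_pow 3 m hm
  fun_induction invC sp s u v m r with
  | case1 v m r h hu =>
    simp only [Comp.work]
    omega
  | case2 v m r h hu =>
    simp only [Comp.work]
    omega
  | case3 v m r h ih₁ ih₂ =>
    have b := fun x => (halfLen_bounds (by omega : 2 ≤ m) x).1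
    have hh := work_halves_le (by omega) (ih₁ (b false) (Nat.one_le_pow _ _ (b false)))
      (ih₂ (b true) (Nat.one_le_pow _ _ (b true)))
    have h₁ := work_quadC_le (o := fieldKernel) (sp := sp) (a := v) (s := s) (m := m) (r := r)
      (by omega) true false true
    have h₂ := work_quadC_le (o := fieldKernel) (sp := sp) (a := v) (s := s) (m := m) (r := r)
      (by omega) true false false
    have h₃ := work_mapC_le FieldOp.zero (ds := s) (ar := s) (ac := 1) (d := v + m / 2)
      (a := v + m / 2) (p := m / 2) (q := m - m / 2) (by omega) (by omega)
    have h₄ : m / 2 * (m - m / 2) ≤ m ^ 3 := by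
      calc m / 2 * (m - m / 2) ≤ m * m * 1 := by
            rw [mul_one]
            exact Nat.mul_le_mul (by omega) (by omega)
        _ ≤ m * m * m := Nat.mul_le_mul_left _ hm
        _ = _ := by ring
    simp only [Comp.work]
    omega

/-- The halves run in parallel, so the polylogarithmic costs add up along a single path and the
shrinking ratios form a geometric sum. No term linear in `m` arises; this is why a solve can be a
subroutine at every level of the elimination. -/
theorem span_invC_le {sp s u v m r : ℕ} (hm : 1 ≤ m) (hr : 1 ≤ r) :
    (invC sp s u v m r).span ≤ 100 * (3 * r + (Nat.clog 2 m + 1) ^ 3) := by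
  fun_induction invC sp s u v m r with
  | case1 v m r h hu =>
    simp only [Comp.span]
    omega
  | case2 v m r h hu =>
    simp only [Comp.span]
    omega
  | case3 v m r h ih₁ ih₂ =>
    have b := fun x => (halfLen_bounds (by omega : 2 ≤ m) x).1
    have c := fun x => clog_half (m := m) (h := halfLen m x) (by omega) (by
      have := halfLen_bounds (by omega : 2 ≤ m) x
      omega)
    obtain ⟨L, hL⟩ : ∃ L, Nat.clog 2 m = L + 1 := ⟨Nat.clog 2 m - 1, by have := c true; omega⟩
    have e := fun x => Nat.pow_le_pow_left (show Nat.clog 2 (halfLen m x) + 1 ≤ L + 1 by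
      have := c x; omega) 3
    have i₁ := ih₁ (b false) (one_le_nextRatio hr)
    have i₂ := ih₂ (b true) (one_le_nextRatio hr)
    have e₁ := e false
    have e₂ := e true
    have h₁ := span_quadC_le (o := fieldKernel) (sp := sp) (a := v) (s := s) (m := m) (r := r)
      (by omega) true false true
    have h₂ := span_quadC_le (o := fieldKernel) (sp := sp) (a := v) (s := s) (m := m) (r := r)
      (by omega) true false false
    have h₃ := span_mapC_le FieldOp.zero (ds := s) (ar := s) (ac := 1) (d := v + m / 2)
      (a := v + m / 2) (p := m / 2) (q := m - m / 2) (by omega) (by omega)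
    have c₁ := c false
    have c₂ := c true
    have e₃ : (Nat.clog 2 m + 1) ^ 3 = (L + 1) ^ 3 + 3 * Nat.clog 2 m ^ 2 + 3 * Nat.clog 2 m + 1 := by
      rw [hL]
      ring
    have e₄ : 10 * nextRatio r ≤ 4 * r + 8 ∧ 5 * nextRatio r ≤ 5 * r ∧ (2 ≤ r → nextRatio r < r) := by
      unfold nextRatio
      omega
    have e₅ : Nat.clog 2 (halfLen m false) = Nat.clog 2 (m / 2) := rfl
    have e₆ : Nat.clog 2 (halfLen m true) = Nat.clog 2 (m - m / 2) := rfl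
    simp only [Comp.span]
    omega

theorem cheap_invC {θ : ℝ} {M B t : ℕ} (hT : Tall θ M B t) {sp s u v m r : ℕ}
    (h : SqArgs sp v s m) (hl : Level θ t r m) :
    Cheap (14 * θ ^ 4 + 6 * (264 * θ ^ 2 + 2 * (40960 * θ ^ 3))) M B t r m
      (invC sp s u v m r).trace := by
  have hθ := hl.hθ
  have ht := hT.two_le_t
  have fits : ∀ {v m r}, SqArgs sp v s m → Level θ t r m → m ≤ t →
      Cheap (14 * θ ^ 4 + 6 * (264 * θ ^ 2 + 2 * (40960 * θ ^ 3))) M B t r m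
        (invC sp s u v m r).trace :=
    fun h hl hm => (cheap_of_fits hT hl hm (by omega) (inScope_invC h) (touches_invC h)
      ((extent_invC_le hl.hr).trans (by omega))).mono (by positivity)
        (le_add_of_nonneg_right (by positivity)) le_rfl
  by_cases hmt : m ≤ t
  · exact fits h hl hmt
  fun_induction invC sp s u v m r with
  | case1 v m r hm hu => omega
  | case2 v m r hm hu => omega
  | case3 v m r hm ih₁ ih₂ =>
    have hm' := not_le.1 hmt
    have hq := fun x y z => cheap_quadC hT (o := fieldKernel) h hl hm' x y z
    have hx := fun x => hl.half ht hm' x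
    have hs := fun x => h.quad (by omega) x
    have hz := cheap_mapC hT FieldOp.zero (ds := s) (ar := s) (ac := 1) (d := v + m / 2)
      (a := v + m / 2) (p := m / 2) (q := m - m / 2) hl hm' (by omega) (by omega) (by omega) (by omega)
      (.inl rfl)
    have key := Cheap.of_halves (tr₀ := (invC sp s u (v + offset m false * s + offset m false)
        (halfLen m false) (nextRatio r)).trace) (tr₁ := [])
      (tr₂ := (invC sp s u (v + offset m true * s + offset m true) (halfLen m true)
        (nextRatio r)).trace) (C := 14 * θ ^ 4 + 6 * (264 * θ ^ 2 + 2 * (40960 * θ ^ 3)))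
      (C' := 264 * θ ^ 2 + 2 * (40960 * θ ^ 3)) ?_ (by positivity) hl.hr (by omega) ?_
      ⟨_, _, ?_, Cheap.nil, hz.append ((hq true false true).append (hq true false false))⟩ ?_
    · simpa only [Comp.trace, List.nil_append, List.append_assoc] using key
    · have : 0 ≤ 14 * θ ^ 4 := by positivity
      linarith
    · rcases le_or_gt (halfLen m false) t with h' | h'
      exacts [fits (hs false) (hx false) h', ih₁ (hs false) (hx false) (not_le.2 h')]
    · linarith
    · rcases le_or_gt (halfLen m true) t with h' | h'
      exacts [fits (hs true) (hx true) h', ih₂ (hs true) (hx true) (not_le.2 h')]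

/-! ### Correctness of the inversion -/

section Inverse

variable {K : Type u} [Field K]

/-- The lower triangular part of `f`, with ones on the diagonal unless `u = 0`. -/
def lowerTri (u : ℕ) (f : ℕ → ℕ → K) (i j : ℕ) : K :=
  if j < i then f i j else if i = j then (if u = 0 then f i i else 1) else 0

theorem lowerTri_congr {u m : ℕ} {f g : ℕ → ℕ → K} (h : ∀ i < m, ∀ j < m, f i j = g i j) {i j : ℕ}
    (hi : i < m) (hj : j < m) : lowerTri u f i j = lowerTri u g i j := by
  simp only [lowerTri, h i hi j hj, h i hi i hi]

/-- `(1 - N) T = 1` for `m × m` matrices. -/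
def IsOneSubInv (m : ℕ) (N T : ℕ → ℕ → K) : Prop :=
  ∀ i < m, ∀ j < m, T i j - ∑ l ∈ Finset.range m, N i l * T l j = if i = j then 1 else 0

theorem IsOneSubInv.congr {m : ℕ} {N T N' T' : ℕ → ℕ → K} (h : IsOneSubInv m N T)
    (hN : ∀ i < m, ∀ j < m, N' i j = N i j) (hT : ∀ i < m, ∀ j < m, T' i j = T i j) :
    IsOneSubInv m N' T' := fun i hi j hj => by
  rw [← h i hi j hj, hT i hi j hj]
  congr 1
  refine Finset.sum_congr rfl fun l hl => ?_
  rw [hN i hi l (Finset.mem_range.1 hl), hT l (Finset.mem_range.1 hl) j hj]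

/-- `(w - w N) T = w` for a row `w`. -/
theorem IsOneSubInv.row {m : ℕ} {N T : ℕ → ℕ → K} (h : IsOneSubInv m N T) (w : ℕ → K) {j : ℕ}
    (hj : j < m) :
    ∑ l ∈ Finset.range m, (w l - ∑ p ∈ Finset.range m, w p * N p l) * T l j = w j := by
  calc _ = ∑ p ∈ Finset.range m, w p * (T p j - ∑ l ∈ Finset.range m, N p l * T l j) := by
        simp only [sub_mul, mul_sub, Finset.sum_sub_distrib, Finset.sum_mul, Finset.mul_sum]
        congr 1
        rw [Finset.sum_comm]
        refine Finset.sum_congr rfl fun p _ => Finset.sum_congr rfl fun l _ => ?_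
        rw [mul_assoc]
    _ = ∑ p ∈ Finset.range m, w p * if p = j then 1 else 0 :=
      Finset.sum_congr rfl fun p hp => by rw [h p (Finset.mem_range.1 hp) j hj]
    _ = w j := by simp [hj]

/-- `(1 - N) (T x) = x` for a column `x`. -/
theorem IsOneSubInv.col {m : ℕ} {N T : ℕ → ℕ → K} (h : IsOneSubInv m N T) {x y : ℕ → K}
    (hy : ∀ i < m, y i = ∑ l ∈ Finset.range m, T i l * x l) {i : ℕ} (hi : i < m) :
    y i - ∑ l ∈ Finset.range m, N i l * y l = x i := by
  calc _ = ∑ p ∈ Finset.range m, (T i p - ∑ l ∈ Finset.range m, N i l * T l p) * x p := by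
        simp only [sub_mul, Finset.sum_sub_distrib, Finset.sum_mul]
        rw [hy i hi]
        congr 1
        rw [Finset.sum_comm]
        refine Finset.sum_congr rfl fun l hl => ?_
        rw [hy l (Finset.mem_range.1 hl), Finset.mul_sum]
        exact Finset.sum_congr rfl fun p _ => (mul_assoc _ _ _).symm
    _ = ∑ p ∈ Finset.range m, (if i = p then 1 else 0) * x p :=
      Finset.sum_congr rfl fun p hp => by rw [h i hi p (Finset.mem_range.1 hp)]
    _ = x i := by simp [hi]

/-- For `T = [T₀₀, 0; T₁₀, T₁₁]` the lower left block of `1 - T⁻¹` is `T₁₁⁻¹ T₁₀ T₀₀⁻¹ = (1 - N₁₁)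
T₁₀ (1 - N₀₀)`. Both factors act as updates `X ← X - N X` and `X ← X - X N`, which the
multiplication performs directly; `W` is the intermediate result. -/
theorem IsOneSubInv.of_blocks {h k : ℕ} {N T W : ℕ → ℕ → K} (h₀ : IsOneSubInv h N T)
    (h₁ : IsOneSubInv k (fun i j => N (h + i) (h + j)) (fun i j => T (h + i) (h + j)))
    (hT : ∀ i < h, ∀ j < k, T i (h + j) = 0) (hN : ∀ i < h, ∀ j < k, N i (h + j) = 0)
    (hW : ∀ i < k, ∀ j < h,
      W i j = T (h + i) j - ∑ l ∈ Finset.range k, N (h + i) (h + l) * T (h + l) j)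
    (hN' : ∀ i < k, ∀ j < h, N (h + i) j = W i j - ∑ l ∈ Finset.range h, W i l * N l j) :
    IsOneSubInv (h + k) N T := by
  intro i hi j hj
  rw [Finset.sum_range_add]
  rcases lt_or_ge i h with hi' | hi'
  · rw [Finset.sum_eq_zero (s := Finset.range k) fun l hl => by
      rw [hN i hi' l (Finset.mem_range.1 hl), zero_mul], add_zero]
    rcases lt_or_ge j h with hj' | hj'
    · exact h₀ i hi' j hj'
    · obtain ⟨j, rfl⟩ := Nat.exists_eq_add_of_le hj'
      rw [hT i hi' j (by omega), Finset.sum_eq_zero fun l hl => by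
        rw [hT l (Finset.mem_range.1 hl) j (by omega), mul_zero], sub_zero, if_neg (by omega)]
  · obtain ⟨i, rfl⟩ := Nat.exists_eq_add_of_le hi'
    rcases lt_or_ge j h with hj' | hj'
    · have e : ∑ l ∈ Finset.range h, N (h + i) l * T l j = W i j := by
        rw [← h₀.row (W i) hj']
        refine Finset.sum_congr rfl fun l hl => ?_
        rw [hN' i (by omega) l (Finset.mem_range.1 hl)]
      rw [e, hW i (by omega) j hj', if_neg (by omega)]
      ring
    · obtain ⟨j, rfl⟩ := Nat.exists_eq_add_of_le hj'
      rw [Finset.sum_eq_zero fun l hl => by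
        rw [hT l (Finset.mem_range.1 hl) j (by omega), mul_zero], zero_add,
        h₁ i (by omega) j (by omega)]
      simp

end Inverse

/-- The address of the entry `i, j` of a quadrant. -/
def quadAddr (a s m : ℕ) (x y : Bool) (i j : ℕ) : ℕ := a + offset m x * s + offset m y + i * s + j

theorem quad_quadAddr {a s m : ℕ} {x y : Bool} {i j : ℕ} (hi : i < halfLen m x)
    (hj : j < halfLen m y) : Quad a s m x y (quadAddr a s m x y i j) := .intro hi hj

theorem quadAddr_eq (a s m : ℕ) (x y : Bool) (i j : ℕ) :
    quadAddr a s m x y i j = a + (offset m x + i) * s + (offset m y + j) := by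
  rw [quadAddr]
  ring

/-- A computation that writes in one quadrant leaves the others alone. -/
theorem run_quadAddr_of_ne {σ : Type} {R : Type u} {I : σ → R → R → R} {junk : ℕ → R}
    {sp a s m : ℕ} (h : SqArgs sp a s m) {x y x' y' : Bool} {c : Comp σ} {X : ℕ → Prop}
    (ht : c.Touches (fun w => Quad a s m x y w ∨ sp ≤ w) X) (hne : (x', y') ≠ (x, y)) (M : ℕ → R)
    {i j : ℕ} (hi : i < halfLen m x') (hj : j < halfLen m y') :
    c.run I junk sp M (quadAddr a s m x' y' i j) = M (quadAddr a s m x' y' i j) := by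
  have hq := quad_quadAddr (a := a) (s := s) (m := m) hi hj
  have hlt := h.hA _ hq.blk
  exact ht.run_eq hlt (not_or.2 ⟨hq.disjoint h.hs hne, not_le.2 hlt⟩)

section Run

variable {K : Type u} [Field K]

theorem run_gemmC_sub (junk : ℕ → K) {sp c sc a sa b br bc p q k r : ℕ}
    (h : GemmArgs sp c sc a sa b br bc p q k) (M : ℕ → K) {i j : ℕ} (hi : i < p) (hj : j < q) :
    (gemmC fieldKernel sp c sc a sa b br bc p q k r).run FieldOp.interp junk sp M (c + i * sc + j) =
      M (c + i * sc + j) -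
        ∑ l ∈ Finset.range k, M (a + i * sa + l) * M (b + l * br + j * bc) := by
  rw [run_gemmC fieldKernel_lawful junk h M hi hj, sub_eq_add_neg]
  rfl

theorem run_quadC_sub (junk : ℕ → K) {sp a s m r : ℕ} (h : SqArgs sp a s m)
    (hm : 2 ≤ m) (x y z : Bool) (M : ℕ → K) {i j : ℕ} (hi : i < halfLen m x) (hj : j < halfLen m y) :
    (quadC fieldKernel sp a s m r x y z).run FieldOp.interp junk sp M (quadAddr a s m x y i j) =
      M (quadAddr a s m x y i j) - ∑ l ∈ Finset.range (halfLen m z),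
        M (quadAddr a s m x z i l) * M (quadAddr a s m z y l j) := by
  simpa only [quadC, quadAddr, mul_one] using run_gemmC_sub junk (h.gemmArgs hm x y z) (r := r) M hi hj

/-- At a leaf `1 - v⁻¹` is computed, or `0` when the diagonal is taken to be `1`. Above, the upper
right quadrant is zeroed explicitly, because the copied block may hold unrelated entries above its
diagonal. -/
theorem run_invC (junk : ℕ → K) {sp s u v m r : ℕ} (h : SqArgs sp v s m) (M : ℕ → K)
    (hd : u = 0 → ∀ i < m, M (v + i * s + i) ≠ 0) :
    IsOneSubInv m (fun i j => (invC sp s u v m r).run FieldOp.interp junk sp M (v + i * s + j))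
      (lowerTri u fun i j => M (v + i * s + j)) := by
  fun_induction invC sp s u v m r generalizing M with
  | case1 v m r hm hu =>
    have hm₁ := h.hm
    obtain rfl : m = 1 := by omega
    obtain rfl : u = 0 := by omega
    have hv : v < sp := h.hA _ ⟨0, h.hm, 0, h.hm, by simp⟩
    have h₀ : M v ≠ 0 := by simpa using hd rfl 0 one_pos
    intro i hi j hj
    obtain rfl : i = 0 := by omega
    obtain rfl : j = 0 := by omega
    simp [Comp.run, lowerTri, FieldOp.interp, hv.ne, hv.ne', not_le.2 hv, Function.update_apply,
      sub_mul, h₀]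
  | case2 v m r hm hu =>
    have hm₁ := h.hm
    obtain rfl : m = 1 := by omega
    intro i hi j hj
    obtain rfl : i = 0 := by omega
    obtain rfl : j = 0 := by omega
    have hu' : u ≠ 0 := by omega
    simp [Comp.run, lowerTri, FieldOp.interp, hu']
  | case3 v m r hm ih₁ ih₂ =>
    have hm₂ : 2 ≤ m := by omega
    have hF := h.quad hm₂ false
    have hT := h.quad hm₂ true
    have hof : offset m false = 0 := rfl
    have hot : offset m true = m / 2 := rfl
    have hlf : halfLen m false = m / 2 := rfl
    have hlt : halfLen m true = m - m / 2 := rfl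
    simp only [Comp.run]
    set M₁ := (invC sp s u (v + offset m false * s + offset m false) (halfLen m false)
      (nextRatio r)).run FieldOp.interp junk sp M with hM₁
    set M₂ := (invC sp s u (v + offset m true * s + offset m true) (halfLen m true)
      (nextRatio r)).run FieldOp.interp junk sp M₁ with hM₂
    set M₃ := (mapC FieldOp.zero s s 1 (v + m / 2) (v + m / 2) (m / 2) (m - m / 2)).run
      FieldOp.interp junk sp M₂ with hM₃
    set M₄ := (quadC fieldKernel sp v s m r true false true).run FieldOp.interp junk sp M₃ with hM₄
    set M₅ := (quadC fieldKernel sp v s m r true false false).run FieldOp.interp junk sp M₄ with hM₅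
    have e₁ : ∀ {x y i j}, (x, y) ≠ (false, false) → i < halfLen m x → j < halfLen m y →
        M₁ (quadAddr v s m x y i j) = M (quadAddr v s m x y i j) := fun hne hi hj =>
      run_quadAddr_of_ne h (touches_invC hF) hne M hi hj
    have e₂ : ∀ {x y i j}, (x, y) ≠ (true, true) → i < halfLen m x → j < halfLen m y →
        M₂ (quadAddr v s m x y i j) = M₁ (quadAddr v s m x y i j) := fun hne hi hj =>
      run_quadAddr_of_ne h (touches_invC hT) hne M₁ hi hj
    have e₃ : ∀ {x y i j}, (x, y) ≠ (false, true) → i < halfLen m x → j < halfLen m y →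
        M₃ (quadAddr v s m x y i j) = M₂ (quadAddr v s m x y i j) := fun hne hi hj =>
      run_quadAddr_of_ne h (touches_zero hm₂) hne M₂ hi hj
    have e₄ : ∀ {x y i j}, (x, y) ≠ (true, false) → i < halfLen m x → j < halfLen m y →
        M₄ (quadAddr v s m x y i j) = M₃ (quadAddr v s m x y i j) := fun hne hi hj =>
      run_quadAddr_of_ne h (touches_quadC h hm₂ _ _ _) hne M₃ hi hj
    have e₅ : ∀ {x y i j}, (x, y) ≠ (true, false) → i < halfLen m x → j < halfLen m y →
        M₅ (quadAddr v s m x y i j) = M₄ (quadAddr v s m x y i j) := fun hne hi hj =>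
      run_quadAddr_of_ne h (touches_quadC h hm₂ _ _ _) hne M₄ hi hj
    have a₀ : ∀ i j, quadAddr v s m false false i j = v + i * s + j := fun i j => by
      rw [quadAddr_eq, hof, zero_add, zero_add]
    have a₁ : ∀ i j, quadAddr v s m false true i j = v + i * s + (m / 2 + j) := fun i j => by
      rw [quadAddr_eq, hof, hot, zero_add]
    have a₂ : ∀ i j, quadAddr v s m true false i j = v + (m / 2 + i) * s + j := fun i j => by
      rw [quadAddr_eq, hof, hot, zero_add]
    have a₃ : ∀ i j, quadAddr v s m true true i j = v + (m / 2 + i) * s + (m / 2 + j) := fun i j => by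
      rw [quadAddr_eq, hot]
    have i₁ := ih₁ hF M fun hu i hi => by
      have := hd hu i (by omega)
      rwa [hof, zero_mul, add_zero, add_zero]
    have i₂ := ih₂ hT M₁ fun hu i hi => by
      have := hd hu (m / 2 + i) (by omega)
      rw [← a₃, ← e₁ (by simp) hi hi] at this
      exact this
    have key : IsOneSubInv (m / 2 + (m - m / 2)) (fun i j => M₅ (v + i * s + j))
        (lowerTri u fun i j => M (v + i * s + j)) := by
      refine IsOneSubInv.of_blocks (W := fun i j => M₄ (quadAddr v s m true false i j)) ?_ ?_ ?_ ?_ ?_ ?_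
      · refine i₁.congr (fun i hi j hj => ?_) fun i hi j hj => ?_
        · rw [← a₀, e₅ (by simp) hi hj, e₄ (by simp) hi hj, e₃ (by simp) hi hj, e₂ (by simp) hi hj]
          rfl
        · rw [hof, zero_mul, add_zero, add_zero]
      · refine i₂.congr (fun i hi j hj => ?_) fun i hi j hj => ?_
        · rw [← a₃, e₅ (by simp) hi hj, e₄ (by simp) hi hj, e₃ (by simp) hi hj]
          rfl
        · have : lowerTri u (fun i j => M (v + i * s + j)) (m / 2 + i) (m / 2 + j) =
              lowerTri u (fun i j => M (quadAddr v s m true true i j)) i j := by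
            simp only [lowerTri, a₃, add_lt_add_iff_left, add_right_inj]
          rw [this]
          exact lowerTri_congr (fun i hi j hj => (e₁ (by simp) hi hj).symm) hi hj
      · intro i hi j hj
        rw [lowerTri, if_neg (by omega), if_neg (by omega)]
      · intro i hi j hj
        rw [← a₁, e₅ (by simp) hi hj, e₄ (by simp) hi hj, hM₃]
        have hb : ∀ i < m / 2, ∀ j < m - m / 2, v + m / 2 + i * s + j < sp := fun i hi j hj =>
          h.hA _ (quad_quadAddr (x := false) (y := true) hi hj).blk |>.trans_eq' (by
            rw [a₁]
            ring)
        rw [show quadAddr v s m false true i j = v + m / 2 + i * s + j by rw [a₁]; ring,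
          run_mapC _ junk (by omega) (by omega) (by have := h.hs; omega)
            (fun i hi j hj => ⟨hb i hi j hj, by rw [mul_one]; exact hb i hi j hj⟩)
            (fun i hi j hj i' hi' j' hj' e => index_unique (s := s) (by have := h.hs; omega)
              (by have := h.hs; omega) (by omega)) _ i hi j hj]
        rfl
      · intro i hi j hj
        rw [hM₄, run_quadC_sub junk h hm₂ true false true M₃ hi hj, e₃ (by simp) hi hj,
          e₂ (by simp) hi hj, e₁ (by simp) hi hj, a₂, lowerTri, if_pos (by omega)]
        congr 1
        refine Finset.sum_congr rfl fun l hl => ?_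
        have hl := Finset.mem_range.1 hl
        rw [e₃ (x := true) (y := false) (by simp) hl hj, e₂ (by simp) hl hj, e₁ (by simp) hl hj, a₂,
          ← a₃, e₅ (by simp) hi hl, e₄ (by simp) hi hl, lowerTri, if_pos (by omega)]
      · intro i hi j hj
        rw [← a₂, hM₅, run_quadC_sub junk h hm₂ true false false M₄ hi hj]
        congr 1
        refine Finset.sum_congr rfl fun l hl => ?_
        have hl := Finset.mem_range.1 hl
        rw [← a₀, ← hM₅, e₅ (by simp) hl hj]
    rwa [show m / 2 + (m - m / 2) = m by omega] at key

end Run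

/-! ## Solving with an inverted copy of a triangular matrix -/

/-- Copy an `h × h` matrix at `a` with strides `ar, ac` to the stack, apply `invC` to the copy, and
continue with `p`. -/
def withInvC (sp a ar ac u h r : ℕ) (p : Comp FieldOp) : Comp FieldOp :=
  .alloc (h * h) (.seq (mapC .copy h ar ac sp a h h) (.seq (invC (sp + h * h) h u sp h r) p))

theorem sqArgs_stack (sp : ℕ) {h : ℕ} (hh : 1 ≤ h) : SqArgs (sp + h * h) sp h h :=
  ⟨hh, le_rfl, fun _ hx => hx.compact.2⟩

section WithInv

variable {sp a ar ac u h r : ℕ} {p : Comp FieldOp}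

theorem touches_withInvC {W X : ℕ → Prop} (hh : 1 ≤ h) (hW : ∀ x, sp ≤ x → W x)
    (hX : ∀ x, sp ≤ x → X x) (ha : ∀ i < h, ∀ j < h, X (a + i * ar + j * ac)) (hp : p.Touches W X) :
    (withInvC sp a ar ac u h r p).Touches W X := by
  refine .alloc (.seq (touches_mapC hh hh (fun i _ j _ => hW _ (by omega))
    fun i hi j hj => ⟨hX _ (by omega), ha i hi j hj⟩) (.seq ?_ hp))
  have : ∀ x, (Blk sp h h h x ∨ sp + h * h ≤ x) → sp ≤ x := by
    rintro x (hx | hx)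
    exacts [hx.compact.1, (Nat.le_add_right _ _).trans hx]
  exact (touches_invC (sqArgs_stack sp hh)).mono (fun x hx => hW x (this x hx))
    (fun x hx => hX x (this x hx))

theorem mapC_copy_lt (ha : ∀ i < h, ∀ j < h, a + i * ar + j * ac < sp) :
    ∀ i < h, ∀ j < h, sp + i * h + j < sp + h * h ∧ a + i * ar + j * ac < sp + h * h :=
  fun i hi j hj => ⟨(Blk.intro (b := sp) (s := h) hi hj).compact.2,
    (ha i hi j hj).trans_le (Nat.le_add_right _ _)⟩

theorem mapC_copy_ne (ha : ∀ i < h, ∀ j < h, a + i * ar + j * ac < sp) :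
    ∀ i < h, ∀ j < h, ∀ i' < h, ∀ j' < h,
      sp + i * h + j = a + i' * ar + j' * ac → i = i' ∧ j = j' := fun i _ j _ i' hi' j' hj' e => by
  have := ha i' hi' j' hj'
  omega

theorem inScope_withInvC (hh : 1 ≤ h) (ha : ∀ i < h, ∀ j < h, a + i * ar + j * ac < sp)
    (hp : p.InScope (sp + h * h)) : (withInvC sp a ar ac u h r p).InScope sp :=
  ⟨inScope_mapC hh hh (mapC_copy_lt ha), inScope_invC (sqArgs_stack sp hh), hp⟩

theorem raceFree_withInvC (hh : 1 ≤ h) (ha : ∀ i < h, ∀ j < h, a + i * ar + j * ac < sp)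
    (hp : p.RaceFree (sp + h * h)) : (withInvC sp a ar ac u h r p).RaceFree sp :=
  ⟨raceFree_mapC hh hh le_rfl (mapC_copy_ne ha), raceFree_invC (sqArgs_stack sp hh), hp⟩

theorem extent_withInvC_le (hr : 1 ≤ r) {e : ℕ} (he : p.extent ≤ e) :
    (withInvC sp a ar ac u h r p).extent ≤ h ^ 2 + max (4 * h ^ 2 + 1) e := by
  have := extent_invC_le (sp := sp + h * h) (s := h) (u := u) (v := sp) (m := h) hr
  simp only [withInvC, Comp.extent, extent_mapC]
  rw [sq] at this ⊢
  omega

theorem work_withInvC_le (hh : 1 ≤ h) :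
    (withInvC sp a ar ac u h r p).work ≤ 208 * h ^ 3 + p.work := by
  have h₁ := work_invC_le (sp := sp + h * h) (s := h) (u := u) (v := sp) (m := h) (r := r) hh
  have h₂ := work_mapC_le FieldOp.copy (ds := h) (ar := ar) (ac := ac) (d := sp) (a := a) hh hh
  have h₃ : h * h ≤ h ^ 3 := by
    rw [pow_succ, sq]
    exact Nat.le_mul_of_pos_right _ hh
  simp only [withInvC, Comp.work]
  omega

theorem span_withInvC_le (hh : 1 ≤ h) (hr : 1 ≤ r) {L : ℕ} (hL : Nat.clog 2 h ≤ L) :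
    (withInvC sp a ar ac u h r p).span ≤ 108 * (3 * r + (L + 1) ^ 3) + p.span := by
  have h₁ := span_invC_le (sp := sp + h * h) (s := h) (u := u) (v := sp) hh hr
  have h₂ := span_mapC_le FieldOp.copy (ds := h) (ar := ar) (ac := ac) (d := sp) (a := a) hh hh
  have h₃ := Nat.pow_le_pow_left (Nat.add_le_add_right hL 1) 3
  have h₄ : (L + 1) ^ 3 = L ^ 3 + 3 * L ^ 2 + 3 * L + 1 := by ring
  simp only [withInvC, Comp.span]
  omega

/-- Splits off the copying and inverting: the continuation sees the old memory below `sp` and the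
matrix `N` on the stack. The strides `ar, ac` allow a transposed copy, which makes an upper
triangular matrix lower triangular. -/
theorem run_withInvC {K : Type u} [Field K] (junk : ℕ → K) (hh : 1 ≤ h)
    (ha : ∀ i < h, ∀ j < h, a + i * ar + j * ac < sp) (M : ℕ → K)
    (hd : u = 0 → ∀ i < h, M (a + i * ar + i * ac) ≠ 0) :
    ∃ M', (withInvC sp a ar ac u h r p).run FieldOp.interp junk sp M =
        p.run FieldOp.interp junk (sp + h * h) M' ∧ (∀ x < sp, M' x = M x) ∧
      IsOneSubInv h (fun i j => M' (sp + i * h + j)) (lowerTri u fun i j => M (a + i * ar + j * ac)) := by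
  set M₀ : ℕ → K := fun x => if sp ≤ x ∧ x < sp + h * h then junk x else M x with hM₀
  set M₁ := (mapC FieldOp.copy h ar ac sp a h h).run FieldOp.interp junk (sp + h * h) M₀ with hM₁
  have e₀ : ∀ x < sp, M₀ x = M x := fun x hx => by simp [hM₀, not_le.2 hx]
  have e₁ : ∀ i < h, ∀ j < h, M₁ (sp + i * h + j) = M (a + i * ar + j * ac) := fun i hi j hj => by
    rw [hM₁, run_mapC _ junk hh hh le_rfl (mapC_copy_lt ha) (mapC_copy_ne ha) _ i hi j hj,
      e₀ _ (ha i hi j hj)]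
    rfl
  refine ⟨_, rfl, fun x hx => ?_, ?_⟩
  · rw [(touches_invC (sqArgs_stack sp hh)).run_eq (by omega), ← e₀ x hx, ← hM₀]
    · refine Comp.Touches.run_eq (W := fun y => sp ≤ y) (X := fun _ => True) ?_ (by omega) (by omega)
      exact touches_mapC hh hh (fun i _ j _ => by omega) (fun _ _ _ _ => ⟨trivial, trivial⟩)
    · rintro (hx' | hx')
      · have := hx'.compact.1
        omega
      · omega
  · have := run_invC junk (sqArgs_stack sp hh) (u := u) (r := r) M₁ fun hu i hi => by
      rw [e₁ i hi i hi]
      exact hd hu i hi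
    exact this.congr (fun _ _ _ _ => rfl) fun i hi j hj =>
      lowerTri_congr (fun i hi j hj => (e₁ i hi j hj).symm) hi hj

end WithInv

/-- Two constants occur because the inversion acts on a block of size `h` with the ratio that
belongs to size `m`. -/
theorem cheap_withInvC {θ θ' : ℝ} {M B t : ℕ} (hT : Tall θ M B t) (hθ' : θ ≤ θ')
    {sp a ar ac u h r m : ℕ} {p : Comp FieldOp} {C : ℝ} (hl : Level θ t r m) (hl' : Level θ' t r h)
    (hm : t < m) (hh : m ≤ 3 * h) (hh' : h ≤ m) (hs : ac = 1 ∨ ar = 1) (hp : Cheap C M B t r m p.trace) :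
    Cheap (264 * θ ^ 2 + (14 * θ' ^ 4 + 6 * (264 * θ' ^ 2 + 2 * (40960 * θ' ^ 3)) + C)) M B t r m
      (withInvC sp a ar ac u h r p).trace := by
  have hθ := hl'.hθ
  exact (cheap_mapC hT FieldOp.copy hl hm hh hh' hh hh' hs).append
    (((cheap_invC (hT.mono hθ') (sqArgs_stack sp hl'.hm) hl').mono (by positivity) le_rfl hh').append
      hp)

/-! ## Triangular systems -/

/-- Makes the cubed logarithm in the span of an inversion linear. The growth of the cube from one
step to the next is below `2` from `L = 3` on. -/
theorem add_two_cube_le (L : ℕ) : (L + 2) ^ 3 ≤ 27 * 2 ^ L := by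
  induction L using Nat.strong_induction_on with
  | _ L ih =>
    rcases lt_or_ge L 3 with h | h
    · interval_cases L <;> norm_num
    · obtain ⟨k, rfl⟩ := Nat.exists_eq_add_of_le h
      have := ih (2 + k) (by omega)
      have e₁ : (3 + k + 2) ^ 3 = k ^ 3 + 15 * k ^ 2 + 75 * k + 125 := by ring
      have e₂ : (2 + k + 2) ^ 3 = k ^ 3 + 12 * k ^ 2 + 48 * k + 64 := by ring
      have e₃ : 2 ^ (3 + k) = 2 * 2 ^ (2 + k) := by ring
      have e₄ : 0 ≤ k ^ 2 := Nat.zero_le _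
      have e₅ : 0 ≤ k ^ 3 := Nat.zero_le _
      omega

theorem clog_add_one_cube_le {n : ℕ} (hn : 1 ≤ n) : (Nat.clog 2 n + 1) ^ 3 ≤ 27 * n := by
  rcases hn.eq_or_lt with rfl | hn
  · simp
  · have h₁ : 0 < Nat.clog 2 n := Nat.clog_pos one_lt_two hn
    have h₂ := Nat.pow_pred_clog_lt_self one_lt_two hn
    have h₃ := add_two_cube_le (Nat.clog 2 n - 1)
    rw [show Nat.clog 2 n - 1 + 2 = Nat.clog 2 n + 1 by omega] at h₃
    exact h₃.trans (Nat.mul_le_mul_left _ h₂.le)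

/-- Solve a triangular system; the registers hold `n, w, r`. -/
def solveStmt : Stmt FieldOp :=
  .alloc (reg 0 * reg 0)
    (.seq (.call 3 [reg 0, reg 1, 0, reg 1, 1, reg 1, reg 1])
      (.seq (.call 6 [reg 0, reg 1, reg 1, reg 3, 0])
        (.call 5 [reg 1 * reg 1, reg 1, reg 0, reg 1, reg 1 * reg 1, reg 1, 1, reg 1, reg 1, reg 1,
          reg 3])))

/-- The computation of `solveStmt`. -/
def solveC (n r : ℕ) : Comp FieldOp :=
  withInvC (2 * n ^ 2) 0 n 1 0 n r
    (gemmC fieldKernel (2 * n ^ 2 + n * n) (n * n) n (2 * n ^ 2) n (n * n) n 1 n n n r)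

def solveProgram : Program FieldOp :=
  [mainStmt 7, mapStmt 1 .zero, mapStmt 2 .add, mapStmt 3 .copy, mmStmt fieldKernel, gemmStmt,
    invStmt, searchStmt 7 solveStmt]

theorem hasInv_solveProgram : HasInv solveProgram := ⟨⟨⟨rfl, rfl, rfl⟩, rfl, rfl⟩, rfl⟩

theorem generates_solveProgram : Generates solveProgram (fun n => 2 * n ^ 2) fun n w =>
    .tick (searchC (solveC n) n w 1) :=
  generates_mainC rfl rfl fun _ _ _ => .alloc
    (.seq (unfolds_mapC hasInv_solveProgram.copy _ _ _ _ _ _ _ _ _ _ rfl)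
      (.seq (unfolds_invC hasInv_solveProgram _ _ _ _ _ _ _ _ rfl)
        (unfolds_gemmC hasInv_solveProgram.toHasGemm rfl)))

section Solve

variable {n r : ℕ}

theorem solveC_source_lt : ∀ i < n, ∀ j < n, 0 + i * n + j * 1 < 2 * n ^ 2 := fun i hi j hj => by
  have := (Blk.intro (b := 0) (s := n) hi hj).compact.2
  rw [sq]
  omega

theorem gemmArgs_solveC (hn : 1 ≤ n) :
    GemmArgs (2 * n ^ 2 + n * n) (n * n) n (2 * n ^ 2) n (n * n) n 1 n n n := by
  rw [sq]
  refine ⟨hn, hn, hn, le_rfl, fun x hx => ?_, fun x hx => ?_, fun x hx => ?_⟩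
  · have := hx.compact
    omega
  · exact hx.compact.2
  · have := hx.of_rows.compact
    omega

theorem Blk.second_half {x : ℕ} (hx : Blk (n * n) n n n x) : Blk 0 n (2 * n) n x := by
  obtain ⟨i, hi, j, hj, rfl⟩ := hx
  exact ⟨n + i, by omega, j, hj, by ring⟩

theorem touches_solveC (hn : 1 ≤ n) : (solveC n r).Touches (fun x => Blk (n * n) n n n x ∨ 2 * n ^ 2 ≤ x)
    (fun x => Blk 0 n (2 * n) n x ∨ 2 * n ^ 2 ≤ x) := by
  refine touches_withInvC hn (fun _ => .inr) (fun _ => .inr) (fun i hi j hj => .inl ?_) ?_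
  · rw [mul_one]
    exact .intro (by omega) hj
  · refine (touches_gemmC (gemmArgs_solveC hn)).mono (fun x => .imp id (by omega)) fun x hx => ?_
    rcases hx with hx | hx | hx | hx
    exacts [.inl hx.second_half, .inr hx.compact.1, .inl hx.of_rows.second_half, .inr (by omega)]

theorem inScope_solveC (hn : 1 ≤ n) : (solveC n r).InScope (2 * n ^ 2) :=
  inScope_withInvC hn solveC_source_lt (inScope_gemmC (gemmArgs_solveC hn))

theorem raceFree_solveC (hn : 1 ≤ n) : (solveC n r).RaceFree (2 * n ^ 2) :=
  raceFree_withInvC hn solveC_source_lt (raceFree_gemmC (gemmArgs_solveC hn))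

theorem extent_solveC_le (hn : 1 ≤ n) (hr : 1 ≤ r) : (solveC n r).extent ≤ 6 * n ^ 2 + 1 := by
  refine (extent_withInvC_le hr (extent_gemmC_le hr hn hn hn)).trans ?_
  rw [sq]
  omega

theorem work_solveC_le (hn : 1 ≤ n) : (solveC n r).work ≤ 252 * n ^ 3 := by
  refine (work_withInvC_le hn).trans ((Nat.add_le_add_left (work_gemmC_le hn hn hn) _).trans_eq ?_)
  ring

theorem le_work_solveC : n ^ 3 ≤ (solveC n r).work := by
  have h : n * n * n ≤ _ := le_work_gemmC (o := fieldKernel) (sp := 2 * n ^ 2 + n * n) (c := n * n)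
    (sc := n) (a := 2 * n ^ 2) (sa := n) (b := n * n) (br := n) (bc := 1) (p := n) (q := n) (k := n)
    (r := r)
  rw [pow_succ, sq]
  refine h.trans ?_
  simp only [solveC, withInvC, Comp.work]
  omega

theorem span_solveC_le (hn : 1 ≤ n) (hr : 1 ≤ r) : (solveC n r).span ≤ 5000 * (n + r) := by
  have h₁ := clog_add_one_cube_le hn
  have h₂ : (Nat.clog 2 n + 1) ^ 3 =
    Nat.clog 2 n ^ 3 + 3 * Nat.clog 2 n ^ 2 + 3 * Nat.clog 2 n + 1 := by ring
  refine (span_withInvC_le hn hr le_rfl).trans ((Nat.add_le_add_left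
    (span_gemmC_le hn hn hn le_rfl le_rfl le_rfl) _).trans ?_)
  omega

theorem cheap_solveC {θ : ℝ} {M B t : ℕ} (hT : Tall θ M B t) (hl : Level θ t r n) :
    Cheap (264 * θ ^ 2 + (14 * θ ^ 4 + 6 * (264 * θ ^ 2 + 2 * (40960 * θ ^ 3)) + 40960 * θ ^ 3))
      M B t r n (solveC n r).trace := by
  have hθ := hl.hθ
  have hn := hl.hm
  rcases le_or_gt n t with h | h
  · refine (cheap_of_fits hT hl h le_rfl (inScope_solveC hn) ((touches_solveC hn).mono
      (fun _ => .imp Blk.second_half id) (fun _ => id)) (extent_solveC_le hn hl.hr)).mono (by positivity) ?_ le_rfl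
    have : 0 ≤ 264 * θ ^ 2 + (6 * (264 * θ ^ 2 + 2 * (40960 * θ ^ 3)) + 40960 * θ ^ 3) := by
      positivity
    linarith
  · exact cheap_withInvC hT le_rfl hl hl h (by omega) le_rfl (.inl rfl) (cheap_gemmC hT
      (gemmArgs_solveC hn) hl h (by omega) le_rfl (by omega) le_rfl (by omega) le_rfl (.inr rfl))

end Solve

theorem efficient_solveC : Efficient (fun n => 2 * n ^ 2) solveC where
  inScope _ _ hn _ := inScope_solveC hn
  raceFree _ _ hn _ := raceFree_solveC hn
  work_le := ⟨252, fun _ _ hn _ => work_solveC_le hn⟩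
  le_work := ⟨1, fun _ _ _ _ => by
    rw [one_mul]
    exact le_work_solveC⟩
  span_le := ⟨5000, fun _ _ hn hr => span_solveC_le hn hr⟩
  cheap θ hθ := ⟨_, by positivity, fun _ _ _ _ _ hT hl => cheap_solveC hT hl⟩

theorem solvesTriangularSystem_solveProgram : SolvesTriangularSystem.{u} fun n w =>
    .tick (searchC (solveC n) n w 1) := by
  intro K _ n w T Y m junk hn hw hT hd hmT hmY
  obtain ⟨j, r, -, -, e⟩ := exists_tick_eq solveC hn hw
  obtain ⟨M, hM, hM', hN⟩ := run_withInvC (sp := 2 * n ^ 2) (a := 0) (ar := n) (ac := 1) (u := 0)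
    (r := r) (p := gemmC fieldKernel (2 * n ^ 2 + n * n) (n * n) n (2 * n ^ 2) n (n * n) n 1 n n n r)
    junk hn solveC_source_lt m fun _ i hi => by
      rw [mul_one, hmT ⟨i, hi⟩ ⟨i, hi⟩]
      exact hd _
  set N : Matrix (Fin n) (Fin n) K := fun i j => M (2 * n ^ 2 + i * n + j)
  have h₁ : (1 - N) * T = 1 := by
    ext i j
    rw [sub_mul, one_mul, Matrix.sub_apply, Matrix.mul_apply, Matrix.one_apply]
    have hT' : ∀ i j : Fin n, lowerTri 0 (fun i j => m (0 + i * n + j * 1)) i j = T i j := fun i j => by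
      simp only [lowerTri, mul_one, hmT i j, hmT i i, if_true, Fin.val_inj, Fin.val_fin_lt]
      split_ifs with h₁ h₂
      · rfl
      · rw [h₂]
      · exact (hT i j (lt_of_le_of_ne (not_lt.1 h₁) h₂)).symm
    have := hN i i.2 j j.2
    rw [← Fin.sum_univ_eq_sum_range fun l => M (2 * n ^ 2 + i * n + l) *
      lowerTri 0 (fun i j => m (0 + i * n + j * 1)) l j] at this
    simpa only [hT', Fin.val_inj] using this
  refine ⟨(1 - N) * Y, ?_, fun i j => ?_⟩
  -- The inversion provides a left inverse of `T`; for square matrices it is also a right inverse.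
  · rw [← mul_assoc, mul_eq_one_comm.1 h₁, one_mul]
  · have h₂ := run_gemmC_sub junk (gemmArgs_solveC hn) (r := r) M i.2 j.2
    have hY : ∀ l : Fin n, M (n * n + l * n + j) = Y l j := fun l => by
      have := (Blk.intro (b := n * n) (s := n) l.2 j.2).compact.2
      rw [hM' _ (by rw [sq]; omega), ← hmY l j, sq]
    beta_reduce
    rw [e, run_iterate_tick, solveC, hM, show n ^ 2 + (i : ℕ) * n + j = n * n + i * n + j by rw [sq],
      h₂, hY, ← Fin.sum_univ_eq_sum_range fun l => M (2 * n ^ 2 + i * n + l) *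
        M (n * n + l * n + j * 1), sub_mul, one_mul, Matrix.sub_apply, Matrix.mul_apply]
    simp only [mul_one, hY, N]

/-! ## Gaussian elimination -/

/-- Gaussian elimination of the `m × m` block at `a` with row stride `s`; the registers hold
`a, s, m, r`. -/
def luStmt : Stmt FieldOp :=
  .ifLe (reg 2) 1 .skip
    (.seq (halfStmt 7 false [])
      (.seq
        (.seq
          (.alloc (halfLenE (reg 2) false * halfLenE (reg 2) false)
            (.seq (.call 3 [reg 0, halfLenE (reg 3) false, reg 1, reg 2, 1, halfLenE (reg 3) false,
                halfLenE (reg 3) false])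
              (.seq (.call 6 [reg 0, halfLenE (reg 3) false, halfLenE (reg 3) false, reg 4, 1])
                (.call 5 [reg 1 + offsetE (reg 3) false * reg 2 + offsetE (reg 3) true, reg 2,
                  reg 0, halfLenE (reg 3) false,
                  reg 1 + offsetE (reg 3) false * reg 2 + offsetE (reg 3) true, reg 2, 1,
                  halfLenE (reg 3) false, halfLenE (reg 3) true, halfLenE (reg 3) false, reg 4]))))
          (.seq
            (.alloc (halfLenE (reg 2) false * halfLenE (reg 2) false)
              (.seq (.call 3 [reg 0, halfLenE (reg 3) false, reg 1, 1, reg 2,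
                  halfLenE (reg 3) false, halfLenE (reg 3) false])
                (.seq (.call 6 [reg 0, halfLenE (reg 3) false, halfLenE (reg 3) false, reg 4, 0])
                  (.call 5 [reg 1 + offsetE (reg 3) true * reg 2 + offsetE (reg 3) false, reg 2,
                    reg 1 + offsetE (reg 3) true * reg 2 + offsetE (reg 3) false, reg 2,
                    reg 0, 1, halfLenE (reg 3) false,
                    halfLenE (reg 3) true, halfLenE (reg 3) false, halfLenE (reg 3) false, reg 4]))))
            (quadStmt true true false)))
        (halfStmt 7 true [])))

/-- Solve for the upper right quadrant. -/
def luRightC (sp s a m r : ℕ) : Comp FieldOp :=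
  withInvC sp a s 1 1 (halfLen m false) r
    (gemmC fieldKernel (sp + halfLen m false * halfLen m false) (a + offset m false * s + offset m true)
      s sp (halfLen m false) (a + offset m false * s + offset m true) s 1 (halfLen m false)
      (halfLen m true) (halfLen m false) r)

/-- Solve for the lower left quadrant. -/
def luLeftC (sp s a m r : ℕ) : Comp FieldOp :=
  withInvC sp a 1 s 0 (halfLen m false) r
    (gemmC fieldKernel (sp + halfLen m false * halfLen m false) (a + offset m true * s + offset m false)
      s (a + offset m true * s + offset m false) s sp 1 (halfLen m false) (halfLen m true)
      (halfLen m false) (halfLen m false) r)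

/-- The computation of `luStmt`. -/
def luC (sp s a m r : ℕ) : Comp FieldOp :=
  if m ≤ 1 then .tick (.tick .step)
  else
    .tick (.tick
      (.seq (luC sp s (a + offset m false * s + offset m false) (halfLen m false) (nextRatio r))
        (.seq (.seq (luRightC sp s a m r) (.seq (luLeftC sp s a m r)
            (quadC fieldKernel sp a s m r true true false)))
          (luC sp s (a + offset m true * s + offset m true) (halfLen m true) (nextRatio r)))))
termination_by m
decreasing_by all_goals simp only [halfLen, cond_true, cond_false]; omega

theorem unfolds_luC {P : Program FieldOp} (hP : HasInv P) (h₇ : P[7]? = some luStmt) (sp s a m r : ℕ) :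
    ∀ (ρ : List ℕ) (args : List IExpr), args.map (IExpr.eval ρ) = [a, s, m, r] →
      Unfolds P sp ρ (.call 7 args) (luC sp s a m r) := by
  fun_induction luC sp s a m r with
  | case1 a m r h => exact fun ρ args hρ => .call h₇ (hρ ▸ .ifTrue h (.skip ..))
  | case2 a m r h ih₁ ih₂ =>
    exact fun ρ args hρ => .call h₇ (hρ ▸ .ifFalse h (.seq (ih₁ _ _ (eval_half ..))
      (.seq
        (.seq (.alloc (.seq (unfolds_mapC hP.copy _ _ _ _ _ _ _ _ _ _ rfl)
            (.seq (unfolds_invC hP _ _ _ _ _ _ _ _ rfl) (unfolds_gemmC hP.toHasGemm rfl))))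
          (.seq (.alloc (.seq (unfolds_mapC hP.copy _ _ _ _ _ _ _ _ _ _ rfl)
            (.seq (unfolds_invC hP _ _ _ _ _ _ _ _ rfl) (unfolds_gemmC hP.toHasGemm rfl))))
            (unfolds_quadC hP.toHasGemm ..)))
        (ih₂ _ _ (eval_half ..)))))

/-! ### The two triangular solves in one step of block elimination. -/

section Solves

variable {sp s a m r : ℕ}

theorem SqArgs.right (h : SqArgs sp a s m) (hm : 2 ≤ m) :
    GemmArgs (sp + halfLen m false * halfLen m false) (a + offset m false * s + offset m true) s sp
      (halfLen m false) (a + offset m false * s + offset m true) s 1 (halfLen m false)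
      (halfLen m true) (halfLen m false) := by
  have hg := h.gemmArgs hm false true false
  exact ⟨hg.hp, hg.hq, hg.hk, hg.hs, fun x hx => (hg.hC x hx).trans_le (Nat.le_add_right _ _),
    fun x hx => hx.compact.2, fun x hx => (hg.hC x hx.of_rows).trans_le (Nat.le_add_right _ _)⟩

/-- The stack holds the matrix for the transposed `U₀₀`. Reading it with strides `1` and `halfLen m
false` transposes it back, so it can be multiplied from the right. -/
theorem SqArgs.left (h : SqArgs sp a s m) (hm : 2 ≤ m) :
    GemmArgs (sp + halfLen m false * halfLen m false) (a + offset m true * s + offset m false) s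
      (a + offset m true * s + offset m false) s sp 1 (halfLen m false) (halfLen m true)
      (halfLen m false) (halfLen m false) := by
  have hg := h.gemmArgs hm true false false
  exact ⟨hg.hp, hg.hq, hg.hk, hg.hs, fun x hx => (hg.hC x hx).trans_le (Nat.le_add_right _ _),
    fun x hx => (hg.hC x hx).trans_le (Nat.le_add_right _ _), fun x hx => hx.of_cols.compact.2⟩

theorem blk_first (hm : 2 ≤ m) {i j : ℕ} (hi : i < halfLen m false) (hj : j < halfLen m false) :
    Blk a s m m (a + i * s + j) :=
  .intro (by have := halfLen_bounds hm false; omega) (by have := halfLen_bounds hm false; omega)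

theorem right_source (hm : 2 ≤ m) : ∀ i < halfLen m false, ∀ j < halfLen m false,
    Blk a s m m (a + i * s + j * 1) := fun i hi j hj => by
  rw [mul_one]
  exact blk_first hm hi hj

theorem left_source (hm : 2 ≤ m) : ∀ i < halfLen m false, ∀ j < halfLen m false,
    Blk a s m m (a + i * 1 + j * s) := fun i hi j hj => by
  rw [mul_one, add_right_comm]
  exact blk_first hm hj hi

theorem touches_luRightC (h : SqArgs sp a s m) (hm : 2 ≤ m) : (luRightC sp s a m r).Touches
    (fun w => Quad a s m false true w ∨ sp ≤ w) (fun w => Blk a s m m w ∨ sp ≤ w) := by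
  refine touches_withInvC (halfLen_bounds hm _).1 (fun _ => .inr) (fun _ => .inr)
    (fun i hi j hj => .inl (right_source hm i hi j hj)) ?_
  refine (touches_gemmC (h.right hm)).mono (fun x => .imp id (by omega)) fun x hx => ?_
  rcases hx with hx | hx | hx | hx
  exacts [.inl (Quad.blk hx), .inr hx.compact.1, .inl (Quad.blk hx.of_rows), .inr (by omega)]

theorem touches_luLeftC (h : SqArgs sp a s m) (hm : 2 ≤ m) : (luLeftC sp s a m r).Touches
    (fun w => Quad a s m true false w ∨ sp ≤ w) (fun w => Blk a s m m w ∨ sp ≤ w) := by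
  refine touches_withInvC (halfLen_bounds hm _).1 (fun _ => .inr) (fun _ => .inr)
    (fun i hi j hj => .inl (left_source hm i hi j hj)) ?_
  refine (touches_gemmC (h.left hm)).mono (fun x => .imp id (by omega)) fun x hx => ?_
  rcases hx with hx | hx | hx | hx
  exacts [.inl (Quad.blk hx), .inl (Quad.blk hx), .inr hx.of_cols.compact.1, .inr (by omega)]

theorem inScope_luRightC (h : SqArgs sp a s m) (hm : 2 ≤ m) : (luRightC sp s a m r).InScope sp :=
  inScope_withInvC (halfLen_bounds hm _).1 (fun i hi j hj => h.hA _ (right_source hm i hi j hj))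
    (inScope_gemmC (h.right hm))

theorem inScope_luLeftC (h : SqArgs sp a s m) (hm : 2 ≤ m) : (luLeftC sp s a m r).InScope sp :=
  inScope_withInvC (halfLen_bounds hm _).1 (fun i hi j hj => h.hA _ (left_source hm i hi j hj))
    (inScope_gemmC (h.left hm))

theorem raceFree_luRightC (h : SqArgs sp a s m) (hm : 2 ≤ m) : (luRightC sp s a m r).RaceFree sp :=
  raceFree_withInvC (halfLen_bounds hm _).1 (fun i hi j hj => h.hA _ (right_source hm i hi j hj))
    (raceFree_gemmC (h.right hm))

theorem raceFree_luLeftC (h : SqArgs sp a s m) (hm : 2 ≤ m) : (luLeftC sp s a m r).RaceFree sp :=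
  raceFree_withInvC (halfLen_bounds hm _).1 (fun i hi j hj => h.hA _ (left_source hm i hi j hj))
    (raceFree_gemmC (h.left hm))

theorem halfLen_mul_le (hm : 2 ≤ m) (x y : Bool) : 16 * (halfLen m x * halfLen m y) ≤ 9 * m ^ 2 := by
  have hx := halfLen_bounds hm x
  have hy := halfLen_bounds hm y
  have := Nat.mul_le_mul (show 4 * halfLen m x ≤ 3 * m by omega) (show 4 * halfLen m y ≤ 3 * m by omega)
  calc 16 * (halfLen m x * halfLen m y) = 4 * halfLen m x * (4 * halfLen m y) := by ring
    _ ≤ 3 * m * (3 * m) := this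
    _ = _ := by ring

theorem extent_luRightC_le (hr : 1 ≤ r) (hm : 2 ≤ m) : (luRightC sp s a m r).extent ≤ 6 * m ^ 2 + 1 := by
  have h₁ := halfLen_mul_le hm false false
  have h₂ := halfLen_mul_le hm true false
  refine (extent_withInvC_le hr (extent_gemmC_le hr (halfLen_bounds hm _).1 (halfLen_bounds hm _).1
    (halfLen_bounds hm _).1)).trans ?_
  rw [sq (halfLen m false)]
  omega

theorem extent_luLeftC_le (hr : 1 ≤ r) (hm : 2 ≤ m) : (luLeftC sp s a m r).extent ≤ 6 * m ^ 2 + 1 := by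
  have h₁ := halfLen_mul_le hm false false
  have h₂ := halfLen_mul_le hm true false
  refine (extent_withInvC_le hr (extent_gemmC_le hr (halfLen_bounds hm _).1 (halfLen_bounds hm _).1
    (halfLen_bounds hm _).1)).trans ?_
  rw [sq (halfLen m false)]
  omega

theorem halfLen_mul_mul_le (hm : 2 ≤ m) (x y z : Bool) :
    halfLen m x * halfLen m y * halfLen m z ≤ m ^ 3 := by
  have hx := halfLen_bounds hm x
  have hy := halfLen_bounds hm y
  have hz := halfLen_bounds hm z
  calc _ ≤ m * m * m := Nat.mul_le_mul (Nat.mul_le_mul (by omega) (by omega)) (by omega)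
    _ = _ := by ring

theorem work_luRightC_le (hm : 2 ≤ m) : (luRightC sp s a m r).work ≤ 252 * m ^ 3 := by
  have h₁ := halfLen_mul_mul_le hm false false false
  have h₂ := halfLen_mul_mul_le hm false true false
  have h₃ : halfLen m false ^ 3 = halfLen m false * halfLen m false * halfLen m false := by ring
  refine (work_withInvC_le (halfLen_bounds hm _).1).trans ((Nat.add_le_add_left (work_gemmC_le
    (halfLen_bounds hm _).1 (halfLen_bounds hm _).1 (halfLen_bounds hm _).1) _).trans ?_)
  omega

theorem work_luLeftC_le (hm : 2 ≤ m) : (luLeftC sp s a m r).work ≤ 252 * m ^ 3 := by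
  have h₁ := halfLen_mul_mul_le hm false false false
  have h₂ := halfLen_mul_mul_le hm true false false
  have h₃ : halfLen m false ^ 3 = halfLen m false * halfLen m false * halfLen m false := by ring
  refine (work_withInvC_le (halfLen_bounds hm _).1).trans ((Nat.add_le_add_left (work_gemmC_le
    (halfLen_bounds hm _).1 (halfLen_bounds hm _).1 (halfLen_bounds hm _).1) _).trans ?_)
  omega

theorem clog_halfLen_le (hm : 2 ≤ m) (x : Bool) : Nat.clog 2 (halfLen m x) ≤ Nat.clog 2 m :=
  Nat.clog_mono_right _ (by have := halfLen_bounds hm x; omega)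

theorem span_luRightC_le (hm : 2 ≤ m) (hr : 1 ≤ r) :
    (luRightC sp s a m r).span ≤ 400 * (r + (Nat.clog 2 m + 1) ^ 3) := by
  have e : (Nat.clog 2 m + 1) ^ 3 =
    Nat.clog 2 m ^ 3 + 3 * Nat.clog 2 m ^ 2 + 3 * Nat.clog 2 m + 1 := by ring
  refine (span_withInvC_le (halfLen_bounds hm _).1 hr (clog_halfLen_le hm _)).trans
    ((Nat.add_le_add_left (span_gemmC_le (halfLen_bounds hm _).1 (halfLen_bounds hm _).1
      (halfLen_bounds hm _).1 (clog_halfLen_le hm _) (clog_halfLen_le hm _) (clog_halfLen_le hm _))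
        _).trans ?_)
  omega

theorem span_luLeftC_le (hm : 2 ≤ m) (hr : 1 ≤ r) :
    (luLeftC sp s a m r).span ≤ 400 * (r + (Nat.clog 2 m + 1) ^ 3) := by
  have e : (Nat.clog 2 m + 1) ^ 3 =
    Nat.clog 2 m ^ 3 + 3 * Nat.clog 2 m ^ 2 + 3 * Nat.clog 2 m + 1 := by ring
  refine (span_withInvC_le (halfLen_bounds hm _).1 hr (clog_halfLen_le hm _)).trans
    ((Nat.add_le_add_left (span_gemmC_le (halfLen_bounds hm _).1 (halfLen_bounds hm _).1
      (halfLen_bounds hm _).1 (clog_halfLen_le hm _) (clog_halfLen_le hm _) (clog_halfLen_le hm _))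
        _).trans ?_)
  omega

/-- The size is halved without reducing the ratio, since the inversion belongs to the work of the
current level; doubling `θ` compensates. -/
theorem Level.first {θ : ℝ} {t : ℕ} (h : Level θ t r m) (hm : 2 ≤ m) (htm : t < m) :
    Level (2 * θ) t r (halfLen m false) := by
  obtain ⟨h₁, h₂, h₃, h₄⟩ := halfLen_bounds hm false
  have hθ := h.hθ
  have h₂' : (m : ℝ) ≤ 3 * halfLen m false := by exact_mod_cast h₂
  have h₄' : (m : ℝ) ≤ 2 * halfLen m false + 1 := by exact_mod_cast h₄
  have hm' : (t : ℝ) ≤ m := by exact_mod_cast htm.le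
  refine ⟨by linarith, h.hr, h₁, ?_, ?_⟩
  · have : (0 : ℝ) ≤ halfLen m false := by positivity
    nlinarith
  · have := h.hrt
    have : θ * (m + 1) ≤ θ * (2 * (halfLen m false + 1)) := by gcongr; linarith
    linarith

/-- The constant in the cache bound of `luRightC` and `luLeftC`. -/
def solveConst (θ : ℝ) : ℝ :=
  264 * θ ^ 2 + (14 * (2 * θ) ^ 4 + 6 * (264 * (2 * θ) ^ 2 + 2 * (40960 * (2 * θ) ^ 3)) +
    40960 * θ ^ 3)

variable {θ : ℝ} {M B t : ℕ}

theorem cheap_luRightC (hT : Tall θ M B t) (h : SqArgs sp a s m) (hl : Level θ t r m) (htm : t < m) :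
    Cheap (solveConst θ) M B t r m (luRightC sp s a m r).trace := by
  have hm : 2 ≤ m := by have := hT.two_le_t; omega
  have h₀ := halfLen_bounds hm false
  have h₁ := halfLen_bounds hm true
  have hθ := hl.hθ
  exact cheap_withInvC hT (by linarith) hl (hl.first hm htm) htm (by omega) (by omega) (.inl rfl)
    (cheap_gemmC hT (h.right hm) hl htm (by omega) (by omega) (by omega) (by omega) (by omega)
      (by omega) (.inr rfl))

theorem cheap_luLeftC (hT : Tall θ M B t) (h : SqArgs sp a s m) (hl : Level θ t r m) (htm : t < m) :
    Cheap (solveConst θ) M B t r m (luLeftC sp s a m r).trace := by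
  have hm : 2 ≤ m := by have := hT.two_le_t; omega
  have h₀ := halfLen_bounds hm false
  have h₁ := halfLen_bounds hm true
  have hθ := hl.hθ
  exact cheap_withInvC hT (by linarith) hl (hl.first hm htm) htm (by omega) (by omega) (.inr rfl)
    (cheap_gemmC hT (h.left hm) hl htm (by omega) (by omega) (by omega) (by omega) (by omega)
      (by omega) (.inl rfl))

end Solves

/-! ### Memory use, race-freeness and costs of recursive elimination. -/

section LU

variable {sp s a m r : ℕ}

theorem touches_luC (h : SqArgs sp a s m) : (luC sp s a m r).Touches
    (fun w => Blk a s m m w ∨ sp ≤ w) (fun w => Blk a s m m w ∨ sp ≤ w) := by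
  fun_induction luC sp s a m r with
  | case1 a m r hm => exact .tick (.tick .step)
  | case2 a m r hm ih₁ ih₂ =>
    have i₁ := touches_of_quad (ih₁ (h.quad (by omega) _))
    have i₂ := touches_of_quad (ih₂ (h.quad (by omega) _))
    exact .tick (.tick (.seq i₁ (.seq (.seq
      ((touches_luRightC h (by omega)).mono (fun _ => .imp Quad.blk id) (fun _ => id))
      (.seq ((touches_luLeftC h (by omega)).mono (fun _ => .imp Quad.blk id) (fun _ => id))
        (touches_quadC' h (by omega) _ _ _))) i₂)))

theorem inScope_luC (h : SqArgs sp a s m) : (luC sp s a m r).InScope sp := by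
  fun_induction luC sp s a m r with
  | case1 a m r hm => exact ⟨trivial, trivial, trivial⟩
  | case2 a m r hm ih₁ ih₂ =>
    exact ⟨trivial, trivial, ih₁ (h.quad (by omega) _), ⟨inScope_luRightC h (by omega),
      inScope_luLeftC h (by omega), inScope_quadC h (by omega) _ _ _⟩, ih₂ (h.quad (by omega) _)⟩

theorem raceFree_luC (h : SqArgs sp a s m) : (luC sp s a m r).RaceFree sp := by
  fun_induction luC sp s a m r with
  | case1 a m r hm => exact ⟨trivial, trivial, trivial⟩
  | case2 a m r hm ih₁ ih₂ =>
    exact ⟨trivial, trivial, ih₁ (h.quad (by omega) _), ⟨raceFree_luRightC h (by omega),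
      raceFree_luLeftC h (by omega), raceFree_quadC h (by omega) _ _ _⟩, ih₂ (h.quad (by omega) _)⟩

theorem extent_luC_le (hr : 1 ≤ r) : (luC sp s a m r).extent ≤ 6 * m ^ 2 + 1 := by
  fun_induction luC sp s a m r with
  | case1 a m r hm => exact Nat.zero_le _
  | case2 a m r hm ih₁ ih₂ =>
    have e := fun x => Nat.mul_le_mul_left 6 (Nat.pow_le_pow_left
      ((Nat.le_add_left _ _).trans (offset_add_halfLen_le m x)) 2)
    have i₁ := (ih₁ (one_le_nextRatio hr)).trans (Nat.add_le_add_right (e false) 1)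
    have i₂ := (ih₂ (one_le_nextRatio hr)).trans (Nat.add_le_add_right (e true) 1)
    simp only [Comp.extent, Nat.zero_le, sup_of_le_right, sup_le_iff]
    exact ⟨i₁, ⟨extent_luRightC_le hr (by omega), extent_luLeftC_le hr (by omega),
      (extent_quadC_le hr (by omega) _ _ _).trans (by omega)⟩, i₂⟩

theorem work_luC_le (hm : 1 ≤ m) : (luC sp s a m r).work ≤ 1000 * m ^ 3 := by
  have e := Nat.one_le_pow 3 m hm
  fun_induction luC sp s a m r with
  | case1 a m r h =>
    simp only [Comp.work]
    omega
  | case2 a m r h ih₁ ih₂ =>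
    have b := fun x => (halfLen_bounds (by omega : 2 ≤ m) x).1
    have hh := work_halves_le (by omega) (ih₁ (b false) (Nat.one_le_pow _ _ (b false)))
      (ih₂ (b true) (Nat.one_le_pow _ _ (b true)))
    have := work_quadC_le (o := fieldKernel) (sp := sp) (a := a) (s := s) (m := m) (r := r)
      (by omega) true true false
    have := work_luRightC_le (sp := sp) (a := a) (s := s) (m := m) (r := r) (by omega)
    have := work_luLeftC_le (sp := sp) (a := a) (s := s) (m := m) (r := r) (by omega)
    simp only [Comp.work]
    omega

theorem le_work_luC : m ^ 3 ≤ 27 * (luC sp s a m r).work := by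
  rw [luC]
  split
  · have := Nat.pow_le_pow_left ‹m ≤ 1› 3
    simp only [Comp.work]
    omega
  · have := le_work_quadC (o := fieldKernel) (sp := sp) (a := a) (s := s) (m := m) (r := r) (by omega)
      true true false
    simp only [Comp.work]
    omega

theorem span_luC_le (hm : 1 ≤ m) (hr : 1 ≤ r) :
    (luC sp s a m r).span + 1000 * (Nat.clog 2 m + 20) ^ 3 ≤ 1000 * (8001 * m + 5 * r) := by
  fun_induction luC sp s a m r with
  | case1 a m r h =>
    obtain rfl : m = 1 := by omega
    simp only [Comp.span, Nat.clog_one_right]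
    omega
  | case2 a m r h ih₁ ih₂ =>
    have hh := span_halves_le (by omega)
      (ih₁ (halfLen_bounds (by omega) false).1 (one_le_nextRatio hr))
      (ih₂ (halfLen_bounds (by omega) true).1 (one_le_nextRatio hr))
    have := span_quadC_le (o := fieldKernel) (sp := sp) (a := a) (s := s) (m := m) (r := r)
      (by omega) true true false
    have := span_luRightC_le (sp := sp) (a := a) (s := s) (m := m) (r := r) (by omega) hr
    have := span_luLeftC_le (sp := sp) (a := a) (s := s) (m := m) (r := r) (by omega) hr
    have e : (Nat.clog 2 m + 1) ^ 3 =
      Nat.clog 2 m ^ 3 + 3 * Nat.clog 2 m ^ 2 + 3 * Nat.clog 2 m + 1 := by ring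
    simp only [Comp.span]
    omega

theorem cheap_luC {θ : ℝ} {M B t : ℕ} (hT : Tall θ M B t) (h : SqArgs sp a s m) (hl : Level θ t r m) :
    Cheap (14 * θ ^ 4 + 6 * (2 * solveConst θ + 40960 * θ ^ 3)) M B t r m
      (luC sp s a m r).trace := by
  have hθ := hl.hθ
  have ht := hT.two_le_t
  have hc : 0 ≤ solveConst θ := by
    unfold solveConst
    positivity
  have fits : ∀ {a m r}, SqArgs sp a s m → Level θ t r m → m ≤ t →
      Cheap (14 * θ ^ 4 + 6 * (2 * solveConst θ + 40960 * θ ^ 3)) M B t r m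
        (luC sp s a m r).trace :=
    fun h hl hm => (cheap_of_fits hT hl hm (by omega) (inScope_luC h) (touches_luC h)
      (extent_luC_le hl.hr)).mono (by positivity) (le_add_of_nonneg_right (by positivity)) le_rfl
  by_cases hmt : m ≤ t
  · exact fits h hl hmt
  fun_induction luC sp s a m r with
  | case1 a m r hm => omega
  | case2 a m r hm ih₁ ih₂ =>
    have hm' := not_le.1 hmt
    have hx := fun x => hl.half ht hm' x
    have hs := fun x => h.quad (by omega) x
    have key := Cheap.of_halves (tr₀ := (luC sp s (a + offset m false * s + offset m false)
        (halfLen m false) (nextRatio r)).trace)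
      (tr₂ := (luC sp s (a + offset m true * s + offset m true) (halfLen m true)
        (nextRatio r)).trace) (tr₃ := []) (C := 14 * θ ^ 4 + 6 * (2 * solveConst θ + 40960 * θ ^ 3))
      (C' := 2 * solveConst θ + 40960 * θ ^ 3) ?_ (by positivity) hl.hr (by omega) ?_
      ⟨_, _, ?_, (cheap_luRightC hT h hl hm').append ((cheap_luLeftC hT h hl hm').append
        (cheap_quadC hT (o := fieldKernel) h hl hm' true true false)), Cheap.nil⟩ ?_
    · simpa only [Comp.trace, List.nil_append, List.append_nil] using key
    · have : 0 ≤ 14 * θ ^ 4 := by positivity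
      linarith
    · rcases le_or_gt (halfLen m false) t with h' | h'
      exacts [fits (hs false) (hx false) h', ih₁ (hs false) (hx false) (not_le.2 h')]
    · linarith
    · rcases le_or_gt (halfLen m true) t with h' | h'
      exacts [fits (hs true) (hx true) h', ih₂ (hs true) (hx true) (not_le.2 h')]

end LU

/-! ### The program for Gaussian elimination. -/

def luProgram : Program FieldOp :=
  [mainStmt 8, mapStmt 1 .zero, mapStmt 2 .add, mapStmt 3 .copy, mmStmt fieldKernel, gemmStmt,
    invStmt, luStmt, searchStmt 8 (.call 7 [0, reg 0, reg 0, reg 2])]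

theorem generates_luProgram : Generates luProgram (fun n => n ^ 2) fun n w =>
    .tick (searchC (fun r => luC (n ^ 2) n 0 n r) n w 1) :=
  generates_mainC (body := fun n r => luC (n ^ 2) n 0 n r) rfl rfl
    fun _ _ _ => unfolds_luC ⟨⟨⟨rfl, rfl, rfl⟩, rfl, rfl⟩, rfl⟩ rfl _ _ _ _ _ _ _ rfl

theorem efficient_luC : Efficient (fun n => n ^ 2) fun n r => luC (n ^ 2) n 0 n r where
  inScope _ _ hn _ := inScope_luC (sqArgs_whole hn)
  raceFree _ _ hn _ := raceFree_luC (sqArgs_whole hn)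
  work_le := ⟨1000, fun _ _ hn _ => work_luC_le hn⟩
  le_work := ⟨27, fun _ _ _ _ => le_work_luC⟩
  span_le := ⟨1000 * 8001, fun _ _ hn hr =>
    (Nat.le_add_right _ _).trans ((span_luC_le hn hr).trans (by omega))⟩
  cheap θ hθ := ⟨14 * θ ^ 4 + 6 * (2 * solveConst θ + 40960 * θ ^ 3), by
    unfold solveConst
    positivity, fun _ _ _ _ _ hT hl => cheap_luC hT (sqArgs_whole hl.hm) hl⟩

/-! ### Correctness of Gaussian elimination -/

section Elimination

variable {K : Type u} [Field K] (f : ℕ → ℕ → K)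

/-- The entries after the first `k` elimination steps. -/
def natElim : ℕ → ℕ → ℕ → K
  | 0 => f
  | k + 1 => fun i j =>
      if k < i then natElim k i j - natElim k i k / natElim k k k * natElim k k j else natElim k i j

/-- The multipliers below the diagonal and the upper triangular matrix that elimination leaves. -/
def natFactors (i j : ℕ) : K :=
  if j < i then natElim f j i j / natElim f j j j else natElim f i i j

theorem natElim_succ (k i j : ℕ) : natElim f (k + 1) i j =
    if k < i then natElim f k i j - natElim f k i k / natElim f k k k * natElim f k k j
    else natElim f k i j := rfl

theorem natFactors_of_lt {i j : ℕ} (h : j < i) :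
    natFactors f i j = natElim f j i j / natElim f j j j := if_pos h

theorem natFactors_of_le {i j : ℕ} (h : i ≤ j) : natFactors f i j = natElim f i i j :=
  if_neg h.not_gt

theorem natElim_of_le {i k k' : ℕ} (hk : i ≤ k) (h : k ≤ k') (j : ℕ) :
    natElim f k' i j = natElim f k i j := by
  induction k', h using Nat.le_induction with
  | base => rfl
  | succ k' h ih => rw [natElim_succ, if_neg (by omega), ih]

/-- After `h` steps the trailing block is the Schur complement, and eliminating it separately is the
same as continuing the elimination. This justifies the second recursive call. -/
theorem natElim_shift (h k i j : ℕ) :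
    natElim (fun i j => natElim f h (h + i) (h + j)) k i j = natElim f (h + k) (h + i) (h + j) := by
  induction k generalizing i j with
  | zero => rfl
  | succ k ih =>
    rw [← add_assoc, natElim_succ, natElim_succ]
    simp only [ih, add_lt_add_iff_left]

theorem natFactors_shift (h i j : ℕ) :
    natFactors (fun i j => natElim f h (h + i) (h + j)) i j = natFactors f (h + i) (h + j) := by
  simp only [natFactors, natElim_shift, add_lt_add_iff_left]

/-- The elimination steps decompose the matrix. -/
theorem eq_natElim_add_sum (k i j : ℕ) :
    f i j = natElim f k i j + ∑ l ∈ Finset.range k,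
      if l < i then natElim f l i l / natElim f l l l * natElim f l l j else 0 := by
  induction k with
  | zero => simp [natElim]
  | succ k ih =>
    rw [Finset.sum_range_succ, natElim_succ]
    split_ifs
    · rw [ih]
      ring
    · rw [add_zero]
      exact ih

variable {f}

/-- Step `j` clears column `j` below the diagonal; later steps subtract multiples of rows whose
entry in that column is already zero. -/
theorem natElim_eq_zero {i j k : ℕ} (hj : natElim f j j j ≠ 0) (hi : j < i) (hk : j < k) :
    natElim f k i j = 0 := by
  induction k, hk using Nat.le_induction generalizing i with
  | base => rw [natElim_succ, if_pos hi, div_mul_cancel₀ _ hj, sub_self]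
  | succ k hk ih =>
    rw [natElim_succ]
    split_ifs
    · rw [ih hi, ih hk, mul_zero, sub_zero]
    · exact ih hi

theorem IsOneSubInv.sub_eq {m : ℕ} {N T : ℕ → ℕ → K} (h : IsOneSubInv m N T) {x y : ℕ → K} {z : K}
    {i : ℕ} (hi : i < m) (hy : ∀ i < m, y i = ∑ l ∈ Finset.range m, T i l * x l)
    (hz : z = y i - ∑ l ∈ Finset.range m, N i l * y l) : z = x i := hz.trans (h.col hy hi)

/-- The telescoped elimination says `A₀₁ = L₀₀ U₀₁` columnwise, with unit lower triangular `L₀₀`.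
The unit diagonal is implicit in memory, and no pivot has to be nonzero here. -/
theorem run_luRightC (junk : ℕ → K) {sp s a m r : ℕ} (h : SqArgs sp a s m) (hm : 2 ≤ m) (M : ℕ → K)
    (hF : ∀ i < halfLen m false, ∀ j < halfLen m false, M (a + i * s + j) = natFactors f i j)
    (hR : ∀ i < halfLen m false, ∀ j < halfLen m true,
      M (quadAddr a s m false true i j) = f i (halfLen m false + j)) {i j : ℕ}
    (hi : i < halfLen m false) (hj : j < halfLen m true) :
    (luRightC sp s a m r).run FieldOp.interp junk sp M (quadAddr a s m false true i j) =
      natFactors f i (halfLen m false + j) := by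
  obtain ⟨M', e, hM', hN⟩ := run_withInvC (sp := sp) (a := a) (ar := s) (ac := 1) (u := 1) (r := r)
    (p := gemmC fieldKernel (sp + halfLen m false * halfLen m false)
      (a + offset m false * s + offset m true) s sp (halfLen m false)
      (a + offset m false * s + offset m true) s 1 (halfLen m false) (halfLen m true)
      (halfLen m false) r) junk (halfLen_bounds hm _).1
    (fun i hi j hj => h.hA _ (right_source hm i hi j hj)) M (fun h => absurd h one_ne_zero)
  have hM'' : ∀ l < halfLen m false, M' (quadAddr a s m false true l j) = f l (halfLen m false + j) :=
    fun l hl => by rw [hM' _ (h.hA _ (quad_quadAddr hl hj).blk), hR l hl j hj]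
  rw [luRightC, e, quadAddr, run_gemmC_sub junk (h.right hm) M' hi hj]
  refine (hN.sub_eq (x := fun l => natFactors f l (halfLen m false + j))
    (y := fun l => f l (halfLen m false + j)) hi (fun i hi => ?_) ?_)
  · have hlow : ∀ l < halfLen m false, lowerTri 1 (fun i j => M (a + i * s + j * 1)) i l *
        natFactors f l (halfLen m false + j) = (if l < i then natElim f l i l / natElim f l l l *
          natElim f l l (halfLen m false + j) else 0) +
            if i = l then natElim f i i (halfLen m false + j) else 0 := fun l hl => by
      rw [lowerTri, natFactors_of_le f (by omega : l ≤ halfLen m false + j)]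
      rcases lt_trichotomy l i with hli | rfl | hli
      · rw [if_pos hli, if_pos hli, if_neg hli.ne', mul_one, hF i hi l hl, natFactors_of_lt f hli,
          add_zero]
      · simp
      · rw [if_neg hli.not_gt, if_neg hli.not_gt, if_neg hli.ne, if_neg hli.ne, zero_mul, add_zero]
    rw [Finset.sum_congr rfl fun l hl => hlow l (Finset.mem_range.1 hl), Finset.sum_add_distrib,
      Finset.sum_ite_eq, if_pos (Finset.mem_range.2 hi),
      add_comm (Finset.sum _ _), ← natElim_of_le f le_rfl hi.le (halfLen m false + j)]
    exact eq_natElim_add_sum f _ _ _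
  · rw [← hM'' i hi, quadAddr]
    congr 1
    refine Finset.sum_congr rfl fun l hl => ?_
    rw [← hM'' l (Finset.mem_range.1 hl), quadAddr, mul_one]

/-- Transposed, `A₁₀ = L₁₀ U₀₀` is a lower triangular system for each row of `L₁₀`. Its diagonal
consists of pivots of the first half, so they must be nonzero. -/
theorem run_luLeftC (junk : ℕ → K) {sp s a m r : ℕ} (h : SqArgs sp a s m) (hm : 2 ≤ m) (M : ℕ → K)
    (hd : ∀ l < halfLen m false, natElim f l l l ≠ 0)
    (hF : ∀ i < halfLen m false, ∀ j < halfLen m false, M (a + i * s + j) = natFactors f i j)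
    (hL : ∀ i < halfLen m true, ∀ j < halfLen m false,
      M (quadAddr a s m true false i j) = f (halfLen m false + i) j) {i j : ℕ}
    (hi : i < halfLen m true) (hj : j < halfLen m false) :
    (luLeftC sp s a m r).run FieldOp.interp junk sp M (quadAddr a s m true false i j) =
      natFactors f (halfLen m false + i) j := by
  obtain ⟨M', e, hM', hN⟩ := run_withInvC (sp := sp) (a := a) (ar := 1) (ac := s) (u := 0) (r := r)
    (p := gemmC fieldKernel (sp + halfLen m false * halfLen m false)
      (a + offset m true * s + offset m false) s (a + offset m true * s + offset m false) s sp 1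
      (halfLen m false) (halfLen m true) (halfLen m false) (halfLen m false) r) junk
    (halfLen_bounds hm _).1 (fun i hi j hj => h.hA _ (left_source hm i hi j hj)) M (fun _ i hi => by
      rw [mul_one, add_right_comm, hF i hi i hi, natFactors_of_le f le_rfl]
      exact hd i hi)
  have hM'' : ∀ l < halfLen m false, M' (quadAddr a s m true false i l) = f (halfLen m false + i) l :=
    fun l hl => by rw [hM' _ (h.hA _ (quad_quadAddr hi hl).blk), hL i hi l hl]
  rw [luLeftC, e, quadAddr, run_gemmC_sub junk (h.left hm) M' hi hj]
  refine (hN.sub_eq (x := fun l => natFactors f (halfLen m false + i) l)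
    (y := fun l => f (halfLen m false + i) l) hj (fun j hj => ?_) ?_)
  -- The remainder of the telescoped sum vanishes: column `j` of a lower row has been cleared after
  -- the first half of the steps.
  · rw [eq_natElim_add_sum f (halfLen m false) (halfLen m false + i) j,
      natElim_eq_zero (hd j hj) (by omega) hj, zero_add]
    refine Finset.sum_congr rfl fun l hl => ?_
    have hl := Finset.mem_range.1 hl
    rw [if_pos (by omega), natFactors_of_lt f (by omega), mul_comm (lowerTri _ _ _ _)]
    congr 1
    rw [lowerTri]
    rcases lt_trichotomy l j with hlj | rfl | hlj
    · rw [if_pos hlj, mul_one, add_right_comm, hF l hl j hj, natFactors_of_le f hlj.le]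
    · rw [if_neg (lt_irrefl l), if_pos rfl, if_pos rfl, mul_one, add_right_comm, hF l hl l hl,
        natFactors_of_le f le_rfl]
    · rw [if_neg hlj.not_gt, if_neg hlj.ne, natElim_eq_zero (hd j hj) hlj hlj]
  · rw [← hM'' j hj, quadAddr]
    congr 1
    refine Finset.sum_congr rfl fun l hl => ?_
    rw [← hM'' l (Finset.mem_range.1 hl), quadAddr, mul_one, mul_comm, add_right_comm]

/-- Each quadrant is final after the stage that computes it: `L₀₀` and `U₀₀`, then `U₀₁`, then
`L₁₀`. The product update turns the last quadrant into the Schur complement, to which the induction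
hypothesis applies. -/
theorem run_luC (junk : ℕ → K) {sp s a m r : ℕ} (h : SqArgs sp a s m) (M : ℕ → K)
    (hd : ∀ l, l + 1 < m → natElim f l l l ≠ 0)
    (hf : ∀ i < m, ∀ j < m, M (a + i * s + j) = f i j) :
    ∀ i < m, ∀ j < m,
      (luC sp s a m r).run FieldOp.interp junk sp M (a + i * s + j) = natFactors f i j := by
  fun_induction luC sp s a m r generalizing M f with
  | case1 a m r hm =>
    intro i hi j hj
    obtain rfl : i = 0 := by omega
    obtain rfl : j = 0 := by omega
    exact hf 0 hi 0 hj
  | case2 a m r hm ih₁ ih₂ =>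
    have hm₂ : 2 ≤ m := by omega
    have hF := h.quad hm₂ false
    have hT := h.quad hm₂ true
    have hof : offset m false = 0 := rfl
    have hot : offset m true = halfLen m false := rfl
    have hlf : halfLen m false = m / 2 := rfl
    have hlt : halfLen m true = m - m / 2 := rfl
    simp only [Comp.run]
    set M₁ := (luC sp s (a + offset m false * s + offset m false) (halfLen m false)
      (nextRatio r)).run FieldOp.interp junk sp M with hM₁
    set M₂ := (luRightC sp s a m r).run FieldOp.interp junk sp M₁ with hM₂
    set M₃ := (luLeftC sp s a m r).run FieldOp.interp junk sp M₂ with hM₃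
    set M₄ := (quadC fieldKernel sp a s m r true true false).run FieldOp.interp junk sp M₃ with hM₄
    set M₅ := (luC sp s (a + offset m true * s + offset m true) (halfLen m true)
      (nextRatio r)).run FieldOp.interp junk sp M₄ with hM₅
    have e₁ : ∀ {x y i j}, (x, y) ≠ (false, false) → i < halfLen m x → j < halfLen m y →
        M₁ (quadAddr a s m x y i j) = M (quadAddr a s m x y i j) := fun hne hi hj =>
      run_quadAddr_of_ne h (touches_luC hF) hne M hi hj
    have e₂ : ∀ {x y i j}, (x, y) ≠ (false, true) → i < halfLen m x → j < halfLen m y →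
        M₂ (quadAddr a s m x y i j) = M₁ (quadAddr a s m x y i j) := fun hne hi hj =>
      run_quadAddr_of_ne h (touches_luRightC h hm₂) hne M₁ hi hj
    have e₃ : ∀ {x y i j}, (x, y) ≠ (true, false) → i < halfLen m x → j < halfLen m y →
        M₃ (quadAddr a s m x y i j) = M₂ (quadAddr a s m x y i j) := fun hne hi hj =>
      run_quadAddr_of_ne h (touches_luLeftC h hm₂) hne M₂ hi hj
    have e₄ : ∀ {x y i j}, (x, y) ≠ (true, true) → i < halfLen m x → j < halfLen m y →
        M₄ (quadAddr a s m x y i j) = M₃ (quadAddr a s m x y i j) := fun hne hi hj =>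
      run_quadAddr_of_ne h (touches_quadC h hm₂ _ _ _) hne M₃ hi hj
    have e₅ : ∀ {x y i j}, (x, y) ≠ (true, true) → i < halfLen m x → j < halfLen m y →
        M₅ (quadAddr a s m x y i j) = M₄ (quadAddr a s m x y i j) := fun hne hi hj =>
      run_quadAddr_of_ne h (touches_luC hT) hne M₄ hi hj
    have a₀ : ∀ i j, quadAddr a s m false false i j = a + i * s + j := fun i j => by
      rw [quadAddr_eq, hof, zero_add, zero_add]
    have a₁ : ∀ i j, quadAddr a s m false true i j = a + i * s + (halfLen m false + j) := fun i j => by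
      rw [quadAddr_eq, hof, hot, zero_add]
    have a₂ : ∀ i j, quadAddr a s m true false i j = a + (halfLen m false + i) * s + j := fun i j => by
      rw [quadAddr_eq, hof, hot, zero_add]
    have a₃ : ∀ i j, quadAddr a s m true true i j =
        a + (halfLen m false + i) * s + (halfLen m false + j) := fun i j => by
      rw [quadAddr_eq, hot]
    have v₀ : ∀ i < halfLen m false, ∀ j < halfLen m false,
        M₁ (quadAddr a s m false false i j) = natFactors f i j :=
      ih₁ hF M (fun l hl => hd l (by omega)) fun i hi j hj => by
        rw [hof, zero_mul, add_zero, add_zero]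
        exact hf i (by omega) j (by omega)
    have v₁ : ∀ i < halfLen m false, ∀ j < halfLen m true,
        M₂ (quadAddr a s m false true i j) = natFactors f i (halfLen m false + j) := fun i hi j hj =>
      run_luRightC junk h hm₂ M₁ (fun i hi j hj => by rw [← a₀, v₀ i hi j hj]) (fun i hi j hj => by
        rw [e₁ (by simp) hi hj, a₁, hf i (by omega) _ (by omega)]) hi hj
    have v₂ : ∀ i < halfLen m true, ∀ j < halfLen m false,
        M₃ (quadAddr a s m true false i j) = natFactors f (halfLen m false + i) j := fun i hi j hj =>
      run_luLeftC junk h hm₂ M₂ (fun l hl => hd l (by omega))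
        (fun i hi j hj => by rw [← a₀, e₂ (by simp) hi hj, v₀ i hi j hj]) (fun i hi j hj => by
          rw [e₂ (by simp) hi hj, e₁ (by simp) hi hj, a₂, hf _ (by omega) j (by omega)]) hi hj
    have v₃ : ∀ i < halfLen m true, ∀ j < halfLen m true, M₄ (quadAddr a s m true true i j) =
        natElim f (halfLen m false) (halfLen m false + i) (halfLen m false + j) := fun i hi j hj => by
      rw [hM₄, run_quadC_sub junk h hm₂ true true false M₃ hi hj, e₃ (by simp) hi hj,
        e₂ (by simp) hi hj, e₁ (by simp) hi hj, a₃, hf _ (by omega) _ (by omega), sub_eq_iff_eq_add,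
        eq_natElim_add_sum f (halfLen m false) (halfLen m false + i) (halfLen m false + j)]
      congr 1
      refine Finset.sum_congr rfl fun l hl => ?_
      have hl := Finset.mem_range.1 hl
      rw [v₂ i hi l hl, e₃ (by simp) hl hj, v₁ l hl j hj, if_pos (by omega),
        natFactors_of_lt f (by omega), natFactors_of_le f (by omega)]
    have v₄ : ∀ i < halfLen m true, ∀ j < halfLen m true, M₅ (quadAddr a s m true true i j) =
        natFactors f (halfLen m false + i) (halfLen m false + j) := fun i hi j hj => by
      rw [← natFactors_shift]
      refine ih₂ hT M₄ (fun l hl => ?_) (fun i hi j hj => v₃ i hi j hj) i hi j hj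
      rw [natElim_shift]
      -- The last pivot may be zero. It is never a divisor, and the condition `l + 1 < m` is
      -- preserved by the shift.
      exact hd _ (by omega)
    intro i hi j hj
    rcases lt_or_ge i (halfLen m false) with hi' | hi' <;>
      rcases lt_or_ge j (halfLen m false) with hj' | hj'
    · rw [← a₀, e₅ (by simp) hi' hj', e₄ (by simp) hi' hj', e₃ (by simp) hi' hj',
        e₂ (by simp) hi' hj', v₀ i hi' j hj']
    · obtain ⟨j, rfl⟩ := Nat.exists_eq_add_of_le hj'
      have hj'' : j < halfLen m true := by omega
      rw [← a₁, e₅ (by simp) hi' hj'', e₄ (by simp) hi' hj'', e₃ (by simp) hi' hj'', v₁ i hi' j hj'']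
    · obtain ⟨i, rfl⟩ := Nat.exists_eq_add_of_le hi'
      have hi'' : i < halfLen m true := by omega
      rw [← a₂, e₅ (by simp) hi'' hj', e₄ (by simp) hi'' hj', v₂ i hi'' j hj']
    · obtain ⟨i, rfl⟩ := Nat.exists_eq_add_of_le hi'
      obtain ⟨j, rfl⟩ := Nat.exists_eq_add_of_le hj'
      rw [← a₃, v₄ i (by omega) j (by omega)]

variable {n : ℕ} {A : Matrix (Fin n) (Fin n) K}

theorem elim_eq_natElim (hA : ∀ i j : Fin n, f i j = A i j) (k : ℕ) (i j : Fin n) :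
    elim A k i j = natElim f k i j := by
  induction k generalizing i j with
  | zero => exact (hA i j).symm
  | succ k ih =>
    rw [natElim_succ, elim]
    beta_reduce
    split_ifs
    · simp only [ih]
    · exact ih i j

theorem factors_eq_natFactors (hA : ∀ i j : Fin n, f i j = A i j) (i j : Fin n) :
    (if j < i then lowerFactor A i j else upperFactor A i j) = natFactors f i j := by
  simp only [lowerFactor, upperFactor, natFactors, elim_eq_natElim hA, Fin.lt_def]
  split_ifs
  · rfl
  · exact natElim_of_le f le_rfl i.2.le j

theorem natElim_ne_zero (hA : ∀ i j : Fin n, f i j = A i j) (h : PivotsNonzero A) {l : ℕ}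
    (hl : l + 1 < n) : natElim f l l l ≠ 0 := by
  have := h ⟨l, by omega⟩ hl
  rwa [elim_eq_natElim hA] at this

theorem exists_nat_entries (A : Matrix (Fin n) (Fin n) K) :
    ∃ f : ℕ → ℕ → K, ∀ i j : Fin n, f i j = A i j :=
  ⟨fun i j => if h : i < n ∧ j < n then A ⟨i, h.1⟩ ⟨j, h.2⟩ else 0, fun i j => by simp⟩

theorem upperFactor_eq_zero (h : PivotsNonzero A) {i j : Fin n} (hij : j < i) :
    upperFactor A i j = 0 := by
  obtain ⟨f, hA⟩ := exists_nat_entries A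
  have hij' : (j : ℕ) < i := hij
  rw [upperFactor, elim_eq_natElim hA]
  exact natElim_eq_zero (natElim_ne_zero hA h (by omega)) hij j.2

/-- Pure telescoping: whatever the multipliers are, what has been subtracted from a row is added
back. Nonzero pivots matter only for the triangular shape of the upper factor. -/
theorem lowerFactor_mul_upperFactor (A : Matrix (Fin n) (Fin n) K) :
    lowerFactor A * upperFactor A = A := by
  obtain ⟨f, hA⟩ := exists_nat_entries A
  ext i j
  have e : ∀ l : Fin n, lowerFactor A i l * upperFactor A l j =
      (if (l : ℕ) < i then natElim f l i l / natElim f l l l * natElim f l l j else 0) +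
        if i = l then natElim f n i j else 0 := fun l => by
    simp only [lowerFactor, upperFactor, elim_eq_natElim hA, Fin.lt_def,
      natElim_of_le f (le_refl (l : ℕ)) l.2.le]
    rcases lt_trichotomy (l : ℕ) i with hl | hl | hl
    · rw [if_pos hl, if_pos hl, if_neg (by rintro rfl; omega), add_zero]
    · obtain rfl := Fin.ext hl
      rw [if_neg (lt_irrefl _), if_neg (lt_irrefl _), if_pos rfl, if_pos rfl, one_mul, zero_add,
        natElim_of_le f le_rfl l.2.le]
    · rw [if_neg hl.not_gt, if_neg hl.not_gt, if_neg (by rintro rfl; omega),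
        if_neg (by rintro rfl; omega), zero_mul, zero_add]
  rw [Matrix.mul_apply, Finset.sum_congr rfl fun l _ => e l, Finset.sum_add_distrib,
    Finset.sum_ite_eq, if_pos (Finset.mem_univ _), add_comm, ← hA i j,
    Fin.sum_univ_eq_sum_range fun l => if l < (i : ℕ) then natElim f l i l / natElim f l l l *
      natElim f l l j else 0]
  exact (eq_natElim_add_sum f n i j).symm

end Elimination

theorem computesGaussianElimination_luProgram : ComputesGaussianElimination.{u} fun n w =>
    .tick (searchC (fun r => luC (n ^ 2) n 0 n r) n w 1) := by
  intro K _ n w A m junk hn hw hp hA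
  obtain ⟨j, r, -, -, e⟩ := exists_tick_eq (fun n r => luC (n ^ 2) n 0 n r) hn hw
  refine ⟨fun i j => ?_, fun i j => upperFactor_eq_zero hp, lowerFactor_mul_upperFactor A⟩
  set f : ℕ → ℕ → K := fun i j => m (0 + i * n + j)
  have hf : ∀ i j : Fin n, f i j = A i j := hA
  beta_reduce
  rw [e, run_iterate_tick, factors_eq_natFactors hf]
  exact run_luC junk (sqArgs_whole hn) m (fun l hl => natElim_ne_zero hf hp hl) (fun _ _ _ _ => rfl)
    i i.2 j j.2

/-! ### The three algorithms together. -/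

theorem mainTheorem9 :
    (∃ (P : Program SemiringOp) (G : ℕ → ℕ → Comp SemiringOp),
      Generates P (fun n => n ^ 2) G ∧ Safe (fun n => n ^ 2) G ∧ ComputesKleene.{u} G ∧
      CubicWork G ∧ LinearSpan G ∧ SymCacheBound G ∧ AsymCacheBound G) ∧
    (∃ (P : Program FieldOp) (G : ℕ → ℕ → Comp FieldOp),
      Generates P (fun n => n ^ 2) G ∧ Safe (fun n => n ^ 2) G ∧
      ComputesGaussianElimination.{u} G ∧
      CubicWork G ∧ LinearSpan G ∧ SymCacheBound G ∧ AsymCacheBound G) ∧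
    (∃ (P : Program FieldOp) (G : ℕ → ℕ → Comp FieldOp),
      Generates P (fun n => 2 * n ^ 2) G ∧ Safe (fun n => 2 * n ^ 2) G ∧
      SolvesTriangularSystem.{u} G ∧
      CubicWork G ∧ LinearSpan G ∧ SymCacheBound G ∧ AsymCacheBound G) := by
  have h₁ := efficient_kleeneC.bounds
  have h₂ := efficient_luC.bounds
  have h₃ := efficient_solveC.bounds
  exact ⟨⟨_, _, generates_kleeneProgram, h₁.1, computesKleene_kleeneProgram, h₁.2⟩,
    ⟨_, _, generates_luProgram, h₂.1, computesGaussianElimination_luProgram, h₂.2⟩,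
    ⟨_, _, generates_solveProgram, h₃.1, solvesTriangularSystem_solveProgram, h₃.2⟩⟩
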